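/- Let $X$ be a finite regular CW complex (each characteristic map is a homeomorphism onto its closed cell), with cells partially ordered by $x\le y$ iff the closed cell $x$ is contained in the closed cell $y$. Let $f$ be a discrete Morse function on $X$, i.e. a real-valued function on the cells such that each $k$-cell $x$ has at most one $(k+1)$-cell $y\ge x$ with $f(x)\ge f(y)$ and at most one $(k-1)$-cell $y\le x$ with $f(y)\ge f(x)$. A pair $\{x,y\}$ with $x\le y$, $\dim y=\dim x+1$ and $f(x)\ge f(y)$ is called regular; cells lying in no regular pair are called critical. The entrance path category $\mathrm{Ent}[X]$ has the cells as objects and the strictly descending sequences $(x=x_0>\dots>x_k=y)$ as morphisms $x\to y$ (with $\mathrm{id}_x=(x)$), composed by concatenation at the common cell, and $p\Rightarrow p'$ iff $p$ is a subsequence of $p'$. Let $\Sigma$ be the set of morphisms $(y>x)$ with $\{x,y\}$ regular, and $\Sigma^+$ its union with the identities. The localization $\mathrm{Loc}_\Sigma[X]$ has the same objects; its morphisms $w\to z$ are zigzags $$w\xrightarrow{g_0}y_0\xleftarrow{f_0}x_0\xrightarrow{g_1}y_1\xleftarrow{f_1}\cdots\xleftarrow{f_k}x_k\xrightarrow{g_{k+1}}z\qquad(f_i\in\Sigma^+,\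 g_i\text{ arbitrary};\text{ a single morphism } w\to z\text{ is allowed}),$$ modulo the equivalence relation generated by deleting intermediate identity maps (and composing the neighbouring maps) and by relating two zigzags of equal length that are the rows of a commutative diagram whose outer vertical maps are $\mathrm{id}_w,\mathrm{id}_z$ and whose other vertical maps lie in $\Sigma^+$. Composition is concatenation. One sets $\gamma'\Rightarrow\gamma$ iff there are representatives of $\gamma$ (top row) and $\gamma'$ (bottom row) in a not necessarily commutative diagram of the same shape such that, in each square, the composite along the bottom row is $\Rightarrow$ the composite along the top row. The discrete flow category $\mathrm{Flo}_\Sigma[X]$ is the full subcategory of $\mathrm{Loc}_\Sigma[X]$ on the critical cells. Then $\mathrm{Flo}_\Sigma[X]$ is a p-category (the relation $\Rightarrow$ is a partial order on each Hom set, compatible with composition). Let $\mathbb{N}\mathrm{Flo}_\Sigma[X]\colon\Delta^{\mathrm{op}}\to\mathsf{Cat}$ be the simplicial category whose $n$-th level $(\mathbb{N}\mathrm{Flo}_\Sigma[X])([n])$ has (copies of) the critical cells as objects and, as morphisms $a\to b$, the chains $f_0\Rightarrow f_1\Rightarrow\dots\Rightarrow f_n$ in $\mathrm{Hom}(a,b)$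 (the $n$-simplices of the nerve of this poset), composed entrywise. Then for every $n\ge 0$ the category $(\mathbb{N}\mathrm{Flo}_\Sigma[X])([n])$ is a unique factorization category, that is: 1. it has finitely many objects and morphisms, its only endomorphisms are identities, and for objects $a\ne b$, if $\mathrm{Hom}(a,b)\neq\emptyset$ then $\mathrm{Hom}(b,a)=\emptyset$; 2. each non-identity morphism can be written in exactly one way as a composition of non-identity indecomposable morphisms, where a morphism is indecomposable if it is not a composite of two non-identity morphisms. -/

import Mathlib

open CategoryTheory Topology

universe v u

/-! ## Categories with ordered Hom sets (p-categories) -/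

/-- A reflexive relation `f ⇒ f'` on the Hom sets of a category, compatible with composition. -/
class HomOrder (C : Type u) [Category.{v} C] where
  /-- `le f f'` is the relation `f ⇒ f'`. -/
  le : HomRel C
  le_refl {a b : C} (f : a ⟶ b) : le f f
  comp_le_comp {a b c : C} {f f' : a ⟶ b} {g g' : b ⟶ c} :
    le f f' → le g g' → le (f ≫ g) (f' ≫ g')

/-- A p-category, i.e. a category enriched in posets: each relation `⇒` on a Hom set is a partial
order (compatibility with composition is part of `HomOrder`). -/
structure IsPCategory (C : Type u) [Category.{v} C] [HomOrder C] : Prop where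
  trans {a b : C} {f g h : a ⟶ b} : HomOrder.le f g → HomOrder.le g h → HomOrder.le f h
  antisymm {a b : C} {f g : a ⟶ b} : HomOrder.le f g → HomOrder.le g f → f = g

/-! ## The simplicial category `NN C` -/

/-- The objects of `(NN C)([n])`: the `n`-fold degeneracies `(s₀)ⁿ a` of the objects `a` of `C`. -/
@[ext]
structure NNLevel (C : Type u) (n : ℕ) where
  /-- the object of which this is the degeneracy -/
  as : C

/-- The morphisms of `(NN C)([n])` are the `n`-simplices `f₀ ⇒ f₁ ⇒ ⋯ ⇒ fₙ` of the nerve of the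
Hom poset, i.e. the monotone maps from `[n]` to the Hom poset; they are composed entrywise. -/
instance NNLevel.category (C : Type u) [Category.{v} C] [HomOrder C] (n : ℕ) :
    Category.{v} (NNLevel C n) where
  Hom a b := {F : Fin (n + 1) → (a.as ⟶ b.as) // ∀ i j, i ≤ j → HomOrder.le (F i) (F j)}
  id a := ⟨fun _ => 𝟙 a.as, fun _ _ _ => HomOrder.le_refl _⟩
  comp F G := ⟨fun i => F.1 i ≫ G.1 i,
    fun i j h => HomOrder.comp_le_comp (F.2 i j h) (G.2 i j h)⟩
  id_comp F := Subtype.ext (funext fun i => Category.id_comp (F.1 i))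
  comp_id F := Subtype.ext (funext fun i => Category.comp_id (F.1 i))
  assoc F G H := Subtype.ext (funext fun i => Category.assoc (F.1 i) (G.1 i) (H.1 i))

/-- The functor `(NN C)([n]) ⥤ (NN C)([m])` induced by a monotone map `[m] → [n]`. -/
def NNLevel.map (C : Type u) [Category.{v} C] [HomOrder C] {m n : ℕ}
    (θ : Fin (m + 1) →o Fin (n + 1)) : NNLevel C n ⥤ NNLevel C m where
  obj a := ⟨a.as⟩
  map F := ⟨fun i => F.1 (θ i), fun _ _ h => F.2 _ _ (θ.monotone h)⟩

/-- The simplicial category `NN C` of a category with ordered Hom sets. -/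
def NN (C : Type u) [Category.{v} C] [HomOrder C] : SimplexCategoryᵒᵖ ⥤ Cat.{v, u} where
  obj n := Cat.of (NNLevel C n.unop.len)
  map θ := (NNLevel.map C θ.unop.toOrderHom).toCatHom
  map_id _ := rfl
  map_comp _ _ := rfl

/-! ## Unique factorization categories -/

section UFC

variable {C : Type u} [Category.{v} C]

/-- `f : a ⟶ b` is an identity morphism (in particular `a = b`). -/
def IsIdentity {a b : C} (f : a ⟶ b) : Prop := ∃ h : a = b, f = eqToHom h

/-- `f` is indecomposable: it is not a composite of two non-identity morphisms. -/
def IsIndecomposable {a b : C} (f : a ⟶ b) : Prop :=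
  ¬ ∃ (z : C) (g : a ⟶ z) (h : z ⟶ b), ¬ IsIdentity g ∧ ¬ IsIdentity h ∧ f = g ≫ h

/-- A string of composable morphisms all of which are non-identity and indecomposable. -/
def IsIndecomposableString {a : C} : ∀ {b : C}, Quiver.Path a b → Prop
  | _, .nil => True
  | _, .cons p f => IsIndecomposableString p ∧ ¬ IsIdentity f ∧ IsIndecomposable f

variable (C)

/-- A finite directed category: finitely many objects and morphisms, no endomorphisms except for
identities, and between two distinct objects there are morphisms in at most one direction. -/
structure IsFiniteDirected : Prop where
  finite_obj : Finite C
  finite_hom (a b : C) : Finite (a ⟶ b)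
  eq_id {a : C} (f : a ⟶ a) : f = 𝟙 a
  isEmpty_hom {a b : C} : a ≠ b → Nonempty (a ⟶ b) → IsEmpty (b ⟶ a)

/-- A unique factorization category: a finite directed category in which each non-identity morphism
is in a unique way a composition of non-identity indecomposable morphisms. -/
structure IsUniqueFactorizationCategory : Prop extends IsFiniteDirected C where
  existsUnique_factorization {a b : C} (f : a ⟶ b) : ¬ IsIdentity f →
    ∃! p : Quiver.Path a b, IsIndecomposableString p ∧ composePath p = f

end UFC

/-! ## The entrance path category -/

/-- The objects of the entrance path category of a poset `P` (of cells): the elements of `P`. -/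
@[ext]
structure Ent (P : Type u) where
  /-- the cell -/
  cell : P

/-- A strictly descending sequence `x = x₀ > x₁ > ⋯ > x_k = y`. -/
@[ext]
structure EntrancePath {P : Type u} [PartialOrder P] (x y : P) where
  /-- the cells `x₀, …, x_k` -/
  cells : List P
  descending : cells.IsChain (· > ·)
  head_eq : cells.head? = some x
  last_eq : cells.getLast? = some y

namespace EntrancePath

variable {P : Type u} [PartialOrder P]

lemma exists_cons {x y : P} (f : EntrancePath x y) : ∃ l, f.cells = x :: l := by
  have h := f.head_eq
  cases hc : f.cells with
  | nil => simp [hc] at h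
  | cons a l => simp [hc] at h; exact ⟨l, by rw [h]⟩

/-- The one-element sequence `(x)`. -/
def id (x : P) : EntrancePath x x := ⟨[x], by simp, rfl, rfl⟩

/-- Concatenation of sequences at their common end: the common cell is not repeated. -/
def comp {x y z : P} (f : EntrancePath x y) (g : EntrancePath y z) : EntrancePath x z where
  cells := f.cells ++ g.cells.tail
  descending := by
    obtain ⟨l, hl⟩ := g.exists_cons
    have hg := g.descending
    rw [hl] at hg ⊢
    refine List.IsChain.append f.descending hg.tail ?_
    intro a ha b hb
    rw [f.last_eq] at ha
    obtain rfl : y = a := by simpa using ha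
    cases l with
    | nil => simp at hb
    | cons c l =>
      obtain rfl : c = b := by simpa using hb
      exact (List.isChain_cons_cons.1 hg).1
  head_eq := by
    obtain ⟨l, hl⟩ := f.exists_cons
    simp [hl]
  last_eq := by
    obtain ⟨l, hl⟩ := g.exists_cons
    have hg := g.last_eq
    rw [hl] at hg ⊢
    cases l with
    | nil => simpa [f.last_eq] using hg
    | cons c l => simpa [List.getLast?_append, List.getLast?_cons_cons] using hg

end EntrancePath

/-- The entrance path category. -/
instance Ent.category (P : Type u) [PartialOrder P] : Category.{u} (Ent P) where
  Hom a b := EntrancePath a.cell b.cell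
  id a := EntrancePath.id a.cell
  comp f g := f.comp g
  id_comp f := by
    obtain ⟨l, hl⟩ := f.exists_cons
    exact EntrancePath.ext (by simp [EntrancePath.comp, EntrancePath.id, hl])
  comp_id f := EntrancePath.ext (by simp [EntrancePath.comp, EntrancePath.id])
  assoc f g h := by
    obtain ⟨l, hl⟩ := g.exists_cons
    exact EntrancePath.ext (by simp [EntrancePath.comp, hl])

/-- `f ⇒ f'` if and only if `f` is a (not necessarily contiguous) subsequence of `f'`. -/
instance Ent.homOrder (P : Type u) [PartialOrder P] : HomOrder (Ent P) where
  le _ _ f f' := List.Sublist (EntrancePath.cells f) (EntrancePath.cells f')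
  le_refl _ := List.Sublist.refl _
  comp_le_comp h h' := h.append h'.tail

lemma Ent.isPCategory (P : Type u) [PartialOrder P] : IsPCategory (Ent P) where
  trans h h' := List.Sublist.trans h h'
  antisymm h h' := EntrancePath.ext (List.Sublist.antisymm h h')

/-! ## Localization of p-categories -/

section Localization

variable {C : Type u} [Category.{v} C]

/-- Zigzags `w -g₀→ y₀ ←f₀- x₀ -g₁→ y₁ ←f₁- ⋯ ←f_k- x_k -g_{k+1}→ z` with the `fᵢ` in `W`;
the zigzag of a single morphism `w -g→ z` is allowed. -/
inductive LocZigzag (W : MorphismProperty C) : C → C → Type (max u v)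
  | last {w z : C} (g : w ⟶ z) : LocZigzag W w z
  | cons {w y x z : C} (g : w ⟶ y) (f : x ⟶ y) (hf : W f) (s : LocZigzag W x z) : LocZigzag W w z

namespace LocZigzag

variable {W : MorphismProperty C}

/-- Concatenation of zigzags: the last morphism of the first one is composed with the first
morphism of the second one. -/
def append {w m : C} : LocZigzag W w m → ∀ {z : C}, LocZigzag W m z → LocZigzag W w z
  | .last g, _, .last g' => .last (g ≫ g')
  | .last g, _, .cons g' f hf s => .cons (g ≫ g') f hf s
  | .cons g f hf s, _, t => .cons g f hf (s.append t)

/-- Elementary horizontal relations: the second zigzag arises from the first one by removing an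
intermediate identity map (pointing to the left, respectively to the right) and composing its two
neighbours. -/
inductive Horizontal : ∀ {w z : C}, LocZigzag W w z → LocZigzag W w z → Prop
  | left_id {w y z : C} (g : w ⟶ y) (h : W (𝟙 y)) (s : LocZigzag W y z) :
      Horizontal (.cons g (𝟙 y) h s) ((LocZigzag.last g).append s)
  | right_id {w y x x' z : C} (g : w ⟶ y) (f : x ⟶ y) (hf : W f) (f' : x' ⟶ x) (hf' : W f')
      (h : W (f' ≫ f)) (s : LocZigzag W x' z) :
      Horizontal (.cons g f hf (.cons (𝟙 x) f' hf' s)) (.cons g (f' ≫ f) h s)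
  | cons {w y x z : C} (g : w ⟶ y) (f : x ⟶ y) (hf : W f) {s t : LocZigzag W x z} :
      Horizontal s t → Horizontal (.cons g f hf s) (.cons g f hf t)

/-- `Ladder R v s t` says that the zigzags `s` (top row) and `t` (bottom row) of equal length are
the rows of a diagram with vertical maps in `W`, leftmost vertical map `v` and rightmost vertical
map an identity, such that in each square the composite `p` along the bottom row and the composite
`q` along the top row satisfy `R p q`. -/
inductive Ladder (R : HomRel C) :
    ∀ {a a' z : C}, (a ⟶ a') → LocZigzag W a z → LocZigzag W a' z → Prop
  | last {a a' z : C} (v : a ⟶ a') (g : a ⟶ z) (g' : a' ⟶ z) :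
      R (v ≫ g') g → Ladder R v (.last g) (.last g')
  | cons {a a' y y' x x' z : C} (v : a ⟶ a')
      (g : a ⟶ y) (f : x ⟶ y) (hf : W f) (s : LocZigzag W x z)
      (g' : a' ⟶ y') (f' : x' ⟶ y') (hf' : W f') (s' : LocZigzag W x' z)
      (u : y ⟶ y') (hu : W u) (v' : x ⟶ x') (hv' : W v') :
      R (v ≫ g') (g ≫ u) → R (v' ≫ f') (f ≫ u) → Ladder R v' s s' →
      Ladder R v (.cons g f hf s) (.cons g' f' hf' s')

/-- Two zigzags are vertically related if they are the rows of a commutative diagram. -/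
def Vertical {w z : C} (s t : LocZigzag W w z) : Prop :=
  Ladder (fun _ _ p q => p = q) (𝟙 w) s t

/-- The relation that generates the equivalence relation on zigzags. -/
def Related {w z : C} (s t : LocZigzag W w z) : Prop := Horizontal s t ∨ Vertical s t

lemma append_assoc {a b c d : C} (r : LocZigzag W a b) (s : LocZigzag W b c) (t : LocZigzag W c d) :
    (r.append s).append t = r.append (s.append t) := by
  induction r with
  | last g => cases s <;> cases t <;> simp [append]
  | cons g f hf r ih => simp [append, ih]

lemma last_id_append {a b : C} (s : LocZigzag W a b) : (LocZigzag.last (𝟙 a)).append s = s := by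
  cases s <;> simp [append]

lemma append_last_id {a b : C} (s : LocZigzag W a b) : s.append (.last (𝟙 b)) = s := by
  induction s with
  | last g => simp [append]
  | cons g f hf s ih => simp [append, ih]

lemma Horizontal.append_right {a b c : C} {s s' : LocZigzag W a b} (h : Horizontal s s')
    (t : LocZigzag W b c) : Horizontal (s.append t) (s'.append t) := by
  induction h with
  | left_id g h s => rw [append_assoc]; exact .left_id g h _
  | right_id g f hf f' hf' h s => exact .right_id g f hf f' hf' h _
  | cons g f hf _ ih => exact .cons g f hf (ih t)

lemma Horizontal.append_left {a b c : C} (r : LocZigzag W a b) {s s' : LocZigzag W b c}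
    (h : Horizontal s s') : Horizontal (r.append s) (r.append s') := by
  induction r with
  | cons g f hf r ih => exact .cons g f hf (ih h)
  | last g =>
    cases h with
    | left_id g' h s =>
      have := Horizontal.left_id (g ≫ g') h s
      rwa [show LocZigzag.last (W := W) (g ≫ g') = (LocZigzag.last g).append (.last g') from rfl,
        append_assoc] at this
    | right_id g' f hf f' hf' h s => exact .right_id _ f hf f' hf' h s
    | cons g' f hf h => exact .cons _ f hf h

lemma Ladder.append {R : HomRel C}
    (hR : ∀ {a b c : C} {f f' : a ⟶ b} {g g' : b ⟶ c}, R f f' → R g g' → R (f ≫ g) (f' ≫ g'))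
    {a a' b c : C} {v : a ⟶ a'} {s : LocZigzag W a b} {s' : LocZigzag W a' b}
    (h : Ladder R v s s') {t t' : LocZigzag W b c} (h' : Ladder R (𝟙 b) t t') :
    Ladder R v (s.append t) (s'.append t') := by
  induction h with
  | last v g g' hg =>
    cases h' with
    | last _ k k' hk =>
      refine .last _ _ _ ?_
      rw [← Category.assoc]
      exact hR hg (by simpa using hk)
    | cons _ k f hf s k' f' hf' s' u hu v' hv' hk hk' hs =>
      refine .cons _ _ f hf s _ f' hf' s' u hu v' hv' ?_ hk' hs
      rw [← Category.assoc, Category.assoc g k u]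
      exact hR hg (by simpa using hk)
  | cons v g f hf s g' f' hf' s' u hu v' hv' h₁ h₂ _ ih =>
    exact .cons _ g f hf _ g' f' hf' _ u hu v' hv' h₁ h₂ (ih h')

lemma Ladder.refl [W.ContainsIdentities] {R : HomRel C}
    (hR : ∀ {a b : C} (f : a ⟶ b), R f f) {a b : C} (s : LocZigzag W a b) :
    Ladder R (𝟙 a) s s := by
  induction s with
  | last g => exact .last _ _ _ (by simpa using hR g)
  | cons g f hf s ih =>
    exact .cons _ g f hf s g f hf s (𝟙 _) (W.id_mem _) (𝟙 _) (W.id_mem _)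
      (by simpa using hR g) (by simpa using hR f) ih

lemma Related.append_right [W.ContainsIdentities] {a b c : C} {s s' : LocZigzag W a b}
    (h : Related s s') (t : LocZigzag W b c) : Related (s.append t) (s'.append t) :=
  h.imp (fun h => h.append_right t) fun h =>
    Ladder.append (fun h h' => by rw [h, h']) h (Ladder.refl (fun _ => rfl) t)

lemma Related.append_left [W.ContainsIdentities] {a b c : C} (r : LocZigzag W a b)
    {s s' : LocZigzag W b c} (h : Related s s') : Related (r.append s) (r.append s') :=
  h.imp (fun h => h.append_left r) fun h =>
    Ladder.append (fun h h' => by rw [h, h']) (Ladder.refl (fun _ => rfl) r) h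

end LocZigzag

/-- The collection `S⁺`: the union of `S` with all identities. -/
def addIdentities (S : MorphismProperty C) : MorphismProperty C :=
  fun _ _ f => S f ∨ IsIdentity f

instance (S : MorphismProperty C) : (addIdentities S).ContainsIdentities where
  id_mem _ := Or.inr ⟨rfl, rfl⟩

/-- The objects of the localization of `C` at the collection `S`: the objects of `C`. -/
@[ext]
structure Loc (S : MorphismProperty C) where
  /-- the object of `C` -/
  obj : C

/-- Composition of equivalence classes of zigzags, by concatenating representatives. -/
def LocZigzag.quotComp {W : MorphismProperty C} [W.ContainsIdentities] {a b c : C}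
    (f : Quot (LocZigzag.Related (W := W) (w := a) (z := b)))
    (g : Quot (LocZigzag.Related (W := W) (w := b) (z := c))) :
    Quot (LocZigzag.Related (W := W) (w := a) (z := c)) :=
  Quot.map₂ (fun s t => s.append t) (fun r _ _ h => h.append_left r)
    (fun _ _ t h => h.append_right t) f g

/-- The localization of `C` at `S`: morphisms are zigzags with left-pointing maps in `S⁺`, modulo
the equivalence relation generated by the horizontal and vertical relations; they are composed by
concatenating representatives. -/
instance Loc.category (S : MorphismProperty C) : Category.{max u v} (Loc S) where
  Hom a b := Quot (LocZigzag.Related (W := addIdentities S) (w := a.obj) (z := b.obj))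
  id a := Quot.mk _ (.last (𝟙 a.obj))
  comp f g := LocZigzag.quotComp f g
  id_comp := by
    rintro a b ⟨s⟩
    exact congrArg (Quot.mk _) (LocZigzag.last_id_append s)
  comp_id := by
    rintro a b ⟨s⟩
    exact congrArg (Quot.mk _) (LocZigzag.append_last_id s)
  assoc := by
    rintro a b c d ⟨r⟩ ⟨s⟩ ⟨t⟩
    exact congrArg (Quot.mk _) (LocZigzag.append_assoc r s t)

/-- The morphism of the localization represented by a zigzag. -/
def Loc.homMk {S : MorphismProperty C} {a b : Loc S}
    (s : LocZigzag (addIdentities S) a.obj b.obj) : a ⟶ b :=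
  Quot.mk (LocZigzag.Related (W := addIdentities S) (w := a.obj) (z := b.obj)) s

lemma Loc.homMk_append {S : MorphismProperty C} {a b c : Loc S}
    (s : LocZigzag (addIdentities S) a.obj b.obj) (t : LocZigzag (addIdentities S) b.obj c.obj) :
    (Loc.homMk (s.append t) : a ⟶ c) = (Loc.homMk s : a ⟶ b) ≫ (Loc.homMk t : b ⟶ c) := rfl

/-- `γ' ⇒ γ` if and only if there are representatives `s` of `γ` and `t` of `γ'` that form the top
and the bottom row of a diagram with vertical maps in `S⁺` in whose squares the composite along the
bottom row is `⇒` the composite along the top row. -/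
instance Loc.homOrder [HomOrder C] (S : MorphismProperty C) : HomOrder (Loc S) where
  le a b γ' γ := ∃ s t : LocZigzag (addIdentities S) a.obj b.obj,
    Loc.homMk s = γ ∧ Loc.homMk t = γ' ∧ LocZigzag.Ladder HomOrder.le (𝟙 a.obj) s t
  le_refl := by
    rintro a b ⟨s⟩
    exact ⟨s, s, rfl, rfl, LocZigzag.Ladder.refl (fun f => HomOrder.le_refl f) s⟩
  comp_le_comp := by
    rintro a b c _ _ _ _ ⟨s, t, rfl, rfl, h⟩ ⟨s', t', rfl, rfl, h'⟩
    exact ⟨s.append s', t.append t', Loc.homMk_append s s', Loc.homMk_append t t',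
      h.append HomOrder.comp_le_comp h'⟩

end Localization

/-- The order on the Hom sets of a full subcategory. -/
instance fullSubcategoryHomOrder {C : Type u} [Category.{v} C] [HomOrder C]
    (P : ObjectProperty C) : HomOrder P.FullSubcategory where
  le _ _ f g := HomOrder.le f.hom g.hom
  le_refl f := HomOrder.le_refl f.hom
  comp_le_comp h h' := HomOrder.comp_le_comp h h'

/-! ## Regular CW complexes and discrete Morse functions -/

section Morse

variable {X : Type u} [TopologicalSpace X] (K : Set X) [CWComplex K]

/-- A CW complex is regular if its characteristic maps are injective on the closed ball, i.e. (in a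
Hausdorff space, by compactness) homeomorphisms onto the closed cells. -/
def IsRegularCW : Prop :=
  ∀ (n : ℕ) (e : RelCWComplex.cell K n),
    Set.InjOn (RelCWComplex.map n e) (Metric.closedBall 0 1)

/-- The cells of a CW complex. -/
structure CWCell where
  /-- the dimension of the cell -/
  dim : ℕ
  /-- the index of the cell among the cells of its dimension -/
  idx : RelCWComplex.cell K dim

variable {K}

/-- The closed cell as a subset of the ambient space. -/
def CWCell.carrier (x : CWCell K) : Set X := RelCWComplex.closedCell x.dim x.idx

lemma CWCell.dim_lt_or_eq {x y : CWCell K} (h : x.carrier ⊆ y.carrier) :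
    x.dim < y.dim ∨ x = y := by
  obtain ⟨n, e⟩ := x
  obtain ⟨m, e'⟩ := y
  have hp : RelCWComplex.map n e 0 ∈ RelCWComplex.openCell n e :=
    RelCWComplex.map_zero_mem_openCell n e
  have hq := h (RelCWComplex.openCell_subset_closedCell n e hp)
  rw [CWCell.carrier, ← RelCWComplex.cellFrontier_union_openCell_eq_closedCell] at hq
  rcases hq with hq | hq
  · left
    obtain ⟨I, hI⟩ := CWComplex.cellFrontier_subset_finite_openCell m e'
    obtain ⟨k, hk, j, hj, hkj⟩ : ∃ k, k < m ∧ ∃ j, j ∈ I k ∧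
        RelCWComplex.map n e 0 ∈ RelCWComplex.openCell k j := by
      simpa using hI hq
    have := RelCWComplex.eq_of_not_disjoint_openCell (Set.not_disjoint_iff.2 ⟨_, hp, hkj⟩)
    obtain ⟨rfl, -⟩ := Sigma.mk.inj_iff.1 this
    exact hk
  · right
    have := RelCWComplex.eq_of_not_disjoint_openCell (Set.not_disjoint_iff.2 ⟨_, hp, hq⟩)
    cases this
    rfl

/-- The face poset: `x ≤ y` if the closed cell `x` is contained in the closed cell `y`. -/
instance : PartialOrder (CWCell K) where
  le x y := x.carrier ⊆ y.carrier
  le_refl _ := Set.Subset.rfl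
  le_trans _ _ _ h h' := Set.Subset.trans h h'
  le_antisymm x y h h' := by
    rcases CWCell.dim_lt_or_eq h with h | h
    · rcases CWCell.dim_lt_or_eq h' with h' | h'
      · omega
      · exact h'.symm
    · exact h

/-- `{x, y}` is a regular pair of `f`: the cell `x` is a face of `y` of codimension one and
`f x ≥ f y`. -/
def IsRegularPair (f : CWCell K → ℝ) (x y : CWCell K) : Prop :=
  y.dim = x.dim + 1 ∧ x ≤ y ∧ f x ≥ f y

/-- Discrete Morse functions: for each `k`-cell `x` there are at most one `(k+1)`-cell `y ⊇ x` with
`f x ≥ f y` and at most one `(k-1)`-cell `y ⊆ x` with `f y ≥ f x`. -/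
structure IsDiscreteMorse (f : CWCell K → ℝ) : Prop where
  upper (x : CWCell K) : {y | IsRegularPair f x y}.Subsingleton
  lower (x : CWCell K) : {y | IsRegularPair f y x}.Subsingleton

/-- Critical cells: those that belong to no regular pair. -/
def IsCriticalCell (f : CWCell K → ℝ) (x : CWCell K) : Prop :=
  (¬ ∃ y, IsRegularPair f x y) ∧ ¬ ∃ y, IsRegularPair f y x

/-- The Morse system of `f`: the morphisms `(y > x)` of the entrance path category for the regular
pairs `{x, y}` of `f`. -/
def morseSystem (f : CWCell K → ℝ) : MorphismProperty (Ent (CWCell K)) :=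
  fun a b p => IsRegularPair f b.cell a.cell ∧ EntrancePath.cells p = [a.cell, b.cell]

/-- The discrete flow category of `f`: the full subcategory on the critical cells of the
localization of the entrance path category at the Morse system of `f`. -/
abbrev Flo (f : CWCell K → ℝ) : Type u :=
  ObjectProperty.FullSubcategory
    (fun a : Loc (morseSystem f) => IsCriticalCell f a.obj.cell)

end Morse

/-! Morphisms of the localization are put in normal form. A zigzag is read as a walk in the face
poset that descends freely and ascends only along regular pairs. Cancelling all backtrackings `x, y,
x` gives a reduced walk. The defining relations preserve it, and it determines the morphism, because
the order of two neighbouring cells dictates whether the step is an arrow or a formal inverse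
(`Loc.nf_injective`).

The relation `⇒` is then generated by inserting a cell `y` into a descent `x > z`
(`Loc.refines_of_le`, `Loc.le_of_refines`). One direction uses that no cell is the upper member of
one regular pair and the lower member of another, so that the squares over left-pointing arrows
commute automatically. For the other, a descent with room for a further cell is not a regular pair,
so it survives cancellation, and all insertions can be made in a single walk. Transitivity follows.
An insertion raises the signed length by one, which gives antisymmetry.

A critical cell lies on no matched edge, so nothing cancels at it and normal forms simply
concatenate there. Two factorizations of a morphism through critical cells are thus two cuts of one
list and have a common refinement (`Loc.equidivisible`). Likewise anything above a composite is a
composite of things above the factors (`Loc.le_split`), which carries equidivisibility over to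
chains of morphisms. Since dimension drops along non-identity morphisms, equidivisibility yields
unique factorization. Finiteness holds because along a reduced walk from a critical cell the
dimension, and at equal dimension the value of the Morse function, keeps dropping.

Topology enters only in showing that regular pairs do not chain. For `x < y < z` of consecutive
dimensions there must be a second intermediate cell `y'`, and the inequalities for `y'` contradict
those for `y`. If `y` were the only facet of `z` near a point of the open cell `x`, the boundary
sphere of `z` would there embed in the closed ball of `y`. By invariance of domain the point would
be interior to that ball, though it lies on its boundary. Invariance of domain is derived from
Brouwer's theorem, and that from a change of variables. -/

section Brouwer

/-! ### No smooth retraction of the ball onto the sphere. -/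

open Metric Set MeasureTheory

/-- Extrapolation by Lagrange interpolation at `n + 1` nodes in `(0, a]`. It carries a volume
identity known for small parameters `t` over to `t = 1`. -/
lemma exists_sum_eval_eq_eval_one (n : ℕ) {a : ℝ} (ha : 0 < a) :
    ∃ (s : Finset ℕ) (c v : ℕ → ℝ), (∀ i ∈ s, 0 < v i ∧ v i ≤ a) ∧
      ∀ p : Polynomial ℝ, p.natDegree ≤ n → p.eval 1 = ∑ i ∈ s, p.eval (v i) * c i := by
  have hv : Set.InjOn (fun i : ℕ => a / (i + 1)) (Finset.range (n + 1)) := by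
    intro i _ j _ h
    have h' : a / ((i : ℝ) + 1) = a / (j + 1) := h
    rw [div_eq_div_iff (by positivity) (by positivity)] at h'
    have := mul_left_cancel₀ ha.ne' h'
    have : (j : ℝ) = i := by linarith
    exact_mod_cast this.symm
  refine ⟨Finset.range (n + 1),
    fun i => (Lagrange.basis (Finset.range (n + 1)) (fun i : ℕ => a / (i + 1)) i).eval 1,
    fun i => a / (i + 1), fun i _ => ⟨by positivity, div_le_self ha.le ?_⟩, fun p hp => ?_⟩
  · have : (0 : ℝ) ≤ i := i.cast_nonneg
    linarith
  · have hd : p.degree < (Finset.range (n + 1)).card := by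
      rw [Finset.card_range]
      exact (Polynomial.degree_le_natDegree).trans_lt (by exact_mod_cast Nat.lt_succ_of_le hp)
    conv_lhs => rw [Lagrange.eq_interpolate hv hd]
    simp [Lagrange.interpolate_apply, Polynomial.eval_finsetSum]

variable {E : Type*} [NormedAddCommGroup E] [InnerProductSpace ℝ E] [FiniteDimensional ℝ E]

lemma exists_polynomial_det_one_add_smul (M : E →L[ℝ] E) :
    ∃ p : Polynomial ℝ, p.natDegree ≤ Module.finrank ℝ E ∧
      ∀ t : ℝ, p.eval t = (ContinuousLinearMap.id ℝ E + t • M).det := by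
  let b := Module.finBasis ℝ E
  let A := LinearMap.toMatrix b b (M : E →ₗ[ℝ] E)
  refine ⟨((Polynomial.X : Polynomial ℝ) • A.map Polynomial.C
    + (1 : Matrix _ _ ℝ).map Polynomial.C).det, ?_, fun t => ?_⟩
  · simpa using Polynomial.natDegree_det_X_add_C_le A 1
  · rw [ContinuousLinearMap.det, ← LinearMap.det_toMatrix b, ← Polynomial.coe_evalRingHom,
      RingHom.map_det]
    congr 1
    ext i j
    simp only [RingHom.mapMatrix_apply, Matrix.map_apply, Matrix.add_apply, Matrix.smul_apply,
      Polynomial.coe_evalRingHom, smul_eq_mul, Polynomial.eval_mul,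
      Polynomial.eval_X, Polynomial.eval_C, A, ContinuousLinearMap.toLinearMap_add,
      ContinuousLinearMap.toLinearMap_smul, map_add, map_smul, ContinuousLinearMap.coe_id,
      LinearMap.toMatrix_id]
    ring

/-- A Lipschitz perturbation of the identity supported in the unit ball preserves the signed
volume of the ball. -/
lemma integral_det_id_add_fderiv_of_lipschitz [MeasurableSpace E] [BorelSpace E]
    (μ : Measure E) [μ.IsAddHaarMeasure] {u : E → E} {K : NNReal} (hu : LipschitzWith K u)
    (h0 : ∀ x, x ∉ ball (0 : E) 1 → u x = 0) (hd : ∀ x ∈ ball (0 : E) 1, DifferentiableAt ℝ u x) :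
    ∫ x in ball (0 : E) 1, (ContinuousLinearMap.id ℝ E + fderiv ℝ u x).det ∂μ
      = μ.real (ball (0 : E) 1) := by
  have hcdet : Continuous (fun M : E →L[ℝ] E => M.det) := ContinuousLinearMap.continuous_det
  -- positivity of the determinant near the identity
  obtain ⟨δ, hδ, hpos⟩ : ∃ δ > 0, ∀ M : E →L[ℝ] E, ‖M‖ ≤ δ →
      0 < (ContinuousLinearMap.id ℝ E + M).det := by
    have h1 : ∀ᶠ M : E →L[ℝ] E in 𝓝 0, 0 < (ContinuousLinearMap.id ℝ E + M).det := by
      have : Continuous fun M : E →L[ℝ] E => (ContinuousLinearMap.id ℝ E + M).det :=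
        hcdet.comp (continuous_const.add continuous_id)
      refine this.continuousAt.eventually (lt_mem_nhds ?_)
      simp [ContinuousLinearMap.det]
    obtain ⟨δ, hδ, h⟩ := Metric.eventually_nhds_iff.1 h1
    exact ⟨δ / 2, half_pos hδ, fun M hM => h (by rw [dist_zero_right]; linarith)⟩
  -- For `t ≤ a` the first bound gives `‖t • Du‖ ≤ δ`, hence a positive determinant. The second
  -- gives `t * K < 1`, hence a bijection `x ↦ x + t • u x`.
  set a : ℝ := min (δ / (K + 1)) (1 / (2 * (K + 1))) with ha
  have hK : (0 : ℝ) < K + 1 := by positivity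
  have hapos : 0 < a := by positivity
  have hnorm : ∀ x, ‖fderiv ℝ u x‖ ≤ K := fun x => norm_fderiv_le_of_lipschitz ℝ hu
  have hmeas : Measurable (fderiv ℝ u) := measurable_fderiv ℝ u
  have hint : ∀ t : ℝ, IntegrableOn
      (fun x => (ContinuousLinearMap.id ℝ E + t • fderiv ℝ u x).det) (ball 0 1) μ := by
    intro t
    have hc : Continuous fun M : E →L[ℝ] E => (ContinuousLinearMap.id ℝ E + t • M).det :=
      hcdet.comp (by fun_prop)
    obtain ⟨B, hB⟩ := (isCompact_closedBall (0 : E →L[ℝ] E) K).exists_bound_of_continuousOn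
      hc.continuousOn
    refine Measure.integrableOn_of_bounded (M := B) measure_ball_lt_top.ne
      (hc.measurable.comp hmeas).aestronglyMeasurable (Filter.Eventually.of_forall fun x => ?_)
    exact hB _ (by simpa using hnorm x)
  have hsmall : ∀ t : ℝ, 0 < t → t ≤ a →
      ∫ x in ball (0 : E) 1, (ContinuousLinearMap.id ℝ E + t • fderiv ℝ u x).det ∂μ
        = μ.real (ball (0 : E) 1) := by
    intro t ht hta
    have htK : t * K < 1 := by
      have h1 : t ≤ 1 / (2 * (K + 1)) := hta.trans (min_le_right _ _)
      have h2 : t * (2 * (K + 1)) ≤ 1 := by rwa [le_div_iff₀ (by positivity)] at h1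
      have : (0 : ℝ) ≤ t * K := by positivity
      nlinarith
    let g : E → E := fun x => x + t • u x
    have hg : ApproximatesLinearOn g ((ContinuousLinearEquiv.refl ℝ E : E ≃L[ℝ] E) : E →L[ℝ] E)
        univ (t.toNNReal * K) := by
      intro x _ y _
      have : g x - g y - (x - y) = t • (u x - u y) := by simp only [g, smul_sub]; abel
      have h2 := hu.dist_le_mul x y
      rw [dist_eq_norm, dist_eq_norm] at h2
      simp only [ContinuousLinearEquiv.coe_refl, ContinuousLinearMap.coe_id', id]
      rw [this, norm_smul, Real.norm_of_nonneg ht.le, NNReal.coe_mul, Real.coe_toNNReal _ ht.le,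
        mul_assoc]
      gcongr
    have hc : Subsingleton E ∨ t.toNNReal * K <
        ‖((ContinuousLinearEquiv.refl ℝ E).symm : E →L[ℝ] E)‖₊⁻¹ := by
      rcases subsingleton_or_nontrivial E with h | h
      · exact Or.inl h
      · right
        have : ‖((ContinuousLinearEquiv.refl ℝ E).symm : E →L[ℝ] E)‖₊ = 1 := by
          ext; simp
        rw [this, inv_one, ← NNReal.coe_lt_coe, NNReal.coe_mul, Real.coe_toNNReal _ ht.le]
        exact htK
    have hinj : Function.Injective g := fun x y h =>
      congrArg Subtype.val (hg.injective hc (a₁ := ⟨x, trivial⟩) (a₂ := ⟨y, trivial⟩) h)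
    have hsurj := hg.surjective hc
    have hid : ∀ x, x ∉ ball (0 : E) 1 → g x = x := fun x hx => by simp [g, h0 x hx]
    -- A bijection of the space that is the identity off the ball permutes the ball.
    have himg : g '' ball 0 1 = ball 0 1 := by
      apply Subset.antisymm
      · rintro _ ⟨x, hx, rfl⟩
        by_contra h
        exact h ((hinj (hid _ h)).symm ▸ hx)
      · intro y hy
        obtain ⟨x, rfl⟩ := hsurj y
        by_cases hx : x ∈ ball (0 : E) 1
        · exact ⟨x, hx, rfl⟩
        · rw [hid x hx] at hy
          exact absurd hy hx
    have hder : ∀ x ∈ ball (0 : E) 1, HasFDerivWithinAt g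
        (ContinuousLinearMap.id ℝ E + t • fderiv ℝ u x) (ball 0 1) x := fun x hx =>
      ((hasFDerivAt_id x).add ((hd x hx).hasFDerivAt.const_smul t)).hasFDerivWithinAt
    have key := integral_image_eq_integral_abs_det_fderiv_smul μ measurableSet_ball hder
      hinj.injOn (fun _ => (1 : ℝ))
    rw [himg] at key
    simp only [integral_const, smul_eq_mul, mul_one, measureReal_restrict_apply_univ] at key
    rw [key]
    refine setIntegral_congr_fun measurableSet_ball fun x _ => ?_
    refine (abs_of_pos (hpos _ ?_)).symm
    rw [norm_smul, Real.norm_of_nonneg ht.le]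
    have h1 : t ≤ δ / (K + 1) := hta.trans (min_le_left _ _)
    have h2 : t * (K + 1) ≤ δ := by rwa [le_div_iff₀ hK] at h1
    have := mul_le_mul_of_nonneg_left (hnorm x) ht.le
    nlinarith
  -- The determinant is polynomial in `t`, so its integral at `t = 1` is a fixed combination of its
  -- integrals at small `t`, all equal to the volume.
  obtain ⟨s, c, v, hv, hs⟩ := exists_sum_eval_eq_eval_one (Module.finrank ℝ E) hapos
  have hsum : ∀ M : E →L[ℝ] E, (ContinuousLinearMap.id ℝ E + M).det
      = ∑ i ∈ s, (ContinuousLinearMap.id ℝ E + v i • M).det * c i := by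
    intro M
    obtain ⟨p, hp, h⟩ := exists_polynomial_det_one_add_smul M
    have := hs p hp
    simpa only [h, one_smul] using this
  have hone : ∑ i ∈ s, c i = 1 := by simpa [ContinuousLinearMap.det] using (hsum 0).symm
  rw [setIntegral_congr_fun measurableSet_ball fun x _ => hsum (fderiv ℝ u x)]
  rw [integral_finsetSum _ fun i _ => (hint (v i)).mul_const (c i)]
  simp_rw [integral_mul_const]
  rw [Finset.sum_congr rfl fun i hi => by rw [hsmall (v i) (hv i hi).1 (hv i hi).2],
    ← Finset.mul_sum, hone, mul_one]

/-- There is no continuously differentiable retraction of the closed unit ball onto the sphere. -/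
theorem no_contDiff_retraction {r : E → E} (hr : ∀ x ∈ closedBall (0 : E) 1, ContDiffAt ℝ 1 r x)
    (hr1 : ∀ x ∈ closedBall (0 : E) 1, ‖r x‖ = 1) (hid : ∀ x ∈ sphere (0 : E) 1, r x = x) :
    False := by
  classical
  borelize E
  let w : E → E := fun x => r x - x
  have hw : ∀ x ∈ closedBall (0 : E) 1, ContDiffAt ℝ 1 w x := fun x hx =>
    (hr x hx).sub contDiffAt_id
  obtain ⟨B, hB⟩ := (isCompact_closedBall (0 : E) 1).exists_bound_of_continuousOn
    (f := fderiv ℝ w) fun x hx =>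
      ((hw x hx).fderiv_right (m := 0) (by simp)).continuousAt.continuousWithinAt
  have hLip : LipschitzOnWith B.toNNReal w (closedBall 0 1) := by
    refine (convex_closedBall (0 : E) 1).lipschitzOnWith_of_nnnorm_fderiv_le
      (fun x hx => (hw x hx).differentiableAt (by simp)) fun x hx => ?_
    rw [← NNReal.coe_le_coe, coe_nnnorm]
    exact (hB x hx).trans (Real.le_coe_toNNReal B)
  let u : E → E := (closedBall (0 : E) 1).indicator w
  have hu_in : ∀ x ∈ closedBall (0 : E) 1, u x = w x := fun x hx => indicator_of_mem hx _
  have hu_out : ∀ x, x ∉ ball (0 : E) 1 → u x = 0 := by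
    intro x hx
    by_cases h : x ∈ closedBall (0 : E) 1
    · rw [hu_in x h]
      have : x ∈ sphere (0 : E) 1 := by
        simp only [mem_ball, mem_closedBall, mem_sphere, not_lt] at *
        exact le_antisymm h hx
      simp [w, hid x this]
    · exact indicator_of_notMem h _
  have hmix : ∀ x ∈ closedBall (0 : E) 1, ∀ y, y ∉ closedBall (0 : E) 1 →
      dist (u x) (u y) ≤ B.toNNReal * dist x y := by
    intro x hx y hy
    -- The segment from `x` to the outside point `y` crosses the sphere, where `u` vanishes. So the
    -- Lipschitz bound on the ball suffices.
    obtain ⟨s, hs, hs1⟩ : ∃ s ∈ Icc (0 : ℝ) 1, ‖AffineMap.lineMap x y s‖ = 1 := by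
      have hcont : ContinuousOn (fun s : ℝ => ‖AffineMap.lineMap x y s‖) (Icc 0 1) :=
        (continuous_norm.comp AffineMap.lineMap_continuous).continuousOn
      have := intermediate_value_Icc (zero_le_one' ℝ) hcont
      simp only [mem_closedBall, dist_zero_right, not_le] at hx hy
      exact this ⟨by simpa using hx, by simpa using hy.le⟩
    set z : E := AffineMap.lineMap x y s
    have hz : z ∈ closedBall (0 : E) 1 := by simp [hs1]
    have hz0 : u z = 0 := hu_out z (by simp [hs1])
    have hy0 : u y = 0 := hu_out y fun h => hy (ball_subset_closedBall h)
    rw [hy0, ← hz0, hu_in x hx, hu_in z hz]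
    refine (hLip.dist_le_mul x hx z hz).trans ?_
    gcongr
    rw [dist_left_lineMap, Real.norm_of_nonneg hs.1]
    exact mul_le_of_le_one_left dist_nonneg hs.2
  have huLip : LipschitzWith B.toNNReal u := by
    refine LipschitzWith.of_dist_le_mul fun x y => ?_
    by_cases hx : x ∈ closedBall (0 : E) 1 <;> by_cases hy : y ∈ closedBall (0 : E) 1
    · rw [hu_in x hx, hu_in y hy]; exact hLip.dist_le_mul x hx y hy
    · exact hmix x hx y hy
    · rw [dist_comm, dist_comm x]; exact hmix y hy x hx
    · rw [hu_out x fun h => hx (ball_subset_closedBall h),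
        hu_out y fun h => hy (ball_subset_closedBall h), dist_self]
      positivity
  have heq : ∀ x ∈ ball (0 : E) 1, u =ᶠ[𝓝 x] w := fun x hx =>
    Filter.eventuallyEq_of_mem (isOpen_ball.mem_nhds hx)
      fun y hy => hu_in y (ball_subset_closedBall hy)
  have hwd : ∀ x ∈ ball (0 : E) 1, DifferentiableAt ℝ w x := fun x hx =>
    (hw x (ball_subset_closedBall hx)).differentiableAt (by simp)
  have key := integral_det_id_add_fderiv_of_lipschitz Measure.addHaar huLip hu_out
    fun x hx => (heq x hx).differentiableAt_iff.2 (hwd x hx)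
  have hzero : ∀ x ∈ ball (0 : E) 1, (ContinuousLinearMap.id ℝ E + fderiv ℝ u x).det = 0 := by
    intro x hx
    have hrd : DifferentiableAt ℝ r x :=
      (hr x (ball_subset_closedBall hx)).differentiableAt (by simp)
    have h1 : ContinuousLinearMap.id ℝ E + fderiv ℝ u x = fderiv ℝ r x := by
      rw [(heq x hx).fderiv_eq]
      have : fderiv ℝ w x = fderiv ℝ r x - ContinuousLinearMap.id ℝ E :=
        (hrd.hasFDerivAt.sub (hasFDerivAt_id x)).fderiv
      rw [this]; abel
    rw [h1]
    by_contra hdet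
    -- Differentiating `‖r‖² = 1` shows that the image of the derivative is orthogonal to `r x ≠ 0`.
    -- The integrand therefore vanishes, while its integral is the volume.
    have horth : ∀ y, inner ℝ (r x) (fderiv ℝ r x y) = 0 := by
      intro y
      have hn : (fun z => inner ℝ (r z) (r z)) =ᶠ[𝓝 x] fun _ => (1 : ℝ) :=
        Filter.eventuallyEq_of_mem (isOpen_ball.mem_nhds hx) fun z hz => by
          simp [hr1 z (ball_subset_closedBall hz)]
      have h2 := hn.fderiv_eq (𝕜 := ℝ)
      have h3 := congrArg (fun T => T y) h2
      simp only [fderiv_inner_apply ℝ hrd hrd, fderiv_fun_const, Pi.zero_apply,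
        zero_apply] at h3
      rw [real_inner_comm (r x)] at h3
      linarith
    have hbij : Function.Surjective (fderiv ℝ r x) := by
      have := (LinearMap.isUnit_iff_isUnit_det (fderiv ℝ r x : E →ₗ[ℝ] E)).2 (Ne.isUnit hdet)
      exact ((Module.End.isUnit_iff _).1 this).2
    obtain ⟨y, hy⟩ := hbij (r x)
    have := horth y
    rw [hy, real_inner_self_eq_norm_sq, hr1 x (ball_subset_closedBall hx)] at this
    norm_num at this
  rw [setIntegral_congr_fun measurableSet_ball hzero, integral_zero] at key
  have : 0 < (Measure.addHaar : Measure E).real (ball (0 : E) 1) :=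
    ENNReal.toReal_pos (measure_ball_pos _ _ one_pos).ne' measure_ball_lt_top.ne
  exact this.ne key

end Brouwer

/-! ### Brouwer's fixed point theorem and invariance of domain. -/

section Brouwer

open Metric Set MeasureTheory

section
variable {E : Type*} [NormedAddCommGroup E] [InnerProductSpace ℝ E] [FiniteDimensional ℝ E]

/-- Without a fixed point, following the ray from `g x` through `x` to the sphere would be a smooth
retraction. -/
lemma exists_fixedPoint_of_contDiff {g : E → E} (hg : ContDiff ℝ 1 g)
    (hmap : MapsTo g (closedBall 0 1) (closedBall 0 1)) :
    ∃ x ∈ closedBall (0 : E) 1, g x = x := by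
  by_contra! hne
  let w : E → E := fun x => x - g x
  let b : E → ℝ := fun x => inner ℝ x (w x)
  let V : E → ℝ := fun x => inner ℝ (w x) (w x)
  let D : E → ℝ := fun x => b x ^ 2 + V x * (1 - inner ℝ x x)
  have hw : ContDiff ℝ 1 w := contDiff_id.sub hg
  have hb : ContDiff ℝ 1 b := contDiff_id.inner ℝ hw
  have hV : ContDiff ℝ 1 V := hw.inner ℝ hw
  have hD : ContDiff ℝ 1 D :=
    (hb.pow 2).add (hV.mul (contDiff_const.sub (contDiff_id.inner ℝ contDiff_id)))
  have hV0 : ∀ x ∈ closedBall (0 : E) 1, 0 < V x := fun x hx =>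
    real_inner_self_pos.2 (sub_ne_zero.2 (hne x hx).symm)
  have hbpos : ∀ x ∈ closedBall (0 : E) 1, ‖x‖ = 1 → 0 < b x := by
    intro x hx h1
    have hgx : ‖g x‖ ≤ 1 := by simpa using hmap hx
    have h2 : V x = 1 - 2 * inner ℝ x (g x) + ‖g x‖ ^ 2 := by
      simp only [V, w, real_inner_self_eq_norm_sq, norm_sub_sq_real, h1]; ring
    have h3 : b x = 1 - inner ℝ x (g x) := by
      simp only [b, w, inner_sub_right, real_inner_self_eq_norm_sq, h1]; ring
    have h4 := hV0 x hx
    have h5 : ‖g x‖ ^ 2 ≤ 1 := pow_le_one₀ (norm_nonneg _) hgx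
    linarith
  have hD0 : ∀ x ∈ closedBall (0 : E) 1, 0 < D x := by
    intro x hx
    have hx1 : ‖x‖ ≤ 1 := by simpa using hx
    simp only [D, real_inner_self_eq_norm_sq]
    rcases hx1.eq_or_lt with h | h
    · have := hbpos x hx h
      rw [h]; nlinarith
    · have := hV0 x hx
      have h2 : ‖x‖ ^ 2 < 1 := pow_lt_one₀ (norm_nonneg _) h two_ne_zero
      have := mul_pos this (sub_pos.2 h2)
      positivity
  -- The larger root of `V s² + 2 b s + ‖x‖² - 1 = 0`, which says `‖x + s • w x‖ = 1`. On the sphere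
  -- `b > 0`, so this root is `0`.
  let s : E → ℝ := fun x => (-b x + √(D x)) / V x
  refine no_contDiff_retraction (r := fun x => x + s x • w x) (fun x hx => ?_) (fun x hx => ?_)
    fun x hx => ?_
  · exact contDiffAt_id.add
      (((hb.contDiffAt.neg.add (hD.contDiffAt.sqrt (hD0 x hx).ne')).div hV.contDiffAt
        (hV0 x hx).ne').smul hw.contDiffAt)
  · have hs : s x * V x = -b x + √(D x) := div_mul_cancel₀ _ (hV0 x hx).ne'
    have hsq : √(D x) ^ 2 = b x ^ 2 + V x * (1 - inner ℝ x x) := Real.sq_sqrt (hD0 x hx).le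
    have h1 : inner ℝ (x + s x • w x) (x + s x • w x)
        = inner ℝ x x + 2 * s x * b x + s x ^ 2 * V x := by
      simp only [inner_add_left, inner_add_right, inner_smul_left, inner_smul_right, b, V,
        real_inner_comm x (w x), conj_trivial]
      ring
    have h2 : V x * inner ℝ (x + s x • w x) (x + s x • w x) = V x * 1 := by
      rw [h1]
      have : V x * (inner ℝ x x + 2 * s x * b x + s x ^ 2 * V x)
        = V x * inner ℝ x x + 2 * (s x * V x) * b x + (s x * V x) ^ 2 := by ring
      rw [this, hs]
      linear_combination hsq
    have h3 := mul_left_cancel₀ (hV0 x hx).ne' h2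
    rw [real_inner_self_eq_norm_sq] at h3
    exact (pow_eq_one_iff_of_nonneg (norm_nonneg _) two_ne_zero).1 h3
  · have hx1 : ‖x‖ = 1 := by simpa using hx
    have hb' := hbpos x (sphere_subset_closedBall hx) hx1
    have : s x = 0 := by
      simp only [s, D, real_inner_self_eq_norm_sq, hx1]
      simp [Real.sqrt_sq hb'.le]
    simp [this]

/-- The **Brouwer fixed point theorem**. -/
theorem brouwer_fixedPoint {f : E → E} (hf : ContinuousOn f (closedBall 0 1))
    (hmap : MapsTo f (closedBall 0 1) (closedBall 0 1)) :
    ∃ x ∈ closedBall (0 : E) 1, f x = x := by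
  by_contra! hne
  obtain ⟨m, hm, hmin⟩ := (isCompact_closedBall (0 : E) 1).exists_forall_le' (a := 0)
    (f := fun x => ‖f x - x‖) (hf.sub continuousOn_id).norm
    fun x hx => norm_pos_iff.2 (sub_ne_zero.2 (hne x hx))
  let p : E → E := fun x => (max 1 ‖x‖)⁻¹ • x
  have hp : Continuous p := by
    refine Continuous.smul (Continuous.inv₀ (by fun_prop) fun x => ?_) continuous_id
    positivity
  have hpm : ∀ x, p x ∈ closedBall (0 : E) 1 := by
    intro x
    have h1 : 0 < max 1 ‖x‖ := by positivity
    rw [mem_closedBall_zero_iff, norm_smul, norm_inv, Real.norm_of_nonneg h1.le, inv_mul_le_iff₀ h1]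
    simp
  have hpid : ∀ x ∈ closedBall (0 : E) 1, p x = x := by
    intro x hx
    have : max 1 ‖x‖ = 1 := max_eq_left (by simpa using hx)
    simp [p, this]
  have hF : Continuous (f ∘ p) := hf.comp_continuous hp hpm
  -- Replace `f` by a smooth map `m / 4`-close to it and shrink it by `(1 + m / 4)⁻¹` back into the
  -- ball. A fixed point of the result is moved by `f` at most `m / 2`, less than the minimal
  -- displacement `m`.
  obtain ⟨g, hg, hgd, -⟩ := hF.exists_contDiff_approx 1 (ε := fun _ => m / 4) continuous_const
    (fun _ => by positivity)
  have hgn : ∀ x, ‖g x‖ ≤ 1 + m / 4 := by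
    intro x
    have h1 : ‖f (p x)‖ ≤ 1 := by simpa using hmap (hpm x)
    have h2 := hgd x
    rw [dist_eq_norm, Function.comp_apply] at h2
    have := norm_le_norm_add_norm_sub (f (p x)) (g x)
    rw [norm_sub_rev] at this
    linarith
  have h0 : 0 < 1 + m / 4 := by positivity
  obtain ⟨x, hx, hfix⟩ := exists_fixedPoint_of_contDiff (g := fun x => (1 + m / 4)⁻¹ • g x)
    (contDiff_const.smul hg) fun x _ => by
      rw [mem_closedBall_zero_iff, norm_smul, norm_inv, Real.norm_of_nonneg h0.le,
        inv_mul_le_iff₀ h0, mul_one]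
      exact hgn x
  have hgx : g x = (1 + m / 4) • x := by
    rw [← hfix, smul_smul, mul_inv_cancel₀ h0.ne', one_smul, hfix]
  have h1 := hgd x
  rw [dist_eq_norm, Function.comp_apply, hpid x hx, hgx] at h1
  have h2 : ‖f x - x‖ ≤ ‖(1 + m / 4) • x - f x‖ + ‖(m / 4) • x‖ := by
    have : f x - x = -((1 + m / 4) • x - f x) + (m / 4) • x := by module
    rw [this]
    exact (norm_add_le _ _).trans (by rw [norm_neg])
  have h3 : ‖(m / 4) • x‖ ≤ m / 4 := by
    rw [norm_smul, Real.norm_of_nonneg (by positivity)]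
    exact mul_le_of_le_one_right (by positivity) (by simpa using hx)
  have := hmin x hx
  linarith

lemma exists_eq_zero_of_norm_sub_le_one {H : E → E} (hH : ContinuousOn H (closedBall 0 1))
    (h : ∀ x ∈ closedBall (0 : E) 1, ‖x - H x‖ ≤ 1) : ∃ x ∈ closedBall (0 : E) 1, H x = 0 := by
  obtain ⟨x, hx, hfix⟩ := brouwer_fixedPoint (f := fun x => x - H x) (continuousOn_id.sub hH)
    fun x hx => by simpa using h x hx
  exact ⟨x, hx, by simpa using hfix⟩

end

variable {E : Type} [NormedAddCommGroup E] [InnerProductSpace ℝ E] [FiniteDimensional ℝ E]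

/-- Let `G` extend the inverse of `f`. If `f 0` were not interior, some `c` close to it would be
missed by the image. Pushing the image radially out of a small ball around `c`, and perturbing `G`
there, gives a map close to the identity of the ball but without zeros, against Brouwer. -/
lemma mem_interior_image_closedBall {f : E → E} (hf : ContinuousOn f (closedBall 0 1))
    (hinj : InjOn f (closedBall 0 1)) : f 0 ∈ interior (f '' closedBall 0 1) := by
  rcases subsingleton_or_nontrivial E with hE | hE
  · have : f '' closedBall 0 1 = univ := Subsingleton.eq_univ_of_nonempty ⟨f 0, 0, by simp, rfl⟩
    simp [this]
  borelize E
  have hcomp : IsCompact (f '' closedBall 0 1) := (isCompact_closedBall _ _).image_of_continuousOn hf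
  -- a continuous extension of the inverse
  obtain ⟨G, hG⟩ : ∃ G : C(E, E), ∀ x ∈ closedBall (0 : E) 1, G (f x) = x := by
    have hemb : IsClosedEmbedding ((closedBall (0 : E) 1).domRestrict f) :=
      have : CompactSpace (closedBall (0 : E) 1) := isCompact_iff_compactSpace.1 (isCompact_closedBall _ _)
      (continuousOn_iff_continuous_domRestrict.1 hf).isClosedEmbedding (injOn_iff_injective.1 hinj)
    obtain ⟨G, hG⟩ := ContinuousMap.exists_extension' hemb ⟨Subtype.val, continuous_subtype_val⟩
    exact ⟨G, fun x hx => congrFun hG ⟨x, hx⟩⟩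
  by_contra hint
  obtain ⟨η, hη, hGη⟩ : ∃ η > 0, ∀ y, dist y (f 0) < η → ‖G y‖ ≤ 1 / 10 := by
    have h0 : G (f 0) = 0 := hG 0 (by simp)
    obtain ⟨η, hη, h⟩ := Metric.continuousAt_iff.1 G.continuous.continuousAt (1 / 10) (by norm_num)
    refine ⟨η, hη, fun y hy => ?_⟩
    have := h hy
    rw [h0, dist_zero_right] at this
    exact this.le
  -- Points within `ε` of `c` are within `2 * ε = η` of `f 0`, where `G` has norm at most `1 / 10`.
  set ε := η / 2 with hε
  have hεpos : 0 < ε := half_pos hη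
  obtain ⟨c, hcd, hc⟩ : ∃ c, dist c (f 0) < ε ∧ c ∉ f '' closedBall 0 1 := by
    by_contra! h
    exact hint (mem_interior.2 ⟨ball (f 0) ε, fun y hy => h y hy, isOpen_ball, by simpa⟩)
  obtain ⟨δ, hδ, hδG⟩ : ∃ δ > 0, ∀ y ∈ f '' closedBall 0 1 \ ball c ε, δ ≤ ‖G y‖ := by
    refine (hcomp.diff isOpen_ball).exists_forall_le' G.continuous.norm.continuousOn ?_
    rintro _ ⟨⟨x, hx, rfl⟩, hxc⟩
    rw [hG x hx, norm_pos_iff]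
    rintro rfl
    exact hxc (by rwa [mem_ball, dist_comm])
  -- The perturbation changes `G` by at most `2 * δ'`. This is at most `δ / 2`, so no zero arises
  -- away from `c`, and at most `1 / 5`, so the total distance from the identity stays below `1`.
  set δ' := min (δ / 4) (1 / 10) with hδ'
  have hδ'pos : 0 < δ' := by positivity
  obtain ⟨P, hP, hPG, -⟩ := G.continuous.exists_contDiff_approx 1 (ε := fun _ => δ') continuous_const
    (fun _ => hδ'pos)
  -- A smooth map sends the sphere to a null set, so a small shift `q` removes all zeros of `P`
  -- there.
  obtain ⟨q, hq, hqP⟩ : ∃ q, ‖q‖ < δ' ∧ q ∉ P '' sphere c ε := by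
    have hnull : (Measure.addHaar : Measure E) (P '' sphere c ε) = 0 :=
      addHaar_image_eq_zero_of_differentiableOn_of_addHaar_eq_zero _
        (hP.differentiable (by simp)).differentiableOn (Measure.addHaar_sphere_of_ne_zero _ _ hεpos.ne')
    by_contra! h
    have h1 : ball (0 : E) δ' ⊆ P '' sphere c ε := fun q hq => h q (by simpa using hq)
    exact (measure_ball_pos (Measure.addHaar : Measure E) 0 hδ'pos).ne' (measure_mono_null h1 hnull)
  -- Pushes the ball of radius `ε`, minus its centre `c`, radially onto its sphere and fixes
  -- everything outside.
  let Φ : E → E := fun y => c + max (ε / ‖y - c‖) 1 • (y - c)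
  have hΦ1 : ∀ y, ε ≤ ‖y - c‖ → Φ y = y := by
    intro y hy
    have : max (ε / ‖y - c‖) 1 = 1 := max_eq_right (div_le_one_of_le₀ hy (norm_nonneg _))
    simp [Φ, this]
  have hΦ2 : ∀ y, y ≠ c → ‖y - c‖ < ε → Φ y ∈ sphere c ε := by
    intro y hyc hy
    have h0 : 0 < ‖y - c‖ := norm_pos_iff.2 (sub_ne_zero.2 hyc)
    have : max (ε / ‖y - c‖) 1 = ε / ‖y - c‖ := max_eq_left (by rw [le_div_iff₀ h0]; linarith)
    simp only [Φ, this, mem_sphere, dist_eq_norm, add_sub_cancel_left, norm_smul, norm_div,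
      norm_norm, Real.norm_of_nonneg hεpos.le]
    exact div_mul_cancel₀ _ h0.ne'
  have hΦc : ContinuousOn Φ {c}ᶜ := by
    refine continuousOn_const.add (ContinuousOn.smul (ContinuousOn.sup (continuousOn_const.div
      (by fun_prop) fun y hy => ?_) continuousOn_const) (by fun_prop))
    exact norm_ne_zero_iff.2 (sub_ne_zero.2 hy)
  have hne : ∀ x ∈ closedBall (0 : E) 1, f x ≠ c := fun x hx h => hc ⟨x, hx, h⟩
  have hPd : ∀ y, ‖G y - (P y - q)‖ ≤ 2 * δ' := by
    intro y
    have h1 := hPG y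
    rw [dist_eq_norm, norm_sub_rev] at h1
    have : G y - (P y - q) = (G y - P y) + q := by abel
    rw [this]
    exact (norm_add_le _ _).trans (by linarith)
  have hδ1 : δ' ≤ δ / 4 := min_le_left _ _
  have hδ2 : δ' ≤ 1 / 10 := min_le_right _ _
  obtain ⟨x, hx, hx0⟩ := exists_eq_zero_of_norm_sub_le_one (H := fun x => P (Φ (f x)) - q)
    ((hP.continuous.comp_continuousOn (hΦc.comp hf hne)).sub continuousOn_const) (by
      intro x hx
      rcases le_or_gt ε ‖f x - c‖ with h | h
      · have := hPd (f x)
        rw [hG x hx] at this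
        simp only [hΦ1 _ h]
        linarith
      · have h1 := hPd (Φ (f x))
        have hnear : ∀ y, ‖y - c‖ ≤ ε → ‖G y‖ ≤ 1 / 10 := by
          intro y hy
          refine hGη y ?_
          rw [← dist_eq_norm] at hy
          have := dist_triangle y c (f 0)
          linarith
        have h2 := hnear (f x) h.le
        rw [hG x hx] at h2
        have h3 := hnear (Φ (f x)) (by simpa [dist_eq_norm] using (hΦ2 _ (hne x hx) h).le)
        have : x - (P (Φ (f x)) - q) = x + (-G (Φ (f x)) + (G (Φ (f x)) - (P (Φ (f x)) - q))) := by
          abel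
        rw [this]
        have h4 := norm_add_le x (-G (Φ (f x)) + (G (Φ (f x)) - (P (Φ (f x)) - q)))
        have h5 := norm_add_le (-G (Φ (f x))) (G (Φ (f x)) - (P (Φ (f x)) - q))
        rw [norm_neg] at h5
        linarith)
  rcases le_or_gt ε ‖f x - c‖ with h | h
  · have h1 := hPd (f x)
    simp only [hΦ1 _ h] at hx0
    rw [hx0, sub_zero] at h1
    have := hδG (f x) ⟨⟨x, hx, rfl⟩, by simpa [dist_eq_norm] using h⟩
    linarith
  · exact hqP ⟨_, hΦ2 _ (hne x hx) h, sub_eq_zero.1 hx0⟩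

lemma isOpen_image_of_continuousOn_of_injOn_self {f : E → E} {U : Set E} (hU : IsOpen U)
    (hf : ContinuousOn f U) (hinj : InjOn f U) : IsOpen (f '' U) := by
  rw [isOpen_iff_mem_nhds]
  rintro _ ⟨x, hx, rfl⟩
  obtain ⟨ρ, hρ, hsub⟩ := Metric.nhds_basis_closedBall.mem_iff.1 (hU.mem_nhds hx)
  let a : E → E := fun y => x + ρ • y
  have ha : MapsTo a (closedBall 0 1) U := by
    intro y hy
    refine hsub ?_
    rw [mem_closedBall_zero_iff] at hy
    simp only [a, mem_closedBall, dist_eq_norm, add_sub_cancel_left, norm_smul,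
      Real.norm_of_nonneg hρ.le]
    exact mul_le_of_le_one_right hρ.le hy
  have hai : Function.Injective a := fun y z h => by
    simpa [a, hρ.ne'] using h
  have := mem_interior_image_closedBall (f := f ∘ a) (hf.comp (by fun_prop) ha)
    (hinj.comp hai.injOn ha)
  rw [mem_interior_iff_mem_nhds] at this
  have h0 : (f ∘ a) 0 = f x := by simp [a]
  rw [h0] at this
  refine Filter.mem_of_superset this ?_
  rw [image_comp]
  exact image_mono (mapsTo_iff_image_subset.1 ha)

/-- **Invariance of domain.** -/
theorem isOpen_image_of_continuousOn_of_injOn {V W : Type*} [NormedAddCommGroup V]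
    [NormedSpace ℝ V] [FiniteDimensional ℝ V] [NormedAddCommGroup W] [NormedSpace ℝ W]
    [FiniteDimensional ℝ W] (hVW : Module.finrank ℝ V = Module.finrank ℝ W) {f : V → W} {U : Set V}
    (hU : IsOpen U) (hf : ContinuousOn f U) (hinj : InjOn f U) : IsOpen (f '' U) := by
  -- Both spaces are identified with one Euclidean space, where the statement for self-maps applies.
  let n := Module.finrank ℝ V
  let e : V ≃L[ℝ] EuclideanSpace ℝ (Fin n) := ContinuousLinearEquiv.ofFinrankEq (by simp [n])
  let e' : W ≃L[ℝ] EuclideanSpace ℝ (Fin n) :=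
    ContinuousLinearEquiv.ofFinrankEq (by simp [n, hVW])
  have hmaps : MapsTo e.symm (e '' U) U := by
    rintro _ ⟨x, hx, rfl⟩
    simpa using hx
  have h := isOpen_image_of_continuousOn_of_injOn_self (f := e' ∘ f ∘ e.symm) (U := e '' U)
    (e.toHomeomorph.isOpenMap U hU)
    (e'.continuous.comp_continuousOn (hf.comp e.symm.continuous.continuousOn hmaps))
    (e'.injective.comp_injOn (hinj.comp e.symm.injective.injOn hmaps))
  have h2 : (e' ∘ f ∘ e.symm) '' (e '' U) = e' '' (f '' U) := by
    simp only [image_image, Function.comp_apply, ContinuousLinearEquiv.symm_apply_apply]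
  rw [h2] at h
  exact (e'.toHomeomorph.isOpen_image).1 h

end Brouwer

/-! ### Regular CW complexes: facets, and intermediate cells in codimension two. -/

section Diamond

open Metric Set

/-- Invariance of domain for relatively open subsets of the unit sphere. -/
lemma isOpen_image_of_sphere {V W : Type*} [NormedAddCommGroup V] [NormedSpace ℝ V]
    [FiniteDimensional ℝ V] [NormedAddCommGroup W] [NormedSpace ℝ W] [FiniteDimensional ℝ W]
    (hVW : Module.finrank ℝ V = Module.finrank ℝ W + 1) {O : Set V} (hO : IsOpen O) {ψ : V → W}
    (hψ : ContinuousOn ψ (sphere 0 1 ∩ O)) (hinj : InjOn ψ (sphere 0 1 ∩ O)) :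
    IsOpen (ψ '' (sphere 0 1 ∩ O)) := by
  let n : V → V := fun w => ‖w‖⁻¹ • w
  have hn : ContinuousOn n {0}ᶜ :=
    (continuousOn_id.norm.inv₀ fun w hw => norm_ne_zero_iff.2 hw).smul continuousOn_id
  have hn1 : ∀ w ≠ 0, n w ∈ sphere (0 : V) 1 := fun w hw => by
    simp [n, norm_smul, norm_ne_zero_iff.2 hw]
  let C : Set V := {0}ᶜ ∩ n ⁻¹' O
  have hC : IsOpen C := hn.isOpen_inter_preimage isOpen_compl_singleton hO
  have hCm : MapsTo n C (sphere 0 1 ∩ O) := fun w hw => ⟨hn1 w hw.1, hw.2⟩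
  -- Polar coordinates turn `ψ` into an injective map on an open cone, to which invariance of domain
  -- applies. The image of `ψ` is the slice at radius `1`.
  let F : V → ℝ × W := fun w => (‖w‖, ψ (n w))
  have hF : ContinuousOn F C :=
    continuous_norm.continuousOn.prodMk (hψ.comp (hn.mono inter_subset_left) hCm)
  have hFi : InjOn F C := by
    intro w hw w' hw' h
    obtain ⟨h1, h2⟩ := Prod.mk.inj h
    have h3 := hinj (hCm hw) (hCm hw') h2
    simp only [n, h1] at h3
    exact smul_right_injective V (inv_ne_zero (norm_ne_zero_iff.2 hw'.1)) h3
  have hopen := isOpen_image_of_continuousOn_of_injOn (by simp [hVW, add_comm]) hC hF hFi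
  have : ψ '' (sphere 0 1 ∩ O) = (fun z => ((1 : ℝ), z)) ⁻¹' (F '' C) := by
    ext z
    constructor
    · rintro ⟨u, ⟨hu, huO⟩, rfl⟩
      have hu1 : ‖u‖ = 1 := by simpa using hu
      have hnu : n u = u := by simp [n, hu1]
      refine ⟨u, ⟨?_, by simpa [hnu] using huO⟩, by simp [F, hnu, hu1]⟩
      rintro rfl
      simp at hu1
    · rintro ⟨w, hw, h⟩
      exact ⟨n w, hCm hw, (Prod.mk.inj h).2⟩
  rw [this]
  exact hopen.preimage (by fun_prop)

/-- A nonempty relatively open subset of the unit sphere does not embed in a space of too small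
dimension. -/
lemma finrank_le_of_sphere {V W : Type*} [NormedAddCommGroup V] [NormedSpace ℝ V]
    [FiniteDimensional ℝ V] [NormedAddCommGroup W] [NormedSpace ℝ W] [FiniteDimensional ℝ W]
    {O : Set V} (hO : IsOpen O) {ψ : V → W} (hψ : ContinuousOn ψ (sphere 0 1 ∩ O))
    (hinj : InjOn ψ (sphere 0 1 ∩ O)) (hne : (sphere 0 1 ∩ O).Nonempty) :
    Module.finrank ℝ V ≤ Module.finrank ℝ W + 1 := by
  by_contra! hlt
  obtain ⟨k, hk⟩ := Nat.exists_eq_add_of_lt hlt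
  -- Pad the target with `k + 1` zero coordinates to reach the critical dimension. The image would
  -- be open, yet its projection to the padding is the single point `0`.
  have h := isOpen_image_of_sphere (W := W × (Fin (k + 1) → ℝ)) (by simp [hk]; omega) hO
    (ψ := fun u => (ψ u, 0)) (hψ.prodMk continuousOn_const)
    fun u hu u' hu' h => hinj hu hu' (Prod.mk.inj h).1
  have h2 := isOpenMap_snd _ h
  rw [image_image] at h2
  have h3 : (fun _ : V => (0 : Fin (k + 1) → ℝ)) '' (sphere 0 1 ∩ O) = {0} := hne.image_const 0
  rw [h3] at h2
  exact not_isOpen_singleton _ h2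

variable {X : Type u} [TopologicalSpace X] {K : Set X} [CWComplex K]

namespace CWCell

/-- The open cell. -/
def interior (x : CWCell K) : Set X := RelCWComplex.openCell x.dim x.idx

/-- The boundary of the cell. -/
def frontier (x : CWCell K) : Set X := RelCWComplex.cellFrontier x.dim x.idx

/-- The characteristic map. -/
def char (x : CWCell K) : (Fin x.dim → ℝ) → X := RelCWComplex.map x.dim x.idx

lemma continuousOn_char (x : CWCell K) : ContinuousOn x.char (closedBall 0 1) :=
  RelCWComplex.continuousOn _ _

lemma frontier_union_interior (x : CWCell K) : x.frontier ∪ x.interior = x.carrier :=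
  RelCWComplex.cellFrontier_union_openCell_eq_closedCell _ _

lemma interior_subset_carrier (x : CWCell K) : x.interior ⊆ x.carrier :=
  RelCWComplex.openCell_subset_closedCell _ _

lemma frontier_subset_carrier (x : CWCell K) : x.frontier ⊆ x.carrier :=
  RelCWComplex.cellFrontier_subset_closedCell _ _

lemma interior_nonempty (x : CWCell K) : x.interior.Nonempty := RelCWComplex.openCell_nonempty _ _

lemma eq_of_mem_interior {x y : CWCell K} {p : X} (hx : p ∈ x.interior) (hy : p ∈ y.interior) :
    x = y := by
  obtain ⟨n, e⟩ := x
  obtain ⟨m, e'⟩ := y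
  cases RelCWComplex.eq_of_not_disjoint_openCell (Set.not_disjoint_iff.2 ⟨_, hx, hy⟩)
  rfl

lemma exists_mem_interior_of_mem_frontier {z : CWCell K} {p : X} (hp : p ∈ z.frontier) :
    ∃ w : CWCell K, w.dim < z.dim ∧ p ∈ w.interior := by
  obtain ⟨I, hI⟩ := CWComplex.cellFrontier_subset_finite_openCell z.dim z.idx
  obtain ⟨k, hk, j, hj, hkj⟩ : ∃ k, k < z.dim ∧ ∃ j, j ∈ I k ∧ p ∈ RelCWComplex.openCell k j := by
    simpa using hI hp
  exact ⟨⟨k, j⟩, hk, hkj⟩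

lemma exists_mem_interior_of_mem_carrier {z : CWCell K} {p : X} (hp : p ∈ z.carrier) :
    ∃ w : CWCell K, (w.dim < z.dim ∨ w = z) ∧ p ∈ w.interior := by
  rw [← frontier_union_interior] at hp
  rcases hp with hp | hp
  · obtain ⟨w, hw, h⟩ := exists_mem_interior_of_mem_frontier hp
    exact ⟨w, Or.inl hw, h⟩
  · exact ⟨z, Or.inr rfl, hp⟩

instance [RelCWComplex.Finite K] : Finite (CWCell K) := by
  have := RelCWComplex.finite_cells_of_finite (C := K)
  exact Finite.of_injective (fun x : CWCell K => (⟨x.dim, x.idx⟩ : Σ n, RelCWComplex.cell K n))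
    fun x y h => by
      obtain ⟨n, e⟩ := x
      obtain ⟨m, e'⟩ := y
      cases h
      rfl

lemma dim_lt_of_lt {x y : CWCell K} (h : x < y) : x.dim < y.dim :=
  (dim_lt_or_eq h.le).resolve_right h.ne

variable [T2Space X]

lemma isClosed_carrier (x : CWCell K) : IsClosed x.carrier := RelCWComplex.isClosed_closedCell

lemma isClosed_frontier (x : CWCell K) : IsClosed x.frontier := RelCWComplex.isClosed_cellFrontier

lemma closure_interior (x : CWCell K) : closure x.interior = x.carrier :=
  RelCWComplex.closure_openCell_eq_closedCell

/-- A continuous injection of a compact space into a Hausdorff space is an embedding. -/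
lemma exists_continuousOn_inverse (hK : IsRegularCW K) (x : CWCell K) :
    ∃ g : X → (Fin x.dim → ℝ), ContinuousOn g x.carrier ∧ ∀ v ∈ closedBall 0 1, g (x.char v) = v := by
  have hinj : InjOn x.char (closedBall 0 1) := hK x.dim x.idx
  have hg : LeftInvOn (Function.invFunOn x.char (closedBall 0 1)) x.char (closedBall 0 1) :=
    hinj.leftInvOn_invFunOn
  refine ⟨_, ?_, fun v hv => hg hv⟩
  rw [continuousOn_iff_isClosed]
  intro t ht
  refine ⟨x.char '' (closedBall 0 1 ∩ t), (((isCompact_closedBall _ _).inter_right ht).image_of_continuousOn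
    (x.continuousOn_char.mono inter_subset_left)).isClosed, ?_⟩
  ext p
  constructor
  · rintro ⟨h1, v, hv, rfl⟩
    have h1' : Function.invFunOn x.char (closedBall 0 1) (x.char v) ∈ t := h1
    rw [hg hv] at h1'
    exact ⟨⟨v, ⟨hv, h1'⟩, rfl⟩, v, hv, rfl⟩
  · rintro ⟨⟨v, ⟨hv, hvt⟩, rfl⟩, h⟩
    refine ⟨?_, h⟩
    rw [mem_preimage, hg hv]
    exact hvt

/-- The transition map from a relatively open part of the boundary sphere of `z` to the closed ball
of `w`. -/
lemma exists_transition (hK : IsRegularCW K) {z w : CWCell K} {O : Set (Fin z.dim → ℝ)}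
    (hO : IsOpen O) (hU : MapsTo z.char (sphere 0 1 ∩ O) w.carrier) :
    ((sphere 0 1 ∩ O).Nonempty → z.dim ≤ w.dim + 1) ∧
    (z.dim = w.dim + 1 →
      IsOpen {v | v ∈ closedBall 0 1 ∧ w.char v ∈ z.char '' (sphere 0 1 ∩ O)}) := by
  obtain ⟨g, hg, hgv⟩ := w.exists_continuousOn_inverse hK
  have hsub : sphere (0 : Fin z.dim → ℝ) 1 ∩ O ⊆ closedBall 0 1 :=
    inter_subset_left.trans sphere_subset_closedBall
  have hc : ContinuousOn (g ∘ z.char) (sphere 0 1 ∩ O) :=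
    hg.comp (z.continuousOn_char.mono hsub) hU
  have hgi : InjOn g w.carrier := by
    rintro _ ⟨v, hv, rfl⟩ _ ⟨v', hv', rfl⟩ h
    have h1 := hgv v hv
    have h2 := hgv v' hv'
    have h' : g (w.char v) = g (w.char v') := h
    rw [h1, h2] at h'
    rw [h']
  have hi : InjOn (g ∘ z.char) (sphere 0 1 ∩ O) :=
    hgi.comp ((hK z.dim z.idx).mono hsub) hU
  refine ⟨fun hne => by simpa using finrank_le_of_sphere hO hc hi hne, fun hd => ?_⟩
  have hopen := isOpen_image_of_sphere (by simpa using hd) hO hc hi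
  have heq : {v | v ∈ closedBall 0 1 ∧ w.char v ∈ z.char '' (sphere 0 1 ∩ O)}
      = g ∘ z.char '' (sphere 0 1 ∩ O) := ?_
  · rwa [heq]
  ext v
  constructor
  · rintro ⟨hv, u, hu, huv⟩
    exact ⟨u, hu, by rw [Function.comp_apply, huv, hgv v hv]⟩
  · rintro ⟨u, hu, rfl⟩
    obtain ⟨v, hv, hvu⟩ := hU hu
    have hvu' : w.char v = z.char u := hvu
    rw [Function.comp_apply, ← hvu', hgv v hv]
    exact ⟨hv, u, hu, hvu'.symm⟩

variable [RelCWComplex.Finite K]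

/-- A finite union of closed cells is closed, so it may be cut away from the boundary sphere,
leaving a relatively open part. -/
lemma exists_isOpen_preimage_compl (z : CWCell K) (s : Set (CWCell K)) :
    ∃ O : Set (Fin z.dim → ℝ), IsOpen O ∧ ∀ u ∈ sphere (0 : Fin z.dim → ℝ) 1,
      u ∈ O ↔ ∀ w ∈ s, z.char u ∉ w.carrier := by
  have hcl : IsClosed (⋃ w ∈ s, w.carrier) :=
    (Set.toFinite s).isClosed_biUnion fun w _ => w.isClosed_carrier
  obtain ⟨O, hO, h⟩ := continuousOn_iff'.1 (z.continuousOn_char.mono sphere_subset_closedBall)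
    _ hcl.isOpen_compl
  refine ⟨O, hO, fun u hu => ?_⟩
  have := Set.ext_iff.1 h u
  simp only [mem_inter_iff, hu, and_true, mem_preimage, mem_compl_iff, mem_iUnion,
    not_exists] at this
  simpa using this.symm

/-- The part of the boundary of `z` in an open cell of maximal dimension is relatively open. -/
lemma exists_isOpen_inter_interior (z e : CWCell K) {O : Set (Fin z.dim → ℝ)} (hO : IsOpen O)
    (hmax : ∀ u ∈ sphere 0 1 ∩ O, ∀ w : CWCell K, z.char u ∈ w.interior → w.dim ≤ e.dim) :
    ∃ O' : Set (Fin z.dim → ℝ), IsOpen O' ∧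
      sphere 0 1 ∩ O' = {u | u ∈ sphere 0 1 ∩ O ∧ z.char u ∈ e.interior} := by
  -- Cut away every other closed cell of dimension at most that of `e`. Such a cell misses the open
  -- cell `e`, since its boundary consists of points in open cells of smaller dimension.
  obtain ⟨O', hO', h⟩ := z.exists_isOpen_preimage_compl {w | w.dim ≤ e.dim ∧ w ≠ e}
  refine ⟨O ∩ O', hO.inter hO', ?_⟩
  ext u
  constructor
  · rintro ⟨hu, huO, huO'⟩
    refine ⟨⟨hu, huO⟩, ?_⟩
    obtain ⟨w, hw, hwu⟩ := exists_mem_interior_of_mem_frontier (z := z) ⟨u, hu, rfl⟩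
    have hwu' : z.char u ∈ w.interior := hwu
    by_cases hwe : w = e
    · exact hwe ▸ hwu'
    · exact absurd (w.interior_subset_carrier hwu')
        ((h u hu).1 huO' w ⟨hmax u ⟨hu, huO⟩ w hwu', hwe⟩)
  · rintro ⟨⟨hu, huO⟩, hue⟩
    refine ⟨hu, huO, (h u hu).2 fun w hw hwu => ?_⟩
    obtain ⟨w', hw', hwu'⟩ := exists_mem_interior_of_mem_carrier hwu
    obtain rfl := eq_of_mem_interior hwu' hue
    rcases hw' with hw' | hw'
    · exact absurd hw.1 (by omega)
    · exact hw.2 hw'.symm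

/-- An open cell of maximal dimension meeting the given part of the sphere meets it in a relatively
open set. That set embeds in the ball of this cell, which therefore has codimension at most one. -/
lemma exists_facet_meeting (hK : IsRegularCW K) (z : CWCell K) {O : Set (Fin z.dim → ℝ)}
    (hO : IsOpen O) (hne : (sphere 0 1 ∩ O).Nonempty) :
    ∃ e : CWCell K, z.dim = e.dim + 1 ∧ ∃ u ∈ sphere 0 1 ∩ O, z.char u ∈ e.interior := by
  let s : Set (CWCell K) := {w | ∃ u ∈ sphere 0 1 ∩ O, z.char u ∈ w.interior}
  have hlt : ∀ u ∈ sphere (0 : Fin z.dim → ℝ) 1, ∃ w : CWCell K, w.dim < z.dim ∧ z.char u ∈ w.interior :=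
    fun u hu => exists_mem_interior_of_mem_frontier ⟨u, hu, rfl⟩
  have hs : s.Nonempty := by
    obtain ⟨u, hu⟩ := hne
    obtain ⟨w, -, hw⟩ := hlt u hu.1
    exact ⟨w, u, hu, hw⟩
  obtain ⟨e, he, hmax⟩ := s.exists_max_image CWCell.dim s.toFinite hs
  obtain ⟨u, hu, hue⟩ := he
  obtain ⟨O', hO', h⟩ := z.exists_isOpen_inter_interior e hO
    fun u hu w hw => hmax w ⟨u, hu, hw⟩
  have h1 := (exists_transition (w := e) hK hO' fun u hu => by
    rw [h] at hu
    exact e.interior_subset_carrier hu.2).1 ⟨u, by rw [h]; exact ⟨hu, hue⟩⟩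
  obtain ⟨w, hw, hwu⟩ := hlt u hu.1
  obtain rfl := eq_of_mem_interior hwu hue
  exact ⟨w, by omega, u, hu, hue⟩

/-- Within the connected open cell `e`, the part lying in the boundary of `z` is closed, open by
invariance of domain, and nonempty. -/
lemma carrier_subset_frontier_of_facet (hK : IsRegularCW K) {z e : CWCell K}
    (hd : z.dim = e.dim + 1) {p : X} (hpz : p ∈ z.frontier) (hpe : p ∈ e.interior) :
    e.carrier ⊆ z.frontier := by
  obtain ⟨O, hO, h⟩ := z.exists_isOpen_inter_interior e isOpen_univ fun u hu w hw => by
    obtain ⟨w', hw', hwu⟩ := exists_mem_interior_of_mem_frontier (z := z) ⟨u, hu.1, rfl⟩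
    obtain rfl := eq_of_mem_interior hwu hw
    omega
  have hT := (exists_transition (w := e) hK hO fun u hu => by
    rw [h] at hu
    exact e.interior_subset_carrier hu.2).2 hd
  have hcb : ContinuousOn e.char (ball 0 1) := e.continuousOn_char.mono ball_subset_closedBall
  have hT' := hcb.isOpen_inter_preimage isOpen_ball z.isClosed_frontier.isOpen_compl
  have hball : _root_.IsPreconnected (ball (0 : Fin e.dim → ℝ) 1) := (convex_ball _ _).isPreconnected
  have hint : e.interior ⊆ z.frontier := by
    have hsub : ball (0 : Fin e.dim → ℝ) 1 ⊆
        {v | v ∈ closedBall 0 1 ∧ e.char v ∈ z.char '' (sphere 0 1 ∩ O)} := by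
      refine hball.subset_left_of_subset_union hT hT' ?_ ?_ ?_
      · refine Set.disjoint_left.2 ?_
        rintro v ⟨-, u, hu, huv⟩ ⟨-, hv⟩
        exact hv ⟨u, hu.1, huv⟩
      · intro v hv
        by_cases hvz : e.char v ∈ z.frontier
        · left
          obtain ⟨u, hu, huv⟩ := hvz
          have huv' : z.char u = e.char v := huv
          refine ⟨ball_subset_closedBall hv, u, ?_, huv⟩
          rw [h]
          exact ⟨⟨hu, trivial⟩, by rw [huv']; exact ⟨v, hv, rfl⟩⟩
        · exact Or.inr ⟨hv, hvz⟩
      · obtain ⟨u, hu, rfl⟩ := hpz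
        obtain ⟨v, hv, huv⟩ := hpe
        refine ⟨v, hv, ball_subset_closedBall hv, u, ?_, huv.symm⟩
        rw [h]
        exact ⟨⟨hu, trivial⟩, ⟨v, hv, huv⟩⟩
    rintro _ ⟨v, hv, rfl⟩
    obtain ⟨-, u, hu, huv⟩ := hsub hv
    exact ⟨u, hu.1, huv⟩
  rw [← closure_interior]
  exact closure_minimal hint z.isClosed_frontier

/-- The boundary of a cell is the union of its facets. -/
lemma exists_facet_of_mem_frontier (hK : IsRegularCW K) {z : CWCell K} {p : X}
    (hp : p ∈ z.frontier) :
    ∃ e : CWCell K, z.dim = e.dim + 1 ∧ e.carrier ⊆ z.frontier ∧ p ∈ e.carrier := by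
  by_contra! hcon
  -- Points in no facet form a relatively open part of the sphere. If nonempty, it would meet an
  -- open cell of codimension one, which is a facet.
  obtain ⟨O, hO, h⟩ := z.exists_isOpen_preimage_compl
    {e | z.dim = e.dim + 1 ∧ e.carrier ⊆ z.frontier}
  obtain ⟨u, hu, rfl⟩ := hp
  obtain ⟨e, he, u', hu', hue⟩ := z.exists_facet_meeting hK hO
    ⟨u, hu, (h u hu).2 fun w hw => hcon w hw.1 hw.2⟩
  exact (h u' hu'.1).1 hu'.2 e
    ⟨he, carrier_subset_frontier_of_facet hK he ⟨u', hu'.1, rfl⟩ hue⟩ (e.interior_subset_carrier hue)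

/-- In a regular complex, a closed cell which meets an open cell contains it. -/
lemma le_of_mem_interior_of_mem_carrier (hK : IsRegularCW K) {x z : CWCell K} {p : X}
    (hx : p ∈ x.interior) (hz : p ∈ z.carrier) : x ≤ z := by
  induction hn : z.dim using Nat.strong_induction_on generalizing z with
  | _ n ih =>
    subst hn
    rw [← frontier_union_interior] at hz
    rcases hz with hz | hz
    · obtain ⟨e, he, hez, hpe⟩ := exists_facet_of_mem_frontier hK hz
      exact (ih e.dim (by omega) hpe rfl).trans (hez.trans z.frontier_subset_carrier)
    · exact (eq_of_mem_interior hx hz).le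

/-- In a regular complex, a cell of codimension two lies in at least two intermediate cells. -/
theorem exists_ne_between (hK : IsRegularCW K) {x y z : CWCell K} (hxy : x ≤ y) (hyz : y ≤ z)
    (hy : y.dim = x.dim + 1) (hz : z.dim = y.dim + 1) :
    ∃ y' : CWCell K, y' ≠ y ∧ y'.dim = y.dim ∧ x ≤ y' ∧ y' ≤ z := by
  by_contra! hcon
  obtain ⟨p, hp⟩ := x.interior_nonempty
  have hfr : ∀ w : CWCell K, x ≤ w → x.dim < w.dim → p ∈ w.frontier := by
    intro w hw hd
    have := hw (x.interior_subset_carrier hp)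
    rw [← frontier_union_interior] at this
    refine this.resolve_right fun h => ?_
    obtain rfl := eq_of_mem_interior hp h
    exact hd.false
  obtain ⟨u, hu, hup⟩ := hfr z (hxy.trans hyz) (by omega)
  obtain ⟨v, hv, hvp⟩ := hfr y hxy (by omega)
  -- After cutting away all facets other than `y`, the sphere still contains the preimage of `p`,
  -- and what remains maps into the closed cell `y`. Its trace in the closed ball of `y` is open, so
  -- it cannot contain the boundary point `v` over `p`.
  obtain ⟨O, hO, h⟩ := z.exists_isOpen_preimage_compl
    {e | z.dim = e.dim + 1 ∧ e.carrier ⊆ z.frontier ∧ e ≠ y}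
  have huO : u ∈ O := by
    refine (h u hu).2 fun e he hue => ?_
    have hue' : p ∈ e.carrier := hup ▸ hue
    exact hcon e he.2.2 (by have := he.1; omega) (le_of_mem_interior_of_mem_carrier hK hp hue')
      (he.2.1.trans z.frontier_subset_carrier)
  have hT := (exists_transition (w := y) hK hO fun u' hu' => by
    obtain ⟨e, he, hez, hpe⟩ := exists_facet_of_mem_frontier hK (z := z) ⟨u', hu'.1, rfl⟩
    by_cases hey : e = y
    · exact hey ▸ hpe
    · exact absurd hpe ((h u' hu'.1).1 hu'.2 e ⟨he, hez, hey⟩)).2 hz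
  have hmem : v ∈ _root_.interior (closedBall (0 : Fin y.dim → ℝ) 1) := by
    refine mem_interior.2 ⟨_, fun v' hv' => hv'.1, hT, sphere_subset_closedBall hv, u, ⟨hu, huO⟩, ?_⟩
    exact hup.trans hvp.symm
  rw [interior_closedBall _ one_ne_zero] at hmem
  exact (mem_ball.1 hmem).ne hv

end CWCell

end Diamond

/-! ### Reduction of walks. -/

section Backtracking

variable {P : Type u}

open Classical in
/-- Put `p` in front of a walk, cancelling a backtracking `p, x, p`. -/
noncomputable def pushCell (p : P) : List P → List P
  | x :: q :: r => if q = p then q :: r else p :: x :: q :: r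
  | l => p :: l

/-- Cancel all backtrackings of a walk. -/
noncomputable def reduceWalk (l : List P) : List P := l.foldr pushCell []

/-- A walk without backtrackings. -/
def IsReducedWalk : List P → Prop
  | x :: y :: z :: l => x ≠ z ∧ IsReducedWalk (y :: z :: l)
  | _ => True

lemma pushCell_cancel (p x : P) (r : List P) : pushCell p (x :: p :: r) = p :: r := by
  simp [pushCell]

lemma pushCell_of_ne {p q : P} (h : q ≠ p) (x : P) (r : List P) :
    pushCell p (x :: q :: r) = p :: x :: q :: r := by
  simp [pushCell, h]

lemma pushCell_eq_cons_or (p : P) (w : List P) :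
    (pushCell p w = p :: w ∧ ∀ x r, w ≠ x :: p :: r) ∨ ∃ x r, w = x :: p :: r ∧ pushCell p w = p :: r := by
  rcases w with _ | ⟨x, _ | ⟨q, r⟩⟩
  · simp [pushCell]
  · simp [pushCell]
  · by_cases h : q = p
    · subst h
      exact Or.inr ⟨x, r, rfl, pushCell_cancel q x r⟩
    · refine Or.inl ⟨pushCell_of_ne h x r, ?_⟩
      rintro x' r' hw
      simp at hw
      exact h hw.2.1

lemma exists_pushCell_eq_cons (p : P) (w : List P) : ∃ r, pushCell p w = p :: r := by
  rcases pushCell_eq_cons_or p w with ⟨h, -⟩ | ⟨x, r, -, h⟩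
  · exact ⟨w, h⟩
  · exact ⟨r, h⟩

lemma reduceWalk_cons (p : P) (l : List P) : reduceWalk (p :: l) = pushCell p (reduceWalk l) := rfl

lemma exists_reduceWalk_eq_cons (p : P) (l : List P) : ∃ r, reduceWalk (p :: l) = p :: r :=
  exists_pushCell_eq_cons p _

lemma reduceWalk_append_congr {l l' : List P} (h : reduceWalk l = reduceWalk l') (a : List P) :
    reduceWalk (a ++ l) = reduceWalk (a ++ l') := by
  simp only [reduceWalk, List.foldr_append] at h ⊢
  rw [h]

lemma IsReducedWalk.tail {x : P} {l : List P} (h : IsReducedWalk (x :: l)) : IsReducedWalk l := by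
  rcases l with _ | ⟨y, _ | ⟨z, l⟩⟩
  · trivial
  · trivial
  · exact h.2

lemma IsReducedWalk.pushCell {w : List P} (h : IsReducedWalk w) (p : P) :
    IsReducedWalk (pushCell p w) := by
  rcases pushCell_eq_cons_or p w with ⟨h', hne⟩ | ⟨x, r, rfl, h'⟩
  · rw [h']
    rcases w with _ | ⟨x, _ | ⟨q, r⟩⟩
    · trivial
    · trivial
    · exact ⟨fun hq => hne x r (by rw [hq]), h⟩
  · rw [h']
    exact h.tail

lemma isReducedWalk_reduceWalk (l : List P) : IsReducedWalk (reduceWalk l) := by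
  induction l with
  | nil => trivial
  | cons p l ih => exact ih.pushCell p

lemma IsReducedWalk.reduceWalk_eq {l : List P} (h : IsReducedWalk l) : reduceWalk l = l := by
  induction l with
  | nil => rfl
  | cons p l ih =>
    rw [reduceWalk_cons, ih h.tail]
    rcases l with _ | ⟨y, _ | ⟨z, l⟩⟩
    · rfl
    · rfl
    · exact pushCell_of_ne h.1.symm y l

/-- Backtracking concerns three consecutive cells, so an overlap of two cells suffices for gluing.
-/
lemma IsReducedWalk.append {x z : P} {a b : List P} (ha : IsReducedWalk (a ++ [x, z]))
    (hb : IsReducedWalk (x :: z :: b)) : IsReducedWalk (a ++ x :: z :: b) := by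
  induction a with
  | nil => exact hb
  | cons p a ih =>
    have := ih ha.tail
    rcases a with _ | ⟨q, _ | ⟨r, a⟩⟩
    · exact ⟨ha.1, this⟩
    · exact ⟨ha.1, this⟩
    · exact ⟨ha.1, this⟩

/-- The core of confluence. If pushing `y` cancels, the walk was `x, y, s, …` with `s ≠ x` by
reducedness, and pushing `x` restores it. -/
lemma pushCell_pushCell {x : P} {r : List P} (h : IsReducedWalk (x :: r)) (y : P) :
    pushCell x (pushCell y (x :: r)) = x :: r := by
  rcases r with _ | ⟨q, r⟩
  · simp [pushCell]
  · by_cases hq : q = y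
    · subst hq
      rw [pushCell_cancel]
      rcases r with _ | ⟨s, r⟩
      · rfl
      · exact pushCell_of_ne h.1.symm q r
    · rw [pushCell_of_ne hq, pushCell_cancel]

lemma reduceWalk_backtrack (x y : P) (l : List P) :
    reduceWalk (x :: y :: x :: l) = reduceWalk (x :: l) := by
  obtain ⟨r, hr⟩ := exists_reduceWalk_eq_cons x l
  have := isReducedWalk_reduceWalk (x :: l)
  rw [reduceWalk_cons, reduceWalk_cons, hr, pushCell_pushCell (hr ▸ this)]

lemma reduceWalk_reduceWalk_append (l m : List P) :
    reduceWalk (reduceWalk l ++ m) = reduceWalk (l ++ m) := by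
  induction l with
  | nil => rfl
  | cons p l ih =>
    rw [List.cons_append, reduceWalk_cons p (l ++ m), ← ih, ← reduceWalk_cons p (reduceWalk l ++ m),
      reduceWalk_cons p l]
    rcases pushCell_eq_cons_or p (reduceWalk l) with ⟨h, -⟩ | ⟨x, r, hw, h⟩
    · rw [h, List.cons_append]
    · rw [h, hw]
      exact (reduceWalk_backtrack p x (r ++ m)).symm

/-- A walk followed by its reverse cancels from the turning point outwards. -/
lemma reduceWalk_append_loop (a b : List P) (x : P) (l : List P) :
    reduceWalk (a ++ x :: l ++ (x :: l).reverse.tail ++ b) = reduceWalk (a ++ [x] ++ b) := by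
  induction l generalizing a b x with
  | nil => simp
  | cons y l ih =>
    have h1 : a ++ x :: y :: l ++ (x :: y :: l).reverse.tail ++ b
        = (a ++ [x]) ++ y :: l ++ (y :: l).reverse.tail ++ (x :: b) := by
      have : (x :: y :: l).reverse.tail = (y :: l).reverse.tail ++ [x] := by
        rw [List.reverse_cons, List.tail_append_of_ne_nil (by simp)]
      rw [this]
      simp
    rw [h1, ih]
    have h2 := reduceWalk_append_congr (reduceWalk_backtrack x y b) a
    simpa using h2

/-- A pair of consecutive cells of the reduction of a walk comes from the walk. -/
lemma exists_append_of_reduceWalk_eq {l U V : List P} {x z : P}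
    (h : reduceWalk l = U ++ x :: z :: V) :
    ∃ l₁ l₂, l = l₁ ++ x :: z :: l₂ ∧ reduceWalk (l₁ ++ [x]) = U ++ [x] ∧
      reduceWalk (z :: l₂) = z :: V := by
  induction l generalizing U with
  | nil => simp [reduceWalk] at h
  | cons p l ih =>
    rw [reduceWalk_cons] at h
    rcases pushCell_eq_cons_or p (reduceWalk l) with ⟨h', hne⟩ | ⟨q, r, hw, h'⟩
    · rw [h'] at h
      rcases U with _ | ⟨p', U⟩
      · obtain ⟨rfl, hl⟩ := List.cons.inj h
        rcases l with _ | ⟨z', l⟩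
        · simp [reduceWalk] at hl
        · obtain ⟨r, hr⟩ := exists_reduceWalk_eq_cons z' l
          obtain ⟨rfl, -⟩ := List.cons.inj (hr.symm.trans hl)
          exact ⟨[], l, rfl, rfl, hl⟩
      · obtain ⟨rfl, hl⟩ := List.cons.inj h
        obtain ⟨l₁, l₂, rfl, h1, h2⟩ := ih hl
        refine ⟨p :: l₁, l₂, rfl, ?_, h2⟩
        rw [List.cons_append, reduceWalk_cons, h1]
        rcases U with _ | ⟨u, _ | ⟨u', U⟩⟩
        · rfl
        · exact pushCell_of_ne (fun hx => hne u (z :: V) (by rw [hl, ← hx]; rfl)) _ _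
        · exact pushCell_of_ne (fun hx => hne u (U ++ x :: z :: V) (by rw [hl, ← hx]; rfl)) _ _
    · rw [h'] at h
      rw [h] at hw
      -- Cancellation with `p` removes only `q` from the front, so the pair already occurs further
      -- inside, after `q :: U`.
      obtain ⟨l₁, l₂, rfl, h1, h2⟩ := ih (U := q :: U) hw
      refine ⟨p :: l₁, l₂, rfl, ?_, h2⟩
      rw [List.cons_append, reduceWalk_cons, h1]
      rcases U with _ | ⟨u, U⟩
      · obtain ⟨rfl, -⟩ := List.cons.inj h
        exact pushCell_cancel _ _ _
      · obtain ⟨rfl, -⟩ := List.cons.inj h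
        exact pushCell_cancel _ _ _

end Backtracking

/-! ### The reduced walk is an invariant of zigzags. -/

section Words

variable {P : Type u}

/-- `l` is a list from `a` to `b`. -/
structure IsWalk (l : List P) (a b : P) : Prop where
  head_eq : l.head? = some a
  last_eq : l.getLast? = some b

namespace IsWalk

variable {l m : List P} {a b c : P}

lemma exists_cons (h : IsWalk l a b) : ∃ l', l = a :: l' := List.head?_eq_some_iff.1 h.head_eq

lemma exists_concat (h : IsWalk l a b) : ∃ l', l = l' ++ [b] := List.getLast?_eq_some_iff.1 h.last_eq

lemma cons_tail (h : IsWalk l a b) : a :: l.tail = l := by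
  obtain ⟨l', rfl⟩ := h.exists_cons
  rfl

lemma reverse (h : IsWalk l a b) : IsWalk l.reverse b a :=
  ⟨by rw [List.head?_reverse, h.last_eq], by rw [List.getLast?_reverse, h.head_eq]⟩

lemma append (h : IsWalk l a b) (h' : IsWalk m b c) : IsWalk (l ++ m.tail) a c := by
  obtain ⟨l', rfl⟩ := h.exists_concat
  have : l' ++ [b] ++ m.tail = l' ++ m := by rw [List.append_assoc, List.singleton_append, h'.cons_tail]
  refine ⟨?_, ?_⟩
  · obtain ⟨k, hk⟩ := h.exists_cons
    rw [hk]
    rfl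
  · rw [this, List.getLast?_append, h'.last_eq]
    rfl

lemma tail_reverse_append (h : IsWalk l a b) (h' : IsWalk m b c) :
    (l ++ m.tail).reverse.tail = m.reverse.tail ++ l.reverse.tail := by
  obtain ⟨l', rfl⟩ := h.exists_concat
  obtain ⟨m', rfl⟩ := h'.exists_cons
  rcases List.eq_nil_or_concat m' with rfl | ⟨k, e, rfl⟩ <;> simp

lemma append_tail (l : List P) (h' : IsWalk m b c) (k : List P) :
    l ++ m.tail ++ k = l ++ (m ++ k).tail := by
  obtain ⟨m', rfl⟩ := h'.exists_cons
  simp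

lemma singleton (a : P) : IsWalk [a] a a := ⟨rfl, rfl⟩

lemma reduceWalk_congr (h : IsWalk l a b) {m' : List P} (hm : IsWalk m b c)
    (hm' : IsWalk m' b c') (e : reduceWalk m = reduceWalk m') :
    reduceWalk (l ++ m.tail) = reduceWalk (l ++ m'.tail) := by
  obtain ⟨l', rfl⟩ := h.exists_concat
  have := reduceWalk_append_congr e l'
  rwa [← hm.cons_tail, ← hm'.cons_tail, ← List.singleton_append, ← List.append_assoc,
    ← List.singleton_append (l := m'.tail), ← List.append_assoc] at this

lemma reduceWalk_loop (h : IsWalk l a b) (h' : IsWalk m b c) (k : List P) :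
    reduceWalk (l ++ m.tail ++ m.reverse.tail ++ k) = reduceWalk (l ++ k) := by
  obtain ⟨l', rfl⟩ := h.exists_concat
  obtain ⟨m', rfl⟩ := h'.exists_cons
  simpa using reduceWalk_append_loop l' k b m'

end IsWalk

variable [PartialOrder P]

/-- The cells of a morphism of the entrance path category. -/
def Ent.path {a b : Ent P} (g : a ⟶ b) : List P := EntrancePath.cells g

lemma Ent.hom_ext {a b : Ent P} {g g' : a ⟶ b} (h : Ent.path g = Ent.path g') : g = g' :=
  EntrancePath.ext h

lemma Ent.path_id (a : Ent P) : Ent.path (𝟙 a) = [a.cell] := rfl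

lemma Ent.path_comp {a b c : Ent P} (g : a ⟶ b) (g' : b ⟶ c) :
    Ent.path (g ≫ g') = Ent.path g ++ (Ent.path g').tail := rfl

lemma Ent.isWalk_path {a b : Ent P} (g : a ⟶ b) : IsWalk (Ent.path g) a.cell b.cell :=
  ⟨EntrancePath.head_eq g, EntrancePath.last_eq g⟩

lemma Ent.isChain_path {a b : Ent P} (g : a ⟶ b) : (Ent.path g).IsChain (· > ·) :=
  EntrancePath.descending g

namespace LocZigzag

variable {W : MorphismProperty (Ent P)}

/-- The list of all cells of a zigzag. -/
def word : ∀ {a b : Ent P}, LocZigzag W a b → List P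
  | _, _, .last g => Ent.path g
  | _, _, .cons g f _ s => Ent.path g ++ (Ent.path f).reverse.tail ++ s.word.tail

lemma isWalk_word {a b : Ent P} (s : LocZigzag W a b) : IsWalk s.word a.cell b.cell := by
  induction s with
  | last g => exact Ent.isWalk_path g
  | cons g f hf s ih => exact ((Ent.isWalk_path g).append (Ent.isWalk_path f).reverse).append ih

lemma word_append {a b c : Ent P} (s : LocZigzag W a b) (t : LocZigzag W b c) :
    (s.append t).word = s.word ++ t.word.tail := by
  induction s with
  | last g =>
    cases t with
    | last g' => rfl
    | cons g' f hf t =>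
      have h := IsWalk.append_tail (Ent.path g) (Ent.isWalk_path g')
        ((Ent.path f).reverse.tail ++ t.word.tail)
      simp only [append, word, Ent.path_comp, List.append_assoc] at h ⊢
      exact h
  | cons g f hf s ih =>
    simp only [append, word, ih, List.append_assoc]
    obtain ⟨k, hk⟩ := s.isWalk_word.exists_cons
    simp [hk]

lemma Horizontal.word_eq {a b : Ent P} {s t : LocZigzag W a b} (h : Horizontal s t) :
    s.word = t.word := by
  induction h with
  | left_id g h s =>
    rw [word_append]
    simp [word, Ent.path_id]
  | right_id g f hf f' hf' h s =>
    simp only [word, Ent.path_comp, Ent.path_id,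
      (Ent.isWalk_path f').tail_reverse_append (Ent.isWalk_path f), List.nil_append,
      List.cons_append, List.tail_cons, List.append_assoc]
  | cons g f hf _ ih => simp [word, ih]

/-- Both routes around the commutative square agree after inserting loops along `f` and `f'`, which
reduction removes. -/
lemma reduceWalk_square {a x y x' y' : Ent P} (g : a ⟶ y) (f : x ⟶ y) (u : y ⟶ y') (v : x ⟶ x')
    (f' : x' ⟶ y') (h : v ≫ f' = f ≫ u) (k : List P) :
    reduceWalk (Ent.path g ++ (Ent.path u).tail ++ (Ent.path f').reverse.tail ++ k)
      = reduceWalk (Ent.path g ++ (Ent.path f).reverse.tail ++ (Ent.path v).tail ++ k) := by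
  have h1 := ((Ent.isWalk_path g).append (Ent.isWalk_path f).reverse).append (Ent.isWalk_path v)
  rw [← h1.reduceWalk_loop (Ent.isWalk_path f') k]
  have h2 : (Ent.path v).tail ++ (Ent.path f').tail = (Ent.path f).tail ++ (Ent.path u).tail := by
    have := congrArg (fun p => (Ent.path p).tail) h
    simp only [Ent.path_comp] at this
    obtain ⟨p, hp⟩ := (Ent.isWalk_path v).exists_cons
    obtain ⟨q, hq⟩ := (Ent.isWalk_path f).exists_cons
    simpa [hp, hq] using this
  have h3 := (Ent.isWalk_path g).reduceWalk_loop (Ent.isWalk_path f).reverse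
    ((Ent.path u).tail ++ (Ent.path f').reverse.tail ++ k)
  rw [List.reverse_reverse] at h3
  simp only [List.append_assoc] at h3 ⊢
  rw [← h3, ← List.append_assoc (Ent.path v).tail, h2]
  simp only [List.append_assoc]

/-- The vertical map is moved through the ladder one square at a time until it reaches the identity
on the right. -/
lemma Ladder.reduceWalk_eq {a a' b : Ent P} {v : a ⟶ a'} {s : LocZigzag W a b}
    {t : LocZigzag W a' b} (h : Ladder (fun _ _ p q => p = q) v s t) :
    reduceWalk (Ent.path v ++ t.word.tail) = reduceWalk s.word := by
  induction h with
  | last v g g' h =>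
    simp only [word, ← h, Ent.path_comp]
  | cons v g f hf s g' f' hf' s' u hu v' hv' h₁ h₂ _ ih =>
    have e1 : Ent.path v ++ (word (.cons g' f' hf' s')).tail
        = Ent.path g ++ (Ent.path u).tail ++ (Ent.path f').reverse.tail ++ s'.word.tail := by
      have h := congrArg Ent.path h₁
      simp only [Ent.path_comp] at h
      rw [← h]
      obtain ⟨k, hk⟩ := (Ent.isWalk_path g').exists_cons
      simp [word, hk]
    rw [e1, reduceWalk_square g f u v' f' h₂]
    obtain ⟨k, hk⟩ := (Ent.isWalk_path v').exists_cons
    have := ((Ent.isWalk_path g).append (Ent.isWalk_path f).reverse).reduceWalk_congr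
      ((Ent.isWalk_path v').append s'.isWalk_word) s.isWalk_word ih
    simp only [word]
    rw [← this, hk]
    simp

lemma Related.reduceWalk_eq {a b : Ent P} {s t : LocZigzag W a b} (h : Related s t) :
    reduceWalk s.word = reduceWalk t.word := by
  rcases h with h | h
  · rw [h.word_eq]
  · rw [← Ladder.reduceWalk_eq h, Ent.path_id, List.singleton_append, t.isWalk_word.cons_tail]

end LocZigzag

namespace Loc

variable {S : MorphismProperty (Ent P)}

/-- The reduced walk of a morphism of the localization. -/
noncomputable def nf {a b : Loc S} (γ : a ⟶ b) : List P :=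
  Quot.lift (fun s : LocZigzag (addIdentities S) a.obj b.obj => reduceWalk s.word)
    (fun _ _ h => h.reduceWalk_eq) γ

lemma isReducedWalk_nf {a b : Loc S} (γ : a ⟶ b) : IsReducedWalk (nf γ) := by
  obtain ⟨s, rfl⟩ := Quot.exists_rep γ
  exact isReducedWalk_reduceWalk _

end Loc

end Words

/-! ### The reduced walk determines the morphism. -/

section Evaluation

variable {P : Type u} [PartialOrder P]

/-- An acyclic matching `R` of a poset with rank function `d`, in which `R x y` means that `x` is
matched with the larger element `y`; along the zigzags of the matching `d` does not increase, and if
`d` is constant then `h` decreases. -/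
structure IsMorseMatching (R : P → P → Prop) (d : P → ℕ) (h : P → ℝ) : Prop where
  dim_lt {x y : P} : x < y → d x < d y
  lt {x y : P} : R x y → x < y
  dim_eq {x y : P} : R x y → d y = d x + 1
  not_both {x y z : P} : R x y → ¬ R y z
  acyclic {x y y' : P} : x < y → R x y' → y' ≠ y → d y' < d y ∨ d y' = d y ∧ h y' < h y

/-- The morphisms `(y > x)` of the entrance path category for the pairs `R x y`. -/
def pairSystem (R : P → P → Prop) : MorphismProperty (Ent P) :=
  fun a b p => R b.cell a.cell ∧ EntrancePath.cells p = [a.cell, b.cell]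

/-- The two-element sequence `(a > b)`. -/
def Ent.edge {a b : Ent P} (h : b.cell < a.cell) : a ⟶ b :=
  (⟨[a.cell, b.cell], by simpa using h, rfl, rfl⟩ : EntrancePath a.cell b.cell)

lemma Ent.path_edge {a b : Ent P} (h : b.cell < a.cell) : Ent.path (Ent.edge h) = [a.cell, b.cell] :=
  rfl

lemma Ent.eq_id_or_exists_edge_comp {a b : Ent P} (g : a ⟶ b) :
    (∃ h : a = b, g = eqToHom h) ∨
      ∃ (c : Ent P) (h : c.cell < a.cell) (g' : c ⟶ b), g = Ent.edge h ≫ g' := by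
  obtain ⟨l, hl⟩ := (Ent.isWalk_path g).exists_cons
  have hlast := (Ent.isWalk_path g).last_eq
  have hch := Ent.isChain_path g
  rw [hl] at hlast hch
  rcases l with _ | ⟨c, l⟩
  · left
    obtain rfl : a = b := Ent.ext (by simpa using hlast)
    exact ⟨rfl, Ent.hom_ext hl⟩
  · right
    rw [List.isChain_cons_cons] at hch
    exact ⟨⟨c⟩, hch.1, (⟨c :: l, hch.2, rfl, by simpa using hlast⟩ : EntrancePath c b.cell),
      Ent.hom_ext hl⟩

variable {R : P → P → Prop}

namespace Loc

/-- The morphism of the localization given by an entrance path. -/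
def ofPath {a b : Loc (pairSystem R)} (g : a.obj ⟶ b.obj) : a ⟶ b :=
  homMk (.last g)

lemma ofPath_comp {a b c : Loc (pairSystem R)} (g : a.obj ⟶ b.obj) (g' : b.obj ⟶ c.obj) :
    (ofPath (g ≫ g') : a ⟶ c) = (ofPath g : a ⟶ b) ≫ (ofPath g' : b ⟶ c) := rfl

lemma ofPath_id (a : Loc (pairSystem R)) : (ofPath (𝟙 a.obj) : a ⟶ a) = 𝟙 a := rfl

/-- The morphism from a cell to a smaller one. -/
def down {a b : Loc (pairSystem R)} (h : b.obj.cell < a.obj.cell) : a ⟶ b := ofPath (Ent.edge h)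

/-- The formal inverse of `down` for a matched pair. -/
def up {a b : Loc (pairSystem R)} (h : a.obj.cell < b.obj.cell) (hR : R a.obj.cell b.obj.cell) :
    a ⟶ b :=
  homMk (.cons (𝟙 a.obj) (Ent.edge h) (Or.inl ⟨hR, rfl⟩) (.last (𝟙 b.obj)))

lemma up_comp_down {a b : Loc (pairSystem R)} (h : a.obj.cell < b.obj.cell)
    (hR : R a.obj.cell b.obj.cell) : up h hR ≫ down h = 𝟙 a := by
  -- A commutative ladder with vertical maps `𝟙` and `Ent.edge h` compares the composite with a
  -- zigzag of identities.
  have e1 : (homMk (.cons (𝟙 a.obj) (Ent.edge h) (Or.inl ⟨hR, rfl⟩) (.last (Ent.edge h))) : a ⟶ a)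
      = homMk (.cons (𝟙 a.obj) (𝟙 a.obj) (Or.inr ⟨rfl, rfl⟩) (.last (𝟙 a.obj))) :=
    Quot.sound (Or.inr (.cons _ _ _ _ _ _ _ _ _ (𝟙 a.obj) (Or.inr ⟨rfl, rfl⟩) (Ent.edge h)
      (Or.inl ⟨hR, rfl⟩) rfl rfl (.last _ _ _ rfl)))
  exact e1.trans (Quot.sound (Or.inl (.left_id _ _ _)))

lemma down_comp_up {a b : Loc (pairSystem R)} (h : a.obj.cell < b.obj.cell)
    (hR : R a.obj.cell b.obj.cell) : down h ≫ up h hR = 𝟙 b := by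
  have e1 : (homMk (.cons (𝟙 b.obj) (𝟙 b.obj) (Or.inr ⟨rfl, rfl⟩) (.last (𝟙 b.obj))) : b ⟶ b)
      = homMk (.cons (Ent.edge h) (Ent.edge h) (Or.inl ⟨hR, rfl⟩) (.last (𝟙 b.obj))) :=
    Quot.sound (Or.inr (.cons _ _ _ _ _ _ _ _ _ (Ent.edge h) (Or.inl ⟨hR, rfl⟩) (𝟙 b.obj)
      (Or.inr ⟨rfl, rfl⟩) rfl rfl (.last _ _ _ rfl)))
  exact e1.symm.trans (Quot.sound (Or.inl (.left_id _ _ _)))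

/-- The walk `l` represents the morphism `γ`. -/
inductive Rep : List P → ∀ {a b : Loc (pairSystem R)}, (a ⟶ b) → Prop
  | nil (a : Loc (pairSystem R)) : Rep [a.obj.cell] (𝟙 a)
  | down {a b c : Loc (pairSystem R)} (h : b.obj.cell < a.obj.cell) {l : List P} {γ : b ⟶ c} :
      Rep l γ → Rep (a.obj.cell :: l) (down h ≫ γ)
  | up {a b c : Loc (pairSystem R)} (h : a.obj.cell < b.obj.cell) (hR : R a.obj.cell b.obj.cell)
      {l : List P} {γ : b ⟶ c} : Rep l γ → Rep (a.obj.cell :: l) (up h hR ≫ γ)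

namespace Rep

lemma isWalk {l : List P} {a b : Loc (pairSystem R)} {γ : a ⟶ b} (h : Rep l γ) :
    IsWalk l a.obj.cell b.obj.cell := by
  induction h with
  | nil a => exact IsWalk.singleton _
  | down h _ ih =>
    obtain ⟨k, rfl⟩ := ih.exists_cons
    exact ⟨rfl, by rw [List.getLast?_cons_cons]; exact ih.last_eq⟩
  | up h hR _ ih =>
    obtain ⟨k, rfl⟩ := ih.exists_cons
    exact ⟨rfl, by rw [List.getLast?_cons_cons]; exact ih.last_eq⟩

lemma obj_eq {x : P} {l : List P} {a b : Loc (pairSystem R)} {γ : a ⟶ b} (h : Rep (x :: l) γ) :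
    a = ⟨⟨x⟩⟩ := by
  have := h.isWalk.head_eq
  exact Loc.ext (Ent.ext (by simpa using this.symm))

lemma eq_id {x : P} {a : Loc (pairSystem R)} {γ : a ⟶ a} (h : Rep [x] γ) : γ = 𝟙 a := by
  generalize hl : [x] = l at h
  cases h with
  | nil => rfl
  | down h h' =>
    obtain ⟨k, rfl⟩ := h'.isWalk.exists_cons
    simp at hl
  | up h hR h' =>
    obtain ⟨k, rfl⟩ := h'.isWalk.exists_cons
    simp at hl

lemma cons_cons {x y : P} {l : List P} {a b : Loc (pairSystem R)} {γ : a ⟶ b}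
    (h : Rep (x :: y :: l) γ) :
    ∃ (δ : (⟨⟨y⟩⟩ : Loc (pairSystem R)) ⟶ b), Rep (y :: l) δ ∧
      ((∃ h : y < a.obj.cell, γ = Loc.down (b := ⟨⟨y⟩⟩) h ≫ δ) ∨
        ∃ (h : a.obj.cell < y) (hR : R a.obj.cell y), γ = Loc.up (b := ⟨⟨y⟩⟩) h hR ≫ δ) := by
  generalize hl : x :: y :: l = l' at h
  cases h with
  | nil => simp at hl
  | down h h' =>
    obtain ⟨rfl, rfl⟩ := List.cons.inj hl
    obtain rfl := h'.obj_eq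
    exact ⟨_, h', Or.inl ⟨h, rfl⟩⟩
  | up h hR h' =>
    obtain ⟨rfl, rfl⟩ := List.cons.inj hl
    obtain rfl := h'.obj_eq
    exact ⟨_, h', Or.inr ⟨h, hR, rfl⟩⟩

/-- The order of consecutive cells decides between `down` and `up`, so a walk leaves no choice. -/
lemma unique {l : List P} {a b : Loc (pairSystem R)} {γ γ' : a ⟶ b} (h : Rep l γ) (h' : Rep l γ') :
    γ = γ' := by
  induction h with
  | nil a => exact h'.eq_id.symm
  | @down a b c h l γ h1 ih =>
    obtain ⟨k, rfl⟩ := h1.isWalk.exists_cons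
    obtain ⟨δ, hδ, ⟨h2, rfl⟩ | ⟨h2, hR, rfl⟩⟩ := h'.cons_cons
    · rw [ih hδ]
    · exact absurd h2 h.not_gt
  | @up a b c h hR l γ h1 ih =>
    obtain ⟨k, rfl⟩ := h1.isWalk.exists_cons
    obtain ⟨δ, hδ, ⟨h2, rfl⟩ | ⟨h2, hR, rfl⟩⟩ := h'.cons_cons
    · exact absurd h2 h.not_gt
    · rw [ih hδ]

lemma pushCell_down {a b c : Loc (pairSystem R)} (h : b.obj.cell < a.obj.cell) {w : List P}
    {γ : b ⟶ c} (hw : Rep w γ) : Rep (pushCell a.obj.cell w) (Loc.down h ≫ γ) := by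
  rcases pushCell_eq_cons_or a.obj.cell w with ⟨h', -⟩ | ⟨x, r, rfl, h'⟩
  · rw [h']
    exact .down h hw
  · rw [h']
    obtain ⟨δ, hδ, ⟨h2, rfl⟩ | ⟨h2, hR, rfl⟩⟩ := hw.cons_cons
    · exact absurd h2 h.not_gt
    · rw [← Category.assoc]
      have := down_comp_up (a := b) (b := a) h hR
      erw [this, Category.id_comp]
      exact hδ

lemma pushCell_up {a b c : Loc (pairSystem R)} (h : a.obj.cell < b.obj.cell)
    (hR : R a.obj.cell b.obj.cell) {w : List P}
    {γ : b ⟶ c} (hw : Rep w γ) : Rep (pushCell a.obj.cell w) (Loc.up h hR ≫ γ) := by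
  rcases pushCell_eq_cons_or a.obj.cell w with ⟨h', -⟩ | ⟨x, r, rfl, h'⟩
  · rw [h']
    exact .up h hR hw
  · rw [h']
    obtain ⟨δ, hδ, ⟨h2, rfl⟩ | ⟨h2, hR, rfl⟩⟩ := hw.cons_cons
    · rw [← Category.assoc]
      have := up_comp_down (a := a) (b := b) h hR
      erw [this, Category.id_comp]
      exact hδ
    · exact absurd h2 h.not_gt

/-- Cancellation is sound: one of the two steps of a backtracking ascends, hence follows a matched
pair, and the other is its inverse. -/
lemma reduceWalk {l : List P} {a b : Loc (pairSystem R)} {γ : a ⟶ b} (h : Rep l γ) :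
    Rep (reduceWalk l) γ := by
  induction h with
  | nil a => exact .nil a
  | down h _ ih => exact ih.pushCell_down h
  | up h hR _ ih => exact ih.pushCell_up h hR

lemma ofPath_comp {a b c : Loc (pairSystem R)} (g : a.obj ⟶ b.obj) {l : List P} {γ : b ⟶ c}
    (h : Rep l γ) : Rep (Ent.path g ++ l.tail) ((ofPath g : a ⟶ b) ≫ γ) := by
  obtain ⟨n, hn⟩ : ∃ n, (Ent.path g).length = n := ⟨_, rfl⟩
  induction n generalizing a with
  | zero =>
    obtain ⟨k, hk⟩ := (Ent.isWalk_path g).exists_cons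
    simp [hk] at hn
  | succ n ih =>
    rcases Ent.eq_id_or_exists_edge_comp g with ⟨hab, rfl⟩ | ⟨x, hx, g', rfl⟩
    · obtain rfl : a = b := Loc.ext hab
      rw [eqToHom_refl, ofPath_id, Category.id_comp, Ent.path_id, List.singleton_append,
        h.isWalk.cons_tail]
      exact h
    · rw [Loc.ofPath_comp (b := ⟨x⟩), Category.assoc]
      obtain ⟨k, hk⟩ := (Ent.isWalk_path g').exists_cons
      have e : Ent.path (Ent.edge hx ≫ g') = a.obj.cell :: Ent.path g' := by
        rw [Ent.path_comp, Ent.path_edge, hk]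
        rfl
      rw [e] at hn ⊢
      exact .down hx (ih (a := ⟨x⟩) g' (by simpa using hn))

end Rep

/-- The morphism represented by a zigzag of length one. -/
lemma homMk_cons {a b : Loc (pairSystem R)} {x y : Ent P} (g : a.obj ⟶ y) (f : x ⟶ y)
    (hf : addIdentities (pairSystem R) f) (s : LocZigzag (addIdentities (pairSystem R)) x b.obj) :
    (homMk (.cons g f hf s) : a ⟶ b) = (ofPath g : a ⟶ ⟨y⟩) ≫
      (homMk (.cons (𝟙 y) f hf (.last (𝟙 x))) : (⟨y⟩ : Loc (pairSystem R)) ⟶ ⟨x⟩) ≫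
      (homMk s : (⟨x⟩ : Loc (pairSystem R)) ⟶ b) := by
  unfold ofPath
  rw [← homMk_append, ← homMk_append]
  simp only [LocZigzag.append, Category.comp_id]
  rw [LocZigzag.last_id_append]

lemma homMk_inv_eq {x y : Ent P} {f : x ⟶ y} (hf : addIdentities (pairSystem R) f) :
    (∃ h : x = y, f = eqToHom h ∧
      (homMk (.cons (𝟙 y) f hf (.last (𝟙 x))) : (⟨y⟩ : Loc (pairSystem R)) ⟶ ⟨x⟩)
        = eqToHom (by rw [h])) ∨
    ∃ (h : y.cell < x.cell) (hR : R y.cell x.cell), f = Ent.edge h ∧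
      (homMk (.cons (𝟙 y) f hf (.last (𝟙 x))) : (⟨y⟩ : Loc (pairSystem R)) ⟶ ⟨x⟩) = up h hR := by
  rcases id hf with ⟨hR, hp⟩ | ⟨rfl, rfl⟩
  · right
    have hch := Ent.isChain_path f
    have hp' : Ent.path f = [x.cell, y.cell] := hp
    rw [hp'] at hch
    have h : y.cell < x.cell := by simpa using hch
    obtain rfl : f = Ent.edge h := Ent.hom_ext hp
    exact ⟨h, hR, rfl, rfl⟩
  · left
    exact ⟨rfl, rfl, Quot.sound (Or.inl (.left_id _ _ _))⟩

lemma rep_word {w z : Ent P} (s : LocZigzag (addIdentities (pairSystem R)) w z) :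
    Rep s.word (homMk s : (⟨w⟩ : Loc (pairSystem R)) ⟶ ⟨z⟩) := by
  induction s with
  | @last w z g =>
    have h := Rep.ofPath_comp (R := R) (a := ⟨w⟩) (b := ⟨z⟩) g (.nil ⟨z⟩)
    rw [Category.comp_id, List.tail_cons, List.append_nil] at h
    exact h
  | @cons w y x z g f hf s ih =>
    rw [homMk_cons (a := ⟨w⟩) (b := ⟨z⟩)]
    obtain ⟨k, hk⟩ := s.isWalk_word.exists_cons
    rcases homMk_inv_eq hf with ⟨rfl, rfl, h⟩ | ⟨h, hR, rfl, e⟩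
    · rw [h]
      have := Rep.ofPath_comp (a := ⟨w⟩) (b := ⟨x⟩) g ih
      simpa [LocZigzag.word, Ent.path_id] using this
    · rw [e]
      have := Rep.ofPath_comp (a := ⟨w⟩) (b := ⟨y⟩) g (.up (a := ⟨y⟩) (b := ⟨x⟩) h hR ih)
      simpa [LocZigzag.word, Ent.path_edge, hk] using this

lemma rep_nf {a b : Loc (pairSystem R)} (γ : a ⟶ b) : Rep (nf γ) γ := by
  obtain ⟨s, rfl⟩ := Quot.exists_rep γ
  exact (rep_word s).reduceWalk

/-- The normal form itself represents the morphism, and a walk represents at most one. -/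
lemma nf_injective {a b : Loc (pairSystem R)} {γ γ' : a ⟶ b} (h : nf γ = nf γ') : γ = γ' :=
  (rep_nf γ).unique (h ▸ rep_nf γ')

lemma isWalk_nf {a b : Loc (pairSystem R)} (γ : a ⟶ b) : IsWalk (nf γ) a.obj.cell b.obj.cell :=
  (rep_nf γ).isWalk

lemma nf_comp {a b c : Loc (pairSystem R)} (γ : a ⟶ b) (δ : b ⟶ c) :
    nf (γ ≫ δ) = reduceWalk (nf γ ++ (nf δ).tail) := by
  obtain ⟨s, rfl⟩ := Quot.exists_rep γ
  obtain ⟨t, rfl⟩ := Quot.exists_rep δ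
  change reduceWalk (s.append t).word = reduceWalk (reduceWalk s.word ++ _)
  rw [LocZigzag.word_append, reduceWalk_reduceWalk_append]
  exact s.isWalk_word.reduceWalk_congr t.isWalk_word (isWalk_nf (homMk t : b ⟶ c))
    (isReducedWalk_reduceWalk _).reduceWalk_eq.symm

lemma nf_down {a b : Loc (pairSystem R)} (h : b.obj.cell < a.obj.cell) :
    nf (down h : a ⟶ b) = [a.obj.cell, b.obj.cell] := rfl

lemma nf_up {a b : Loc (pairSystem R)} (h : a.obj.cell < b.obj.cell)
    (hR : R a.obj.cell b.obj.cell) : nf (up h hR : a ⟶ b) = [a.obj.cell, b.obj.cell] := rfl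

lemma Rep.nf_eq {l : List P} {a b : Loc (pairSystem R)} {γ : a ⟶ b} (h : Rep l γ) :
    nf γ = _root_.reduceWalk l := by
  induction h with
  | nil a => rfl
  | @down a b c h l γ h' ih =>
    rw [nf_comp, nf_down, List.cons_append, List.singleton_append, (isWalk_nf γ).cons_tail, ih]
    exact congrArg (pushCell _) (isReducedWalk_reduceWalk l).reduceWalk_eq
  | @up a b c h hR l γ h' ih =>
    rw [nf_comp, nf_up, List.cons_append, List.singleton_append, (isWalk_nf γ).cons_tail, ih]
    exact congrArg (pushCell _) (isReducedWalk_reduceWalk l).reduceWalk_eq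

/-- Consecutive cells of a walk. -/
def IsStep (R : P → P → Prop) (x y : P) : Prop := y < x ∨ x < y ∧ R x y

lemma Rep.isChain {l : List P} {a b : Loc (pairSystem R)} {γ : a ⟶ b} (h : Rep l γ) :
    l.IsChain (IsStep R) := by
  induction h with
  | nil a => simp
  | down h h' ih =>
    obtain ⟨k, rfl⟩ := h'.isWalk.exists_cons
    exact List.isChain_cons_cons.2 ⟨Or.inl h, ih⟩
  | up h hR h' ih =>
    obtain ⟨k, rfl⟩ := h'.isWalk.exists_cons
    exact List.isChain_cons_cons.2 ⟨Or.inr ⟨h, hR⟩, ih⟩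

lemma exists_rep {l : List P} (hl : l.IsChain (IsStep R)) {a b : Loc (pairSystem R)}
    (hw : IsWalk l a.obj.cell b.obj.cell) : ∃ γ : a ⟶ b, Rep l γ := by
  induction l generalizing a with
  | nil => simpa using hw.head_eq
  | cons x l ih =>
    obtain rfl : x = a.obj.cell := by simpa using hw.head_eq
    rcases l with _ | ⟨y, l⟩
    · obtain rfl : a = b := Loc.ext (Ent.ext (by simpa using hw.last_eq))
      exact ⟨𝟙 a, .nil a⟩
    · rw [List.isChain_cons_cons] at hl
      obtain ⟨δ, hδ⟩ := ih hl.2 (a := ⟨⟨y⟩⟩)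
        ⟨rfl, by have := hw.last_eq; rwa [List.getLast?_cons_cons] at this⟩
      rcases hl.1 with h | ⟨h, hR⟩
      · exact ⟨_, .down (b := ⟨⟨y⟩⟩) h hδ⟩
      · exact ⟨_, .up (b := ⟨⟨y⟩⟩) h hR hδ⟩

end Loc

end Evaluation

/-! ### The order implies refinement; antisymmetry. -/

section Order

variable {P : Type u} [PartialOrder P]

/-- The number of steps of an entrance path. -/
def Ent.len {a b : Ent P} (g : a ⟶ b) : ℤ := (Ent.path g).length - 1

lemma Ent.len_id (a : Ent P) : Ent.len (𝟙 a) = 0 := rfl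

lemma Ent.len_comp {a b c : Ent P} (g : a ⟶ b) (g' : b ⟶ c) :
    Ent.len (g ≫ g') = Ent.len g + Ent.len g' := by
  obtain ⟨k, hk⟩ := (Ent.isWalk_path g').exists_cons
  simp [Ent.len, Ent.path_comp, hk]
  ring

lemma Ent.le_of_hom {a b : Ent P} (g : a ⟶ b) : b.cell ≤ a.cell := by
  obtain ⟨n, hn⟩ : ∃ n, (Ent.path g).length = n := ⟨_, rfl⟩
  induction n generalizing a with
  | zero =>
    obtain ⟨k, hk⟩ := (Ent.isWalk_path g).exists_cons
    simp [hk] at hn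
  | succ n ih =>
    rcases Ent.eq_id_or_exists_edge_comp g with ⟨rfl, rfl⟩ | ⟨x, hx, g', rfl⟩
    · rfl
    · refine (ih g' ?_).trans hx.le
      obtain ⟨k, hk⟩ := (Ent.isWalk_path g').exists_cons
      simpa [Ent.path_comp, Ent.path_edge, hk] using hn

lemma Ent.path_edge_comp {a b c : Ent P} (h : b.cell < a.cell) (g : b ⟶ c) :
    Ent.path (Ent.edge h ≫ g) = a.cell :: Ent.path g := by
  rw [Ent.path_comp, Ent.path_edge, List.cons_append, List.singleton_append,
    (Ent.isWalk_path g).cons_tail]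

lemma Ent.not_lt_of_hom {a b x : Ent P} (h : x.cell < a.cell) (g : x ⟶ b) (hab : a = b) : False :=
  (hab ▸ (Ent.le_of_hom g)).not_gt h

namespace LocZigzag

variable {W : MorphismProperty (Ent P)}

/-- The number of steps of a zigzag, where left-pointing steps count negatively. -/
def len : ∀ {a b : Ent P}, LocZigzag W a b → ℤ
  | _, _, .last g => Ent.len g
  | _, _, .cons g f _ s => Ent.len g - Ent.len f + s.len

lemma len_append {a b c : Ent P} (s : LocZigzag W a b) (t : LocZigzag W b c) :
    (s.append t).len = s.len + t.len := by
  induction s with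
  | last g =>
    cases t with
    | last g' => exact Ent.len_comp g g'
    | cons g' f hf t => simp only [append, len, Ent.len_comp]; ring
  | cons g f hf s ih => simp only [append, len, ih]; ring

lemma Related.len_eq {a b : Ent P} {s t : LocZigzag W a b} (h : Related s t) : s.len = t.len := by
  rcases h with h | h
  · induction h with
    | left_id g h s => simp only [len_append, len, Ent.len_id]; ring
    | right_id g f hf f' hf' h s => simp only [len, Ent.len_comp, Ent.len_id]; ring
    | cons g f hf _ ih => simp only [len, ih]
  · have key : ∀ {a a' b : Ent P} {v : a ⟶ a'} {s : LocZigzag W a b} {t : LocZigzag W a' b},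
        Ladder (fun _ _ p q => p = q) v s t → Ent.len v + t.len = s.len := by
      intro a a' b v s t h
      induction h with
      | last v g g' h => rw [len, len, ← h, Ent.len_comp]
      | cons v g f hf s g' f' hf' s' u hu v' hv' h₁ h₂ _ ih =>
        have e1 := congrArg Ent.len h₁
        have e2 := congrArg Ent.len h₂
        simp only [Ent.len_comp] at e1 e2
        simp only [len]
        linarith
    have := key h
    rw [Ent.len_id, zero_add] at this
    exact this.symm

end LocZigzag

namespace Loc

variable {R : P → P → Prop}

/-- The length of a morphism of the localization. -/
def len {a b : Loc (pairSystem R)} (γ : a ⟶ b) : ℤ :=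
  Quot.lift (fun s : LocZigzag (addIdentities (pairSystem R)) a.obj b.obj => s.len)
    (fun _ _ h => h.len_eq) γ

lemma len_comp {a b c : Loc (pairSystem R)} (γ : a ⟶ b) (δ : b ⟶ c) :
    len (γ ≫ δ) = len γ + len δ := by
  obtain ⟨s, rfl⟩ := Quot.exists_rep γ
  obtain ⟨t, rfl⟩ := Quot.exists_rep δ
  exact LocZigzag.len_append s t

lemma len_down {a b : Loc (pairSystem R)} (h : b.obj.cell < a.obj.cell) :
    len (down h : a ⟶ b) = 1 := rfl

/-- Elementary refinements: a step `x > z` is replaced by `x > y > z`. -/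
inductive Refine {a b : Loc (pairSystem R)} : (a ⟶ b) → (a ⟶ b) → Prop
  | mk {x y z : Loc (pairSystem R)} (A : a ⟶ x) (hxy : y.obj.cell < x.obj.cell)
      (hyz : z.obj.cell < y.obj.cell) (B : z ⟶ b) :
      Refine (A ≫ down (hyz.trans hxy) ≫ B) (A ≫ down hxy ≫ down hyz ≫ B)

/-- Sequences of elementary refinements. -/
def Refines {a b : Loc (pairSystem R)} : (a ⟶ b) → (a ⟶ b) → Prop := Relation.ReflTransGen Refine

lemma Refine.len_lt {a b : Loc (pairSystem R)} {γ γ' : a ⟶ b} (h : Refine γ' γ) :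
    len γ' < len γ := by
  obtain ⟨A, hxy, hyz, B⟩ := h
  simp only [len_comp, len_down]
  linarith

lemma Refines.eq_or_len_lt {a b : Loc (pairSystem R)} {γ γ' : a ⟶ b} (h : Refines γ' γ) :
    γ' = γ ∨ len γ' < len γ := by
  induction h with
  | refl => exact Or.inl rfl
  | tail _ h ih =>
    rcases ih with rfl | ih
    · exact Or.inr h.len_lt
    · exact Or.inr (ih.trans h.len_lt)

lemma Refines.comp_left {a b c : Loc (pairSystem R)} (α : a ⟶ b) {γ γ' : b ⟶ c}
    (h : Refines γ' γ) : Refines (α ≫ γ') (α ≫ γ) := by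
  refine Relation.ReflTransGen.lift (fun γ => α ≫ γ) ?_ _ _ h
  rintro _ _ ⟨A, hxy, hyz, B⟩
  have := Refine.mk (α ≫ A) hxy hyz B
  simpa only [Category.assoc] using this

lemma Refines.comp_right {a b c : Loc (pairSystem R)} {γ γ' : a ⟶ b}
    (h : Refines γ' γ) (β : b ⟶ c) : Refines (γ' ≫ β) (γ ≫ β) := by
  refine Relation.ReflTransGen.lift (fun γ => γ ≫ β) ?_ _ _ h
  rintro _ _ ⟨A, hxy, hyz, B⟩
  have := Refine.mk A hxy hyz (B ≫ β)
  simpa only [Function.onFun, Category.assoc] using this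

lemma refines_of_sublist {a b : Loc (pairSystem R)} {g g' : a.obj ⟶ b.obj}
    (h : (Ent.path g).Sublist (Ent.path g')) : Refines (ofPath g : a ⟶ b) (ofPath g') := by
  obtain ⟨n, hn⟩ : ∃ n, (Ent.path g').length = n := ⟨_, rfl⟩
  induction n generalizing a with
  | zero =>
    obtain ⟨k, hk⟩ := (Ent.isWalk_path g').exists_cons
    simp [hk] at hn
  | succ n ih =>
    rcases Ent.eq_id_or_exists_edge_comp g' with ⟨hab, rfl⟩ | ⟨x, hx, g₁', rfl⟩
    · rcases Ent.eq_id_or_exists_edge_comp g with ⟨_, rfl⟩ | ⟨y, hy, g₁, rfl⟩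
      · exact .refl
      · exact (Ent.not_lt_of_hom hy g₁ hab).elim
    · rcases Ent.eq_id_or_exists_edge_comp g with ⟨hab, rfl⟩ | ⟨y, hy, g₁, rfl⟩
      · exact (Ent.not_lt_of_hom hx g₁' hab).elim
      · rw [Ent.path_edge_comp] at hn
        rw [Ent.path_edge_comp, Ent.path_edge_comp, List.cons_sublist_cons] at h
        by_cases hxy : y = x
        · subst hxy
          exact (ih (a := ⟨y⟩) h (by simpa using hn)).comp_left (down (b := ⟨y⟩) hy)
        · obtain ⟨k, hk⟩ := (Ent.isWalk_path g₁).exists_cons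
          rcases Ent.eq_id_or_exists_edge_comp g₁' with ⟨rfl, rfl⟩ | ⟨w, hw, g₂', rfl⟩
          · rw [hk, eqToHom_refl, Ent.path_id] at h
            rcases List.sublist_cons_iff.1 h with h | ⟨r, hr, -⟩
            · simp at h
            · exact absurd (Ent.ext (List.cons.inj hr).1) hxy
          · rw [Ent.path_edge_comp] at h hn
            have h2 : (Ent.path g₁).Sublist (Ent.path g₂') := by
              rcases List.sublist_cons_iff.1 h with h | ⟨r, hr, -⟩
              · exact h
              · rw [hk] at hr
                exact absurd (Ent.ext (List.cons.inj hr).1) hxy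
            -- The second cell `x` of `g'` is not used by `g`. Drop it, apply induction, and insert
            -- `x` between `a` and `w` last.
            have h3 := ih (g := Ent.edge hy ≫ g₁) (g' := Ent.edge (hw.trans hx) ≫ g₂')
              (by rw [Ent.path_edge_comp, Ent.path_edge_comp]; exact h2.cons_cons _)
              (by rw [Ent.path_edge_comp]; simpa using hn)
            refine h3.tail ?_
            have := Refine.mk (a := a) (b := b) (y := ⟨x⟩) (z := ⟨w⟩) (𝟙 a) hx hw
              (ofPath (R := R) (a := ⟨w⟩) g₂')
            rwa [Category.id_comp, Category.id_comp] at this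

/-- The formal inverse of a morphism of `Σ⁺`. -/
def inv {x y : Ent P} (f : x ⟶ y) (hf : addIdentities (pairSystem R) f) :
    (⟨y⟩ : Loc (pairSystem R)) ⟶ ⟨x⟩ :=
  homMk (.cons (𝟙 y) f hf (.last (𝟙 x)))

lemma inv_comp {x y : Ent P} (f : x ⟶ y) (hf : addIdentities (pairSystem R) f) :
    inv f hf ≫ ofPath f = 𝟙 _ := by
  rcases homMk_inv_eq hf with ⟨rfl, rfl, h⟩ | ⟨h, hR, rfl, e⟩
  · unfold inv
    rw [h]
    rfl
  · unfold inv
    rw [e]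
    exact up_comp_down (a := ⟨y⟩) (b := ⟨x⟩) h hR

lemma comp_inv {x y : Ent P} (f : x ⟶ y) (hf : addIdentities (pairSystem R) f) :
    ofPath f ≫ inv f hf = 𝟙 _ := by
  rcases homMk_inv_eq hf with ⟨rfl, rfl, h⟩ | ⟨h, hR, rfl, e⟩
  · unfold inv
    rw [h]
    rfl
  · unfold inv
    rw [e]
    exact down_comp_up (a := ⟨y⟩) (b := ⟨x⟩) h hR

variable {d : P → ℕ} {h : P → ℝ}

open Classical in
-- Matched pairs do not chain, so at most one factor is a non-identity, and the composite depends
-- only on its end cells.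
lemma path_comp_of_mem (hM : IsMorseMatching R d h) {x y z : Ent P} {f : x ⟶ y} {u : y ⟶ z}
    (hf : addIdentities (pairSystem R) f) (hu : addIdentities (pairSystem R) u) :
    Ent.path (f ≫ u) = if x.cell = z.cell then [x.cell] else [x.cell, z.cell] := by
  have key : ∀ {x y : Ent P} {f : x ⟶ y}, addIdentities (pairSystem R) f →
      Ent.path f = if x.cell = y.cell then [x.cell] else [x.cell, y.cell] := by
    rintro x y f (⟨hR, hp⟩ | ⟨rfl, rfl⟩)
    · rw [if_neg (hM.lt hR).ne']
      exact hp
    · rw [if_pos rfl]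
      rfl
  rcases id hf with ⟨hR, hp⟩ | ⟨rfl, rfl⟩
  · rcases id hu with ⟨hR', hp'⟩ | ⟨rfl, rfl⟩
    · exact absurd hR (hM.not_both hR')
    · rw [eqToHom_refl, Category.comp_id]
      exact key hf
  · rw [eqToHom_refl, Category.id_comp]
    exact key hu

/-- Only the squares over right-pointing arrows can be strict, and each of these is a subsequence
relation. The squares over left-pointing arrows commute, so vertical maps can be moved past formal
inverses. -/
lemma refines_of_ladder (hM : IsMorseMatching R d h) {a a' b : Ent P} {v : a ⟶ a'}
    {s : LocZigzag (addIdentities (pairSystem R)) a b}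
    {t : LocZigzag (addIdentities (pairSystem R)) a' b}
    (hl : LocZigzag.Ladder HomOrder.le v s t) :
    Refines ((ofPath v : (⟨a⟩ : Loc (pairSystem R)) ⟶ ⟨a'⟩) ≫
      (homMk t : (⟨a'⟩ : Loc (pairSystem R)) ⟶ ⟨b⟩)) (homMk s) := by
  induction hl with
  | @last a a' b v g g' hle =>
    exact refines_of_sublist (a := ⟨a⟩) (b := ⟨b⟩) hle
  | @cons a a' y y' x x' z v g f hf s g' f' hf' s' u hu v' hv' h₁ h₂ _ ih =>
    rw [homMk_cons (a := ⟨a⟩) (b := ⟨z⟩) g f, homMk_cons (a := ⟨a'⟩) (b := ⟨z⟩) g' f']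
    have e : v' ≫ f' = f ≫ u :=
      Ent.hom_ext (by rw [path_comp_of_mem hM hv' hf', path_comp_of_mem hM hf hu])
    have e1 : (ofPath u : (⟨y⟩ : Loc (pairSystem R)) ⟶ ⟨y'⟩) ≫ inv f' hf'
        = inv f hf ≫ (ofPath v' : (⟨x⟩ : Loc (pairSystem R)) ⟶ ⟨x'⟩) := by
      have e2 : (ofPath v' : (⟨x⟩ : Loc (pairSystem R)) ⟶ ⟨x'⟩) ≫ ofPath f' (b := ⟨y'⟩)
          = (ofPath f : (⟨x⟩ : Loc (pairSystem R)) ⟶ ⟨y⟩) ≫ ofPath u :=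
        congrArg (fun p => (ofPath p : (⟨x⟩ : Loc (pairSystem R)) ⟶ ⟨y'⟩)) e
      rw [← Category.comp_id (ofPath v'), ← comp_inv f' hf', ← Category.assoc (ofPath v'), e2,
        Category.assoc, ← Category.assoc (inv f hf), inv_comp, Category.id_comp]
    have r1 := (refines_of_sublist (R := R) (a := ⟨a⟩) (b := ⟨y'⟩) h₁).comp_right
      (inv f' hf' ≫ (homMk s' : (⟨x'⟩ : Loc (pairSystem R)) ⟶ ⟨z⟩))
    rw [ofPath_comp (b := ⟨a'⟩), ofPath_comp (b := ⟨y⟩), Category.assoc, Category.assoc,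
      ← Category.assoc (ofPath u), e1, Category.assoc] at r1
    exact r1.trans ((ih.comp_left _).comp_left _)

lemma refines_of_le (hM : IsMorseMatching R d h) {a b : Loc (pairSystem R)} {γ' γ : a ⟶ b}
    (hle : HomOrder.le γ' γ) : Refines γ' γ := by
  obtain ⟨s, t, rfl, rfl, hl⟩ := hle
  have := refines_of_ladder hM hl
  change Refines (𝟙 a ≫ homMk t) (homMk s) at this
  rwa [Category.id_comp] at this

lemma le_antisymm (hM : IsMorseMatching R d h) {a b : Loc (pairSystem R)} {γ γ' : a ⟶ b}
    (h₁ : HomOrder.le γ γ') (h₂ : HomOrder.le γ' γ) : γ = γ' := by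
  rcases (refines_of_le hM h₁).eq_or_len_lt with h | h
  · exact h
  · rcases (refines_of_le hM h₂).eq_or_len_lt with h' | h'
    · exact h'.symm
    · exact absurd h h'.not_gt

end Loc

end Order

/-! ### Refinement implies the order; transitivity. -/

section Splitting

variable {P : Type u} [PartialOrder P] {R : P → P → Prop}

namespace Loc

lemma Rep.append {l m : List P} {a b c : Loc (pairSystem R)} {γ : a ⟶ b} {δ : b ⟶ c}
    (hγ : Rep l γ) (hδ : Rep m δ) : Rep (l ++ m.tail) (γ ≫ δ) := by
  induction hγ with
  | nil a => rw [List.singleton_append, hδ.isWalk.cons_tail, Category.id_comp]; exact hδ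
  | down h _ ih => rw [Category.assoc]; exact .down h (ih hδ)
  | up h hR _ ih => rw [Category.assoc]; exact .up h hR (ih hδ)

lemma Rep.split {l₁ l₂ : List P} {x : P} {a b : Loc (pairSystem R)} {γ : a ⟶ b}
    (h : Rep (l₁ ++ x :: l₂) γ) :
    ∃ (A : a ⟶ ⟨⟨x⟩⟩) (B : (⟨⟨x⟩⟩ : Loc (pairSystem R)) ⟶ b),
      Rep (l₁ ++ [x]) A ∧ Rep (x :: l₂) B ∧ γ = A ≫ B := by
  induction l₁ generalizing a with
  | nil =>
    obtain rfl := h.obj_eq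
    exact ⟨𝟙 _, γ, .nil ⟨⟨x⟩⟩, h, (Category.id_comp γ).symm⟩
  | cons p l₁ ih =>
    obtain ⟨y, k, hk⟩ : ∃ y k, l₁ ++ x :: l₂ = y :: k := by
      cases l₁ with
      | nil => exact ⟨_, _, rfl⟩
      | cons q l₁ => exact ⟨_, _, rfl⟩
    obtain rfl := h.obj_eq
    rw [List.cons_append, hk] at h
    obtain ⟨δ, hδ, hor⟩ := h.cons_cons
    rw [← hk] at hδ
    obtain ⟨A, B, hA, hB, rfl⟩ := ih hδ
    rcases hor with ⟨hlt, rfl⟩ | ⟨hlt, hR, rfl⟩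
    · exact ⟨_, B, .down (a := ⟨⟨p⟩⟩) hlt hA, hB, (Category.assoc _ _ _).symm⟩
    · exact ⟨_, B, .up (a := ⟨⟨p⟩⟩) hlt hR hA, hB, (Category.assoc _ _ _).symm⟩

lemma Rep.comp_down_comp {l m : List P} {a b x z : Loc (pairSystem R)} {A : a ⟶ x} {B : z ⟶ b}
    (hA : Rep l A) (h : z.obj.cell < x.obj.cell) (hB : Rep m B) :
    Rep (l ++ m) (A ≫ Loc.down h ≫ B) :=
  hA.append (.down h hB)

/-- Cancelling the descent `x > z` would need the ascent from `z` to `x`, which is not available. -/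
lemma nf_comp_down_comp {a b x z : Loc (pairSystem R)} (A : a ⟶ x)
    (h : z.obj.cell < x.obj.cell) (B : z ⟶ b) (hR : ¬ R z.obj.cell x.obj.cell) :
    nf (A ≫ down h ≫ B) = nf A ++ nf B := by
  rw [((rep_nf A).comp_down_comp h (rep_nf B)).nf_eq]
  refine IsReducedWalk.reduceWalk_eq ?_
  obtain ⟨U, hU⟩ := (isWalk_nf A).exists_concat
  obtain ⟨V, hV⟩ := (isWalk_nf B).exists_cons
  have hAr := isReducedWalk_nf A
  have hBr := isReducedWalk_nf B
  have hAc := (rep_nf A).isChain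
  have hBc := (rep_nf B).isChain
  rw [hU] at hAr hAc
  rw [hV] at hBr hBc
  rw [hU, hV, List.append_assoc, List.singleton_append]
  refine IsReducedWalk.append ?_ ?_
  · rcases List.eq_nil_or_concat' U with rfl | ⟨U', p, rfl⟩
    · trivial
    · have e : ∀ k, U' ++ [p] ++ x.obj.cell :: k = U' ++ p :: x.obj.cell :: k := fun k => by simp
      rw [e] at hAr hAc ⊢
      refine hAr.append ⟨?_, trivial⟩
      rintro rfl
      have := (List.isChain_append.1 hAc).2.1
      rw [List.isChain_cons_cons] at this
      rcases this.1 with h' | h'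
      · exact h'.not_gt h
      · exact hR h'.2
  · rcases V with _ | ⟨q, V⟩
    · trivial
    · refine ⟨?_, hBr⟩
      rintro rfl
      rw [List.isChain_cons_cons] at hBc
      rcases hBc.1 with h' | h'
      · exact h'.not_gt h
      · exact hR h'.2

/-- `Ins τ σ`: the list `σ` arises from `τ` by inserting cells in descending steps. -/
inductive Ins : List P → List P → Prop
  | single (a : P) : Ins [a] [a]
  | step (x : P) {y : P} {l m : List P} : Ins (y :: l) (y :: m) → Ins (x :: y :: l) (x :: y :: m)
  | insert {x y z : P} {l m : List P} : y < x → z < y → Ins (y :: z :: l) (y :: m) →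
      Ins (x :: z :: l) (x :: y :: m)

lemma Ins.refl (x : P) (l : List P) : Ins (x :: l) (x :: l) := by
  induction l generalizing x with
  | nil => exact .single x
  | cons y l ih => exact .step x (ih y)

/-- Insertions accumulate: a further cell may be put into any descent of `σ`, including one next to
a cell inserted earlier. -/
lemma Ins.insert_append {τ l₁ l₂ : List P} {x y z : P} (h : Ins τ (l₁ ++ x :: z :: l₂)) (hxy : y < x)
    (hyz : z < y) : Ins τ (l₁ ++ x :: y :: z :: l₂) := by
  generalize hσ : l₁ ++ x :: z :: l₂ = σ at h
  induction h generalizing l₁ with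
  | single a => rcases l₁ with _ | ⟨p, _ | ⟨q, l₁⟩⟩ <;> simp at hσ
  | @step x' y' l m h ih =>
    rcases l₁ with _ | ⟨p, l₁⟩
    · obtain ⟨rfl, h'⟩ := List.cons.inj hσ
      obtain ⟨rfl, rfl⟩ := List.cons.inj h'
      exact .insert hxy hyz (.step y h)
    · obtain ⟨rfl, h'⟩ := List.cons.inj hσ
      have := ih h'
      obtain ⟨k, hk⟩ : ∃ k, l₁ ++ x :: y :: z :: l₂ = y' :: k := by
        rcases l₁ with _ | ⟨q, l₁⟩ <;> obtain ⟨rfl, -⟩ := List.cons.inj h' <;> exact ⟨_, rfl⟩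
      rw [List.cons_append, hk]
      rw [hk] at this
      exact .step _ this
  | @insert x' y' z' l m h₁ h₂ h ih =>
    rcases l₁ with _ | ⟨p, l₁⟩
    · obtain ⟨rfl, h'⟩ := List.cons.inj hσ
      obtain ⟨rfl, rfl⟩ := List.cons.inj h'
      exact .insert hxy (h₂.trans hyz) (.insert hyz h₂ h)
    · obtain ⟨rfl, h'⟩ := List.cons.inj hσ
      have := ih h'
      obtain ⟨k, hk⟩ : ∃ k, l₁ ++ x :: y :: z :: l₂ = y' :: k := by
        rcases l₁ with _ | ⟨q, l₁⟩ <;> obtain ⟨rfl, -⟩ := List.cons.inj h' <;> exact ⟨_, rfl⟩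
      rw [List.cons_append, hk]
      rw [hk] at this
      exact .insert h₁ h₂ this

lemma le_ofPath {a b : Loc (pairSystem R)} {g g' : a.obj ⟶ b.obj}
    (h : (Ent.path g).Sublist (Ent.path g')) :
    HomOrder.le (ofPath g : a ⟶ b) (ofPath g') :=
  ⟨.last g', .last g, rfl, rfl, .last _ _ _ (by rw [Category.id_comp]; exact h)⟩

lemma sublist_path {a b : Ent P} (h : b.cell < a.cell) (p : a ⟶ b) :
    (Ent.path (Ent.edge h)).Sublist (Ent.path p) := by
  obtain ⟨k, hk⟩ := (Ent.isWalk_path p).exists_cons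
  have hl := (Ent.isWalk_path p).last_eq
  rw [hk] at hl ⊢
  rw [Ent.path_edge, List.cons_sublist_cons, List.singleton_sublist]
  exact (List.mem_cons.1 (List.mem_of_getLast? hl)).resolve_left h.ne

/-- All insertions are compared in one diagram, without appeal to transitivity. The second half
carries the induction: it gathers the cells inserted into a descent `y > z` into one entrance path
`p` from `y` to `z`, which is above the bare edge. -/
lemma Ins.le_and {τ σ : List P} (h : Ins τ σ) :
    (∀ {a b : Loc (pairSystem R)} {γ' γ : a ⟶ b}, Rep τ γ' → Rep σ γ → HomOrder.le γ' γ) ∧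
    ∀ {y z : P} {l : List P}, τ = y :: z :: l → z < y →
      ∀ {b : Loc (pairSystem R)} {δ : (⟨⟨z⟩⟩ : Loc (pairSystem R)) ⟶ b}
        {γ : (⟨⟨y⟩⟩ : Loc (pairSystem R)) ⟶ b}, Rep (z :: l) δ → Rep σ γ →
        ∃ (p : (⟨y⟩ : Ent P) ⟶ ⟨z⟩) (δ' : (⟨⟨z⟩⟩ : Loc (pairSystem R)) ⟶ b),
          γ = (ofPath p : (⟨⟨y⟩⟩ : Loc (pairSystem R)) ⟶ ⟨⟨z⟩⟩) ≫ δ' ∧ HomOrder.le δ δ' := by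
  induction h with
  | single a =>
    refine ⟨fun h h' => ?_, fun h => by simp at h⟩
    rw [h.unique h']
    exact HomOrder.le_refl _
  | @step x y l m h ih =>
    constructor
    · intro a b γ' γ h₁ h₂
      obtain ⟨δ₁, hδ₁, h₁⟩ := h₁.cons_cons
      obtain ⟨δ₂, hδ₂, h₂⟩ := h₂.cons_cons
      have := ih.1 hδ₁ hδ₂
      rcases h₁ with ⟨hlt, rfl⟩ | ⟨hlt, hR, rfl⟩ <;> rcases h₂ with ⟨hlt', rfl⟩ | ⟨hlt', hR', rfl⟩
      · exact HomOrder.comp_le_comp (HomOrder.le_refl _) this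
      · exact absurd hlt hlt'.not_gt
      · exact absurd hlt hlt'.not_gt
      · exact HomOrder.comp_le_comp (HomOrder.le_refl _) this
    · intro y' z' l' e hlt b δ γ h₁ h₂
      obtain ⟨rfl, e'⟩ := List.cons.inj e
      obtain ⟨rfl, rfl⟩ := List.cons.inj e'
      obtain ⟨δ₂, hδ₂, ⟨hlt', rfl⟩ | ⟨hlt', hR', rfl⟩⟩ := h₂.cons_cons
      · exact ⟨Ent.edge hlt, δ₂, rfl, ih.1 h₁ hδ₂⟩
      · exact absurd hlt hlt'.not_gt
  | @insert x y z l m hyx hzy h ih =>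
    have key : ∀ {b : Loc (pairSystem R)} {δ : (⟨⟨z⟩⟩ : Loc (pairSystem R)) ⟶ b}
        {γ : (⟨⟨x⟩⟩ : Loc (pairSystem R)) ⟶ b}, Rep (z :: l) δ → Rep (x :: y :: m) γ →
        ∃ (p : (⟨x⟩ : Ent P) ⟶ ⟨z⟩) (δ' : (⟨⟨z⟩⟩ : Loc (pairSystem R)) ⟶ b),
          γ = (ofPath p : (⟨⟨x⟩⟩ : Loc (pairSystem R)) ⟶ ⟨⟨z⟩⟩) ≫ δ' ∧ HomOrder.le δ δ' := by
      intro b δ γ h₁ h₂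
      obtain ⟨δ₂, hδ₂, ⟨hlt', rfl⟩ | ⟨hlt', hR', rfl⟩⟩ := h₂.cons_cons
      · obtain ⟨p, δ', rfl, hle⟩ := ih.2 rfl hzy h₁ hδ₂
        exact ⟨Ent.edge (a := ⟨x⟩) hyx ≫ p, δ', (Category.assoc _ _ _).symm, hle⟩
      · exact absurd hyx hlt'.not_gt
    constructor
    · intro a b γ' γ h₁ h₂
      obtain rfl := h₁.obj_eq
      obtain ⟨δ₁, hδ₁, ⟨hlt, rfl⟩ | ⟨hlt, hR, rfl⟩⟩ := h₁.cons_cons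
      · obtain ⟨p, δ', rfl, hle⟩ := key hδ₁ h₂
        exact HomOrder.comp_le_comp (le_ofPath (sublist_path hlt p)) hle
      · exact absurd (hzy.trans hyx) hlt.not_gt
    · intro y' z' l' e hlt b δ γ h₁ h₂
      obtain ⟨rfl, e'⟩ := List.cons.inj e
      obtain ⟨rfl, rfl⟩ := List.cons.inj e'
      exact key h₁ h₂

variable {d : P → ℕ} {h : P → ℝ}

lemma not_pair_of_between (hM : IsMorseMatching R d h) {x y z : P} (hxy : y < x) (hyz : z < y) :
    ¬ R z x := fun hR => by
  have := hM.dim_eq hR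
  have := hM.dim_lt hxy
  have := hM.dim_lt hyz
  omega

/-- As transitivity of `⇒` is not yet known, the successive refinements are collected as insertions
into one walk, starting from the normal form of `γ'` and left unreduced. -/
lemma le_of_refines (hM : IsMorseMatching R d h) {a b : Loc (pairSystem R)} {γ' γ : a ⟶ b}
    (hr : Refines γ' γ) : HomOrder.le γ' γ := by
  suffices ∃ σ, Ins (nf γ') σ ∧ Rep σ γ by
    obtain ⟨σ, hσ, hrep⟩ := this
    exact hσ.le_and.1 (rep_nf γ') hrep
  induction hr with
  | refl =>
    obtain ⟨k, hk⟩ := (isWalk_nf γ').exists_cons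
    exact ⟨nf γ', by rw [hk]; exact .refl _ _, rep_nf γ'⟩
  | tail _ hstep ih =>
    obtain ⟨σ, hσ, hrep⟩ := ih
    obtain ⟨A, hxy, hyz, B⟩ := hstep
    have hn := hrep.nf_eq
    rw [nf_comp_down_comp _ _ _ (not_pair_of_between hM hxy hyz)] at hn
    obtain ⟨U, hU⟩ := (isWalk_nf A).exists_concat
    obtain ⟨V, hV⟩ := (isWalk_nf B).exists_cons
    rw [hU, hV, List.append_assoc, List.singleton_append] at hn
    -- The step to be refined is unmatched, so it appears in the reduced walk and hence already in
    -- `σ`. The parts of `σ` before and after it represent `A` and `B`.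
    obtain ⟨l₁, l₂, rfl, h₁, h₂⟩ := exists_append_of_reduceWalk_eq hn.symm
    refine ⟨_, hσ.insert_append hxy hyz, ?_⟩
    obtain ⟨A', B', hA', hB', -⟩ := hrep.split
    obtain rfl : A' = A := nf_injective (by rw [hA'.nf_eq, h₁, hU])
    rw [List.append_cons]
    have hch := hB'.isChain
    obtain ⟨B'', hB''⟩ := exists_rep (R := R) (b := b) (List.isChain_cons_cons.1 hch).2
      ⟨rfl, by have := hB'.isWalk.last_eq; rwa [List.getLast?_cons_cons] at this⟩
    obtain rfl : B'' = B := nf_injective (by rw [hB''.nf_eq, h₂, hV])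
    exact hA'.comp_down_comp hxy (.down hyz hB'')

lemma le_trans (hM : IsMorseMatching R d h) {a b : Loc (pairSystem R)} {γ₁ γ₂ γ₃ : a ⟶ b}
    (h₁ : HomOrder.le γ₁ γ₂) (h₂ : HomOrder.le γ₂ γ₃) : HomOrder.le γ₁ γ₃ :=
  le_of_refines hM ((refines_of_le hM h₁).trans (refines_of_le hM h₂))

end Loc

end Splitting

/-! ### Morphisms between critical cells: cutting, dimension, finiteness. -/

section Critical

variable {P : Type u} [PartialOrder P] {R : P → P → Prop}

/-- The elements which are not matched. -/
def IsUnmatched (R : P → P → Prop) (x : P) : Prop := (∀ y, ¬ R x y) ∧ ∀ y, ¬ R y x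

namespace Loc

/-- A backtracking centred at `c` would traverse a matched edge at `c`. -/
lemma nf_comp_of_isUnmatched {a b c : Loc (pairSystem R)} (hc : IsUnmatched R c.obj.cell)
    (γ : a ⟶ c) (δ : c ⟶ b) : nf (γ ≫ δ) = nf γ ++ (nf δ).tail := by
  rw [((rep_nf γ).append (rep_nf δ)).nf_eq]
  refine IsReducedWalk.reduceWalk_eq ?_
  obtain ⟨U, hU⟩ := (isWalk_nf γ).exists_concat
  obtain ⟨V, hV⟩ := (isWalk_nf δ).exists_cons
  have hγr := isReducedWalk_nf γ
  have hδr := isReducedWalk_nf δ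
  have hγc := (rep_nf γ).isChain
  have hδc := (rep_nf δ).isChain
  rw [hU] at hγr hγc ⊢
  rw [hV] at hδr hδc ⊢
  rw [List.append_assoc, List.singleton_append, List.tail_cons]
  rcases List.eq_nil_or_concat' U with rfl | ⟨U, p, rfl⟩
  · exact hδr
  · have e : ∀ k, U ++ [p] ++ c.obj.cell :: k = U ++ p :: c.obj.cell :: k := fun k => by simp
    rw [e] at hγr hγc ⊢
    refine hγr.append ?_
    rcases V with _ | ⟨q, V⟩
    · trivial
    · refine ⟨?_, hδr⟩
      rintro rfl
      have h1 := (List.isChain_append.1 hγc).2.1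
      rw [List.isChain_cons_cons] at h1 hδc
      rcases h1.1 with h1 | h1
      · rcases hδc.1 with h2 | h2
        · exact h1.not_gt h2
        · exact hc.1 _ h2.2
      · exact hc.2 _ h1.2

/-- The normal form of `γ ≫ δ` is cut at `c` and also at the refined descent, so this descent lies
wholly before or wholly after `c`. -/
lemma Refine.split {d : P → ℕ} {h : P → ℝ} (hM : IsMorseMatching R d h)
    {a b c : Loc (pairSystem R)} (hc : IsUnmatched R c.obj.cell) {γ : a ⟶ c} {δ : c ⟶ b} {η : a ⟶ b}
    (hr : Refine (γ ≫ δ) η) :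
    ∃ (γ' : a ⟶ c) (δ' : c ⟶ b), η = γ' ≫ δ' ∧ Refines γ γ' ∧ Refines δ δ' := by
  generalize hε : γ ≫ δ = ε at hr
  obtain ⟨A, hxy, hyz, B⟩ := hr
  have hn := nf_comp_of_isUnmatched hc γ δ
  rw [hε, nf_comp_down_comp _ _ _ (not_pair_of_between hM hxy hyz)] at hn
  obtain ⟨G, hG⟩ := (isWalk_nf γ).exists_concat
  obtain ⟨K, hK⟩ := (isWalk_nf δ).exists_cons
  rw [hG, hK, List.append_assoc, List.singleton_append, List.tail_cons] at hn
  have hγ := rep_nf γ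
  have hδ := rep_nf δ
  rw [hG] at hγ
  rw [hK] at hδ
  rcases List.append_eq_append_iff.1 hn with ⟨w, hw, hB⟩ | ⟨w, hA, hw⟩
  · have hBr := rep_nf B
    rw [hB] at hBr
    obtain ⟨B₁, B₂, hB₁, hB₂, rfl⟩ := hBr.split
    obtain rfl := hB₂.unique hδ
    have h1 := (rep_nf A).comp_down_comp (hyz.trans hxy) hB₁
    rw [← List.append_assoc, ← hw] at h1
    obtain rfl := h1.unique hγ
    exact ⟨A ≫ down hxy ≫ down hyz ≫ B₁, B₂, by simp only [Category.assoc],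
      .single (.mk A hxy hyz B₁), .refl⟩
  -- If `w` is empty, `c` is the first cell of `B`, that is, the lower end of the refined descent.
  · rcases w with _ | ⟨c', w⟩
    · rw [List.nil_append] at hw
      have hBr := rep_nf B
      rw [← hw] at hBr
      obtain ⟨B₁, B₂, hB₁, hB₂, rfl⟩ := Rep.split (l₁ := []) hBr
      obtain rfl := hB₂.unique hδ
      have h1 := (rep_nf A).comp_down_comp (hyz.trans hxy) hB₁
      rw [List.nil_append, hA, List.append_nil] at h1
      obtain rfl := h1.unique hγ
      exact ⟨A ≫ down hxy ≫ down hyz ≫ B₁, B₂, by simp only [Category.assoc],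
        .single (.mk A hxy hyz B₁), .refl⟩
    · obtain ⟨rfl, hw⟩ := List.cons.inj hw
      have hAr := rep_nf A
      rw [hA] at hAr
      obtain ⟨A₁, A₂, hA₁, hA₂, rfl⟩ := hAr.split
      obtain rfl := hA₁.unique hγ
      have h1 := hA₂.comp_down_comp (hyz.trans hxy) (rep_nf B)
      rw [← hw] at h1
      obtain rfl := h1.unique hδ
      exact ⟨A₁, A₂ ≫ down hxy ≫ down hyz ≫ B, by simp only [Category.assoc],
        .refl, .single (.mk A₂ hxy hyz B)⟩

lemma le_split {d : P → ℕ} {h : P → ℝ} (hM : IsMorseMatching R d h)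
    {a b c : Loc (pairSystem R)} (hc : IsUnmatched R c.obj.cell) {γ : a ⟶ c} {δ : c ⟶ b} {η : a ⟶ b}
    (hle : HomOrder.le (γ ≫ δ) η) :
    ∃ (γ' : a ⟶ c) (δ' : c ⟶ b), η = γ' ≫ δ' ∧ HomOrder.le γ γ' ∧ HomOrder.le δ δ' := by
  suffices ∃ (γ' : a ⟶ c) (δ' : c ⟶ b), η = γ' ≫ δ' ∧ Refines γ γ' ∧ Refines δ δ' by
    obtain ⟨γ', δ', e, h₁, h₂⟩ := this
    exact ⟨γ', δ', e, le_of_refines hM h₁, le_of_refines hM h₂⟩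
  have hr := refines_of_le hM hle
  induction hr with
  | refl => exact ⟨γ, δ, rfl, .refl, .refl⟩
  | tail h' hstep ih =>
    obtain ⟨γ', δ', rfl, h₁, h₂⟩ := ih (le_of_refines hM h')
    obtain ⟨γ'', δ'', rfl, h₁', h₂'⟩ := hstep.split hM hc
    exact ⟨γ'', δ'', rfl, h₁.trans h₁', h₂.trans h₂'⟩

/-- Both composites have the same list of cells, cut at `c` and at `c'`. The segment between the
cuts is `κ`. -/
lemma equidivisible {a b c c' : Loc (pairSystem R)} (hc : IsUnmatched R c.obj.cell)
    (hc' : IsUnmatched R c'.obj.cell) {γ : a ⟶ c} {δ : c ⟶ b} {γ' : a ⟶ c'} {δ' : c' ⟶ b}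
    (e : γ ≫ δ = γ' ≫ δ') :
    (∃ κ : c ⟶ c', γ' = γ ≫ κ ∧ δ = κ ≫ δ') ∨ ∃ κ : c' ⟶ c, γ = γ' ≫ κ ∧ δ' = κ ≫ δ := by
  have aux : ∀ {c c' : Loc (pairSystem R)} {γ : a ⟶ c} {δ : c ⟶ b} {γ' : a ⟶ c'} {δ' : c' ⟶ b}
      {G K G' K' w : List P}, Rep (G ++ [c.obj.cell]) γ → Rep (c.obj.cell :: K) δ →
      Rep (G' ++ [c'.obj.cell]) γ' → Rep (c'.obj.cell :: K') δ' → G' = G ++ w →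
      c.obj.cell :: K = w ++ c'.obj.cell :: K' → ∃ κ : c ⟶ c', γ' = γ ≫ κ ∧ δ = κ ≫ δ' := by
    intro c c' γ δ γ' δ' G K G' K' w hγ hδ hγ' hδ' e₁ e₂
    rw [e₂] at hδ
    obtain ⟨κ, δ'', hκ, hδ'', rfl⟩ := hδ.split
    obtain rfl := hδ''.unique hδ'
    refine ⟨κ, ?_, rfl⟩
    have h1 := hγ.append hκ
    obtain ⟨k, hk⟩ : ∃ k, w ++ [c'.obj.cell] = c.obj.cell :: k := by
      rcases w with _ | ⟨x, w⟩
      · obtain ⟨h, -⟩ := List.cons.inj e₂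
        exact ⟨[], by rw [h]; rfl⟩
      · obtain ⟨rfl, -⟩ := List.cons.inj e₂
        exact ⟨_, rfl⟩
    rw [hk, List.append_assoc, List.tail_cons, List.singleton_append, ← hk, ← List.append_assoc,
      ← e₁] at h1
    exact hγ'.unique h1
  obtain ⟨G, hG⟩ := (isWalk_nf γ).exists_concat
  obtain ⟨K, hK⟩ := (isWalk_nf δ).exists_cons
  obtain ⟨G', hG'⟩ := (isWalk_nf γ').exists_concat
  obtain ⟨K', hK'⟩ := (isWalk_nf δ').exists_cons
  have hn := congrArg nf e
  rw [nf_comp_of_isUnmatched hc, nf_comp_of_isUnmatched hc', hG, hK, hG', hK', List.append_assoc,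
    List.append_assoc, List.singleton_append, List.singleton_append, List.tail_cons,
    List.tail_cons] at hn
  have hγ := rep_nf γ
  have hδ := rep_nf δ
  have hγ' := rep_nf γ'
  have hδ' := rep_nf δ'
  rw [hG] at hγ
  rw [hK] at hδ
  rw [hG'] at hγ'
  rw [hK'] at hδ'
  rcases List.append_eq_append_iff.1 hn with ⟨w, h₁, h₂⟩ | ⟨w, h₁, h₂⟩
  · exact Or.inl (aux hγ hδ hγ' hδ' h₁ h₂)
  · exact Or.inr (aux hγ' hδ' hγ hδ h₁ h₂)

variable {d : P → ℕ} {h : P → ℝ}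

/-- An ascent gains exactly one dimension, follows a descent that lost at least one, and must be
followed by another descent, since matched pairs do not chain and `b` is not the upper cell of a
pair. The bound `n` on the length allows the induction to skip two cells. -/
lemma dim_lt_of_isChain (hM : IsMorseMatching R d h) {b : P} (hb : ∀ y, ¬ R y b) {n : ℕ} :
    ∀ {x y : P} {l : List P}, l.length ≤ n → y < x → (x :: y :: l).IsChain (IsStep R) →
      IsReducedWalk (x :: y :: l) → (x :: y :: l).getLast? = some b → d b < d x := by
  induction n with
  | zero =>
    intro x y l hn hyx _ _ hl
    obtain rfl := List.length_eq_zero_iff.1 (Nat.le_zero.1 hn)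
    obtain rfl : y = b := by simpa using hl
    exact hM.dim_lt hyx
  | succ n ih =>
    intro x y l hn hyx hch hred hl
    have h1 := hM.dim_lt hyx
    rcases l with _ | ⟨z, l⟩
    · obtain rfl : y = b := by simpa using hl
      exact h1
    · rw [List.isChain_cons_cons, List.isChain_cons_cons] at hch
      rw [List.getLast?_cons_cons] at hl
      simp only [List.length_cons] at hn
      rcases hch.2.1 with hzy | ⟨hyz, hR⟩
      · exact (ih (by omega) hzy (List.isChain_cons_cons.2 hch.2) hred.2 hl).trans h1
      · have h2 := hM.dim_eq hR
        rw [List.getLast?_cons_cons] at hl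
        rcases l with _ | ⟨w, l⟩
        · obtain rfl : z = b := by simpa using hl
          exact absurd hR (hb y)
        · have hch' := hch.2.2
          rcases (List.isChain_cons_cons.1 hch').1 with hwz | ⟨-, hR'⟩
          · simp only [List.length_cons] at hn
            have := ih (by omega) hwz hch' hred.2.2 hl
            omega
          · exact absurd hR' (hM.not_both hR)

lemma dim_lt_of_hom (hM : IsMorseMatching R d h) {a b : Loc (pairSystem R)}
    (ha : IsUnmatched R a.obj.cell) (hb : IsUnmatched R b.obj.cell) (γ : a ⟶ b)
    (hγ : ¬ ∃ h : a = b, γ = eqToHom h) : d b.obj.cell < d a.obj.cell := by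
  have hrep := rep_nf γ
  have hred := isReducedWalk_nf γ
  obtain ⟨k, hk⟩ := (isWalk_nf γ).exists_cons
  rw [hk] at hrep hred
  rcases k with _ | ⟨y, k⟩
  · obtain rfl : a = b := Loc.ext (Ent.ext (by simpa using hrep.isWalk.last_eq))
    exact absurd ⟨rfl, hrep.eq_id⟩ hγ
  · have hch := hrep.isChain
    rcases (List.isChain_cons_cons.1 hch).1 with h | ⟨-, hR⟩
    · exact dim_lt_of_isChain hM hb.2 le_rfl h hch hred hrep.isWalk.last_eq
    · exact absurd hR (ha.1 y)

/-- Well-founded induction on `(d, h)` in lexicographic order. A walk descending from `x` next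
descends either from `y < x`, or from `z ≠ x` after an ascent; both are smaller, the latter by
acyclicity. -/
lemma finite_setOf_isChain [Finite P] (hM : IsMorseMatching R d h) (x : P) :
    {l : List P | ∃ y k, l = x :: y :: k ∧ y < x ∧ l.IsChain (IsStep R) ∧ IsReducedWalk l}.Finite := by
  let r : P → P → Prop := fun x' x => d x' < d x ∨ d x' = d x ∧ h x' < h x
  have : IsTrans P r := ⟨fun a b c h₁ h₂ => by
    rcases h₁ with h₁ | ⟨h₁, h₁'⟩ <;> rcases h₂ with h₂ | ⟨h₂, h₂'⟩
    · exact Or.inl (h₁.trans h₂)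
    · exact Or.inl (h₂ ▸ h₁)
    · exact Or.inl (h₁ ▸ h₂)
    · exact Or.inr ⟨h₁.trans h₂, h₁'.trans h₂'⟩⟩
  have : Std.Irrefl r := ⟨fun a h₁ => by
    rcases h₁ with h₁ | ⟨-, h₁⟩
    · exact h₁.false
    · exact h₁.false⟩
  have hwf : WellFounded r := Finite.wellFounded_of_trans_of_irrefl r
  induction x using hwf.induction with
  | _ x ih =>
    let S : P → Set (List P) := fun x =>
      {l | ∃ y k, l = x :: y :: k ∧ y < x ∧ l.IsChain (IsStep R) ∧ IsReducedWalk l}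
    -- The four families: one step, a walk ending after an ascent, a second descent at once, and a
    -- second descent after an ascent.
    refine Set.Finite.subset (s := (⋃ y, {[x, y]}) ∪ (⋃ y, ⋃ z, {[x, y, z]}) ∪
      (⋃ y ∈ {y | r y x}, (x :: ·) '' S y) ∪
      ⋃ y, ⋃ z ∈ {z | r z x}, (fun l => x :: y :: l) '' S z) ?_ ?_
    · refine (((Set.finite_iUnion fun y => Set.finite_singleton _).union
        (Set.finite_iUnion fun y => Set.finite_iUnion fun z => Set.finite_singleton _)).union
        ((Set.toFinite _).biUnion fun y hy => (ih y hy).image _)).union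
        (Set.finite_iUnion fun y => (Set.toFinite _).biUnion fun z hz => (ih z hz).image _)
    · rintro _ ⟨y, k, rfl, hyx, hch, hred⟩
      rcases k with _ | ⟨z, k⟩
      · exact Or.inl (Or.inl (Or.inl (Set.mem_iUnion.2 ⟨y, rfl⟩)))
      · have hch' := (List.isChain_cons_cons.1 hch).2
        rcases (List.isChain_cons_cons.1 hch').1 with hzy | ⟨hyz, hR⟩
        · exact Or.inl (Or.inr (Set.mem_biUnion (x := y) (Or.inl (hM.dim_lt hyx))
            ⟨_, ⟨z, k, rfl, hzy, hch', hred.2⟩, rfl⟩))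
        · rcases k with _ | ⟨w, k⟩
          · exact Or.inl (Or.inl (Or.inr (Set.mem_iUnion.2 ⟨y, Set.mem_iUnion.2 ⟨z, rfl⟩⟩)))
          · have hch'' := (List.isChain_cons_cons.1 hch').2
            rcases (List.isChain_cons_cons.1 hch'').1 with hwz | ⟨-, hR'⟩
            · exact Or.inr (Set.mem_iUnion.2 ⟨y, Set.mem_biUnion (x := z)
                (hM.acyclic hyx hR hred.1.symm) ⟨_, ⟨w, k, rfl, hwz, hch'', hred.2.2⟩, rfl⟩⟩)
            · exact absurd hR' (hM.not_both hR)

lemma finite_hom [Finite P] (hM : IsMorseMatching R d h) {a b : Loc (pairSystem R)}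
    (ha : IsUnmatched R a.obj.cell) : Finite (a ⟶ b) := by
  have hfin := (Set.finite_singleton [a.obj.cell]).union (finite_setOf_isChain hM a.obj.cell)
  have := hfin.to_subtype
  refine Finite.of_injective (fun γ : a ⟶ b => (⟨nf γ, ?_⟩ : ↥({[a.obj.cell]} ∪
    {l : List P | ∃ y k, l = a.obj.cell :: y :: k ∧ y < a.obj.cell ∧
      l.IsChain (IsStep R) ∧ IsReducedWalk l}))) fun γ γ' e => nf_injective (Subtype.ext_iff.1 e)
  have hch := (rep_nf γ).isChain
  have hred := isReducedWalk_nf γ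
  obtain ⟨k, hk⟩ := (isWalk_nf γ).exists_cons
  rw [hk] at hch hred ⊢
  rcases k with _ | ⟨y, k⟩
  · exact Or.inl rfl
  · rcases (List.isChain_cons_cons.1 hch).1 with h | ⟨-, hR⟩
    · exact Or.inr ⟨y, k, rfl, h, hch, hred⟩
    · exact absurd hR (ha.1 y)

end Loc

end Critical

/-! ### Equidivisible categories and chains of morphisms. -/

section UniqueFactorization

variable {C : Type u} [Category.{v} C]

/-- A category with a rank function that drops along non-identity morphisms and in which two
factorizations of a morphism have a common refinement. -/
structure IsEquidivisible (C : Type u) [Category.{v} C] (r : C → ℕ) : Prop where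
  rank_lt {a b : C} (f : a ⟶ b) : ¬ IsIdentity f → r b < r a
  equidivisible {a b c c' : C} {g : a ⟶ c} {k : c ⟶ b} {g' : a ⟶ c'} {k' : c' ⟶ b} :
    g ≫ k = g' ≫ k' →
      (∃ κ : c ⟶ c', g' = g ≫ κ ∧ k = κ ≫ k') ∨ ∃ κ : c' ⟶ c, g = g' ≫ κ ∧ k' = κ ≫ k

lemma IsIndecomposableString.comp {a b : C} {p : Quiver.Path a b} (hp : IsIndecomposableString p)
    {c : C} {q : Quiver.Path b c} (hq : IsIndecomposableString q) :
    IsIndecomposableString (p.comp q) := by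
  induction q with
  | nil => exact hp
  | cons q e ih => exact ⟨ih hq.1, hq.2⟩

namespace IsEquidivisible

variable {r : C → ℕ}

lemma rank_le (hC : IsEquidivisible C r) {a b : C} (f : a ⟶ b) : r b ≤ r a := by
  by_cases hf : IsIdentity f
  · obtain ⟨rfl, -⟩ := hf
    exact le_rfl
  · exact (hC.rank_lt f hf).le

lemma eq_id (hC : IsEquidivisible C r) {a : C} (f : a ⟶ a) : f = 𝟙 a := by
  by_cases hf : IsIdentity f
  · exact hf.choose_spec
  · exact absurd (hC.rank_lt f hf) (lt_irrefl _)

/-- With a common middle object, the comparison map is an endomorphism, hence an identity. -/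
lemma eq_of_comp_eq (hC : IsEquidivisible C r) {a b c : C} {g g' : a ⟶ c} {k k' : c ⟶ b}
    (e : g ≫ k = g' ≫ k') : g' = g ∧ k' = k := by
  rcases hC.equidivisible e with ⟨κ, h₁, h₂⟩ | ⟨κ, h₁, h₂⟩ <;> rw [hC.eq_id κ] at h₁ h₂ <;> simp_all

lemma isFiniteDirected (hC : IsEquidivisible C r) [Finite C] (hfin : ∀ a b : C, Finite (a ⟶ b)) :
    IsFiniteDirected C where
  finite_obj := inferInstance
  finite_hom := hfin
  eq_id := hC.eq_id
  isEmpty_hom := by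
    rintro a b hab ⟨f⟩
    refine ⟨fun g => ?_⟩
    have := hC.rank_lt f fun h => hab h.choose
    exact absurd (hC.rank_le g) (by omega)

lemma exists_factorization (hC : IsEquidivisible C r) {a b : C} (f : a ⟶ b) :
    ∃ p : Quiver.Path a b, IsIndecomposableString p ∧ composePath p = f := by
  induction hn : r a - r b using Nat.strong_induction_on generalizing a b with
  | _ n ih =>
    by_cases hf : IsIdentity f
    · obtain ⟨rfl, rfl⟩ := hf
      exact ⟨.nil, trivial, rfl⟩
    · by_cases hi : IsIndecomposable f
      · exact ⟨(Quiver.Path.nil).cons f, ⟨trivial, hf, hi⟩, by simp⟩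
      · obtain ⟨z, g, h, hg, hh, rfl⟩ := not_not.1 hi
        have h₁ := hC.rank_lt g hg
        have h₂ := hC.rank_lt h hh
        obtain ⟨p, hp, rfl⟩ := ih (r a - r z) (by omega) g rfl
        obtain ⟨q, hq, rfl⟩ := ih (r z - r b) (by omega) h rfl
        exact ⟨p.comp q, hp.comp hq, composePath_comp p q⟩

lemma comp_ne_id (hC : IsEquidivisible C r) {a c : C} (g : a ⟶ c) {e : c ⟶ a}
    (he : ¬ IsIdentity e) : False :=
  absurd (hC.rank_le g) (hC.rank_lt e he).not_ge

lemma _root_.IsIndecomposable.isIdentity_left {c c' b : C} {e : c ⟶ b} (he : IsIndecomposable e)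
    {e' : c' ⟶ b} (he' : ¬ IsIdentity e') {κ : c ⟶ c'} (h : e = κ ≫ e') : IsIdentity κ :=
  not_not.1 fun hκ => he ⟨_, _, _, hκ, he', h⟩

/-- Compare the last factors: the map relating them is an identity by indecomposability. So they
agree and can be stripped off. -/
lemma eq_of_composePath_eq (hC : IsEquidivisible C r) {a b : C} {p q : Quiver.Path a b}
    (hp : IsIndecomposableString p) (hq : IsIndecomposableString q)
    (e : composePath p = composePath q) : p = q := by
  induction p with
  | nil =>
    cases q with
    | nil => rfl
    | cons q k' => exact (hC.comp_ne_id (composePath q) hq.2.1).elim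
  | cons p k ih =>
    cases q with
    | nil => exact (hC.comp_ne_id (composePath p) hp.2.1).elim
    | cons q k' =>
      rw [composePath_cons, composePath_cons] at e
      rcases hC.equidivisible e with ⟨κ, h₁, h₂⟩ | ⟨κ, h₁, h₂⟩
      · obtain ⟨rfl, rfl⟩ := hp.2.2.isIdentity_left hq.2.1 h₂
        obtain rfl : k = k' := by simpa using h₂
        rw [ih hp.1 hq.1 (by simpa using h₁.symm)]
      · obtain ⟨rfl, rfl⟩ := hq.2.2.isIdentity_left hp.2.1 h₂
        obtain rfl : k' = k := by simpa using h₂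
        rw [ih hp.1 hq.1 (by simpa using h₁)]

lemma isUniqueFactorizationCategory (hC : IsEquidivisible C r) [Finite C]
    (hfin : ∀ a b : C, Finite (a ⟶ b)) : IsUniqueFactorizationCategory C where
  __ := hC.isFiniteDirected hfin
  existsUnique_factorization f _ := by
    obtain ⟨p, hp, rfl⟩ := hC.exists_factorization f
    exact ⟨p, ⟨hp, rfl⟩, fun q hq => hC.eq_of_composePath_eq hq.1 hp hq.2⟩

variable [HomOrder C]

/-- A comparison map at entry `0` spreads to entry `i` by splitting `κ ≫ K'.1 0 ⇒ K.1 i`. The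
factorization through a given object is unique, so the second part is `K'.1 i`. The same argument
makes the entries monotone. -/
lemma exists_lift (hC : IsEquidivisible C r)
    (hsplit : ∀ {a b c : C} {g : a ⟶ c} {k : c ⟶ b} {f : a ⟶ b}, HomOrder.le (g ≫ k) f →
      ∃ (g' : a ⟶ c) (k' : c ⟶ b), f = g' ≫ k' ∧ HomOrder.le g g' ∧ HomOrder.le k k')
    {n : ℕ} {a b c c' : NNLevel C n} {G : a ⟶ c} {K : c ⟶ b} {G' : a ⟶ c'} {K' : c' ⟶ b}
    (e : G ≫ K = G' ≫ K') {κ : c.as ⟶ c'.as} (hκ : K.1 0 = κ ≫ K'.1 0) :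
    ∃ κ : c ⟶ c', G' = G ≫ κ ∧ K = κ ≫ K' := by
  have ei (i) : G.1 i ≫ K.1 i = G'.1 i ≫ K'.1 i := congrFun (congrArg Subtype.val e) i
  have h (i) : ∃ μ : c.as ⟶ c'.as, G'.1 i = G.1 i ≫ μ ∧ K.1 i = μ ≫ K'.1 i := by
    have hle := K.2 0 i (Fin.zero_le i)
    rw [hκ] at hle
    obtain ⟨μ, ν, hμ, -, -⟩ := hsplit hle
    have e' := ei i
    rw [hμ, ← Category.assoc] at e'
    obtain ⟨h₁, h₂⟩ := hC.eq_of_comp_eq e'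
    exact ⟨μ, h₁, by rw [h₂, hμ]⟩
  choose μ hμ₁ hμ₂ using h
  refine ⟨⟨μ, fun i j hij => ?_⟩, Subtype.ext (funext hμ₁), Subtype.ext (funext hμ₂)⟩
  have hle := K.2 i j hij
  rw [hμ₂ i] at hle
  obtain ⟨x, y, hxy, hx, -⟩ := hsplit hle
  rw [hμ₂ j] at hxy
  rwa [(hC.eq_of_comp_eq hxy).1] at hx

lemma nnLevel (hC : IsEquidivisible C r)
    (hsplit : ∀ {a b c : C} {g : a ⟶ c} {k : c ⟶ b} {f : a ⟶ b}, HomOrder.le (g ≫ k) f →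
      ∃ (g' : a ⟶ c) (k' : c ⟶ b), f = g' ≫ k' ∧ HomOrder.le g g' ∧ HomOrder.le k k') (n : ℕ) :
    IsEquidivisible (NNLevel C n) (fun a => r a.as) where
  rank_lt := by
    rintro ⟨a⟩ ⟨b⟩ F hF
    by_contra hr
    have hid (i) : IsIdentity (F.1 i) := not_not.1 fun h => hr (hC.rank_lt _ h)
    obtain rfl : a = b := (hid 0).choose
    exact hF ⟨rfl, Subtype.ext (funext fun i => hC.eq_id (F.1 i))⟩
  equidivisible {a b c c' G K G' K'} e := by
    have e0 : G.1 0 ≫ K.1 0 = G'.1 0 ≫ K'.1 0 := congrFun (congrArg Subtype.val e) 0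
    rcases hC.equidivisible e0 with ⟨κ, -, h⟩ | ⟨κ, -, h⟩
    · exact Or.inl (hC.exists_lift hsplit e h)
    · exact Or.inr (hC.exists_lift hsplit e.symm h)

end IsEquidivisible

lemma NNLevel.finite (C : Type u) [Finite C] (n : ℕ) : Finite (NNLevel C n) :=
  Finite.of_injective NNLevel.as fun _ _ h => NNLevel.ext h

lemma NNLevel.finite_hom [HomOrder C] (hfin : ∀ a b : C, Finite (a ⟶ b)) {n : ℕ}
    (a b : NNLevel C n) : Finite (a ⟶ b) := by
  have := hfin a.as b.as
  exact inferInstanceAs (Finite {F : Fin (n + 1) → (a.as ⟶ b.as) //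
    ∀ i j, i ≤ j → HomOrder.le (F i) (F j)})

end UniqueFactorization

/-! ### Discrete Morse functions and conclusion. -/

section Main

variable {X : Type u} [TopologicalSpace X] {K : Set X} [CWComplex K]

lemma IsRegularPair.lt {f : CWCell K → ℝ} {x y : CWCell K} (h : IsRegularPair f x y) : x < y :=
  lt_of_le_of_ne h.2.1 fun e => by have := h.1; rw [e] at this; omega

/-- No cell is both the larger cell of one regular pair and the smaller cell of another one. -/
lemma IsDiscreteMorse.not_isRegularPair [T2Space X] [RelCWComplex.Finite K] (hK : IsRegularCW K) {f : CWCell K → ℝ}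
    (hf : IsDiscreteMorse f) {x y z : CWCell K} (hxy : IsRegularPair f x y) :
    ¬ IsRegularPair f y z := by
  intro hyz
  obtain ⟨y', hne, hd, hx, hz⟩ := CWCell.exists_ne_between hK hxy.2.1 hyz.2.1 hxy.1 hyz.1
  have h₁ : f x < f y' := by
    by_contra h
    exact hne (hf.upper x ⟨by rw [hd, hxy.1], hx, not_lt.1 h⟩ hxy)
  have h₂ : f y' < f z := by
    by_contra h
    exact hne (hf.lower z ⟨by rw [hd, hyz.1], hz, not_lt.1 h⟩ hyz)
  have := hxy.2.2
  have := hyz.2.2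
  linarith

/-- The Morse function serves as height: if `y' ≠ y` have equal dimension and `x` is paired with
`y'`, then it is not paired with `y`, so `f y' ≤ f x < f y`. -/
lemma IsDiscreteMorse.isMorseMatching [T2Space X] [RelCWComplex.Finite K] (hK : IsRegularCW K) {f : CWCell K → ℝ}
    (hf : IsDiscreteMorse f) : IsMorseMatching (IsRegularPair f) CWCell.dim f where
  dim_lt := CWCell.dim_lt_of_lt
  lt := IsRegularPair.lt
  dim_eq h := h.1
  not_both h := hf.not_isRegularPair hK h
  acyclic {x y y'} hxy h hne := by
    have hd := CWCell.dim_lt_of_lt hxy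
    have hd' := h.1
    rcases (show y'.dim < y.dim ∨ y'.dim = y.dim by omega) with hlt | heq
    · exact Or.inl hlt
    · refine Or.inr ⟨heq, lt_of_le_of_lt h.2.2 (not_le.1 fun hle => hne ?_)⟩
      exact hf.upper x h ⟨by omega, hxy.le, hle⟩

lemma IsCriticalCell.isUnmatched {f : CWCell K → ℝ} {x : CWCell K} (h : IsCriticalCell f x) :
    IsUnmatched (IsRegularPair f) x :=
  ⟨fun y hy => h.1 ⟨y, hy⟩, fun y hy => h.2 ⟨y, hy⟩⟩

/-- `morseSystem f` unfolds to `pairSystem (IsRegularPair f)`, so the results on matchings apply,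
with dimension as rank. -/
lemma Flo.isEquidivisible {f : CWCell K → ℝ}
    (hM : IsMorseMatching (IsRegularPair f) CWCell.dim f) :
    IsEquidivisible (Flo f) (fun a => a.obj.obj.cell.dim) where
  rank_lt {a b} γ hγ := by
    refine Loc.dim_lt_of_hom hM a.property.isUnmatched b.property.isUnmatched γ.hom ?_
    rintro ⟨h, hγ'⟩
    obtain ⟨a, ha⟩ := a
    obtain ⟨b, hb⟩ := b
    obtain rfl : a = b := h
    exact hγ ⟨rfl, InducedCategory.hom_ext hγ'⟩
  equidivisible {a b c c' g k g' k'} e := by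
    rcases Loc.equidivisible (R := IsRegularPair f) c.property.isUnmatched c'.property.isUnmatched
      (congrArg InducedCategory.Hom.hom e) with ⟨κ, h₁, h₂⟩ | ⟨κ, h₁, h₂⟩
    · exact Or.inl ⟨⟨κ⟩, InducedCategory.hom_ext h₁, InducedCategory.hom_ext h₂⟩
    · exact Or.inr ⟨⟨κ⟩, InducedCategory.hom_ext h₁, InducedCategory.hom_ext h₂⟩

lemma Flo.le_split {f : CWCell K → ℝ} (hM : IsMorseMatching (IsRegularPair f) CWCell.dim f)
    {a b c : Flo f} {g : a ⟶ c} {k : c ⟶ b} {h : a ⟶ b} (hle : HomOrder.le (g ≫ k) h) :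
    ∃ (g' : a ⟶ c) (k' : c ⟶ b), h = g' ≫ k' ∧ HomOrder.le g g' ∧ HomOrder.le k k' := by
  obtain ⟨g', k', e, h₁, h₂⟩ := Loc.le_split (γ := g.hom) (δ := k.hom) hM c.property.isUnmatched hle
  exact ⟨⟨g'⟩, ⟨k'⟩, InducedCategory.hom_ext e, h₁, h₂⟩

lemma Flo.finite [RelCWComplex.Finite K] (f : CWCell K → ℝ) : Finite (Flo f) :=
  Finite.of_injective (fun a => a.obj.obj.cell) fun _ _ h =>
    ObjectProperty.FullSubcategory.ext (Loc.ext (Ent.ext h))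

lemma Flo.finite_hom [RelCWComplex.Finite K] {f : CWCell K → ℝ}
    (hM : IsMorseMatching (IsRegularPair f) CWCell.dim f) (a b : Flo f) : Finite (a ⟶ b) := by
  have : Finite (a.obj ⟶ b.obj) := Loc.finite_hom hM a.property.isUnmatched
  exact Finite.of_injective (β := (a.obj ⟶ b.obj)) (fun γ => γ.hom)
    fun _ _ h => InducedCategory.hom_ext h

end Main

theorem mainTheorem8 {X : Type u} [TopologicalSpace X] [T2Space X] (K : Set X)
    [CWComplex K] [RelCWComplex.Finite K] (hK : IsRegularCW K)
    (f : CWCell K → ℝ) (hf : IsDiscreteMorse f) :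
    IsPCategory (Flo f) ∧
      ∀ n : ℕ, IsUniqueFactorizationCategory ((NN (Flo f)).obj (Opposite.op (SimplexCategory.mk n))) := by
  have hM := hf.isMorseMatching hK
  refine ⟨⟨fun h h' => Loc.le_trans hM h h', fun h h' =>
    InducedCategory.hom_ext (Loc.le_antisymm hM h h')⟩, fun n => ?_⟩
  have := Flo.finite f
  have := NNLevel.finite (Flo f) n
  exact ((Flo.isEquidivisible hM).nnLevel (Flo.le_split hM) n).isUniqueFactorizationCategory
    (NNLevel.finite_hom (Flo.finite_hom hM))
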